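/- **Definitions.** Graphs are finite, loops and multiple edges are allowed. A *type* $(G,w,r)$ is a connected graph $G$ with weights $w:V(G)\to\mathbb Z_{\ge 0}$ such that every vertex of weight $0$ has valence at least $3$, and an equivalence relation $r$ on $E(G)$. Its genus is $|E(G)|-|V(G)|+1+\sum_v w(v)$. An isomorphism of types is an isomorphism of graphs that respects the weights and the relations. Let $G^w_-$ be the loopless graph obtained from $G$ by adding $w(v)$ loops at each vertex $v$ and then placing a vertex in the interior of every loop. A *morphism* $\varphi:H\to H'$ of loopless graphs maps vertices to vertices and every edge either to a vertex (then its ends are mapped to the same vertex) or to an edge joining the images of its ends; it is *harmonic* if for every vertex $x$ the number $m_\varphi(x)$ of edges at $x$ lying over an edge $e'$ at $\varphi(x)$ does not depend on $e'$, *nondegenerate* if $m_\varphi(x)>0$ for all $x$, and of *degree* $2$ if $H'$ has an edge and every edge of $H'$ has exactly two edges over it. The type $(G,w,r)$ is *2-edge-connected hyperelliptic* if $G$ is connected and stays connected after removal of any one edge, and there is a harmonic morphism $\varphi$ from $G^w_-$ to a tree such that either $\varphi$ is nondegenerate of degree $2$, or $G^w_-$ has two vertices and the tree is a single vertex; and two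 distinct edges of $G$ are $r$-equivalent if and only if both are non-loops and $\varphi$ maps them to the same edge of the tree. Let $\mathcal C_g^{(2)}$ be the collection of 2-edge-connected hyperelliptic types of genus $g$. A point of the closed orthant $\mathbb R_{\ge 0}^{E(G)/r}$ assigns lengths to the edges of $G$, equal on $r$-equivalent edges. The space $H_g^{(2),\mathrm{tr}}$ is the quotient of $\coprod_{(G,w,r)\in\mathcal C_g^{(2)}}\mathbb R_{\ge 0}^{E(G)/r}$, with the quotient topology, by the relation that identifies two points if contracting all edges of length zero (contracting a loop adds $1$ to the weight of its vertex; contracting a non-loop adds the weights of its ends) gives isomorphic weighted graphs with edge lengths. Each type gives a continuous map $\alpha_{(G,w,r)}:\mathbb R_{\ge 0}^{E(G)/r}/\mathrm{Aut}(G,w,r)\to H_g^{(2),\mathrm{tr}}$. A *stacky fan* is a topological space $X$ with finitely many full-dimensional rational open polyhedral cones $X_i\subseteq\mathbb R^{m_i}$, subgroups $\Gamma_i\subseteq GL_{m_i}(\mathbb Z)$ preserving $X_i$, and continuous maps $\alpha_i:\overline{X_i}/\Gamma_i\to X$, with images $\overline{C_i}$ and $C_i=\alpha_i(X_i/\Gamma_i)$,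 such that: (i) $\alpha_i$ restricts to a homeomorphism $X_i/\Gamma_i\to C_i$; (ii) $X$ is the disjoint union of the $C_i$; (iii) for every face $F$ of $\overline{X_i}$ there is an $l$ with $\alpha_i(F)=\overline{C_l}$ and a linear isomorphism $L:\mathrm{span}(F)\to\mathbb R^{m_l}$ that maps $F$ onto $\overline{X_l}$ and $\mathrm{span}(F)\cap\mathbb Z^{m_i}$ onto $\mathbb Z^{m_l}$, with $\alpha_l\circ L=\alpha_i$ on $F$ (then $\overline{C_l}$ is called a stacky face of $\overline{C_i}$); (iv) $\overline{C_i}\cap\overline{C_j}$ is the union of the common stacky faces of $\overline{C_i}$ and $\overline{C_j}$. The dimension of the cell $C_i$ is $m_i$; a cell is maximal if its closed cell $\overline{C_i}$ is not properly contained in another closed cell; the stacky fan is *pure of dimension $d$* if $d$ is the largest dimension of a cell and all maximal cells have dimension $d$. For a tree $T$ with at least two vertices and maximum valence at most $3$, the *ladder* $L(T)$ consists of two disjoint copies of $T$ together with two edges between the two copies of each vertex of valence $1$ and one edge between the two copies of each vertex of valence $2$ of $T$. **Theorem.** Let $g\ge 3$. The space $H_g^{(2),\mathrm{tr}}$, with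 the maps $\alpha_{(G,w,r)}$ for one representative of each isomorphism class of types in $\mathcal C_g^{(2)}$, is a stacky fan. It is pure of dimension $2g-1$. The cell of $(G,w,r)$ is maximal if and only if $w=0$ and $G$ is isomorphic to a ladder $L(T)$ of genus $g$. The map that sends a tree $T$ to the cell of $L(T)$, with weights $0$ and the relation that identifies the two copies of each edge of $T$, is a bijection from the isomorphism classes of trees on $g-1$ vertices with maximum valence at most $3$ to the maximal cells. -/

import Mathlib

open Set

namespace HypTrop

/-! ### Finite weighted multigraphs -/

/-- A finite multigraph (loops and multiple edges allowed) with a weight function on its vertices.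
An edge has an unordered pair of ends; it is a loop when the pair is on the diagonal. -/
structure WGraph : Type 1 where
  V : Type
  E : Type
  finV : Finite V
  finE : Finite E
  ends : E → Sym2 V
  w : V → ℕ

attribute [instance] WGraph.finV WGraph.finE

/-- Isomorphisms of weighted multigraphs. -/
structure WIso (A B : WGraph) where
  onV : A.V ≃ B.V
  onE : A.E ≃ B.E
  ends_eq : ∀ e, B.ends (onE e) = (A.ends e).map onV
  w_eq : ∀ v, B.w (onV v) = A.w v

def WIso.refl (A : WGraph) : WIso A A :=
  ⟨Equiv.refl _, Equiv.refl _, fun e => by simp, fun _ => rfl⟩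

def WIso.symm {A B : WGraph} (f : WIso A B) : WIso B A :=
  ⟨f.onV.symm, f.onE.symm, fun e => by
    obtain ⟨e, rfl⟩ := f.onE.surjective e
    simp [f.ends_eq, Sym2.map_map], fun v => by
    obtain ⟨v, rfl⟩ := f.onV.surjective v
    simp [f.w_eq]⟩

def WIso.trans {A B C : WGraph} (f : WIso A B) (g : WIso B C) : WIso A C :=
  ⟨f.onV.trans g.onV, f.onE.trans g.onE, fun e => by
    simp [f.ends_eq, g.ends_eq, Sym2.map_map], fun v => by
    simp [f.w_eq, g.w_eq]⟩

namespace WGraph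

/-- Being joined by a path all of whose edges lie in `S`. -/
def joined (G : WGraph) (S : Set G.E) : Setoid G.V :=
  Relation.EqvGen.setoid fun x y => ∃ e ∈ S, G.ends e = s(x, y)

def Connected (G : WGraph) : Prop :=
  Nonempty G.V ∧ ∀ x y, G.joined univ x y

/-- Connected, and still connected after the removal of any one edge. -/
def TwoEdgeConnected (G : WGraph) : Prop :=
  G.Connected ∧ ∀ e x y, G.joined {e}ᶜ x y

/-- The valence of a vertex; a loop counts twice. -/
noncomputable def valence (G : WGraph) (v : G.V) : ℕ :=
  Nat.card {e // v ∈ G.ends e} + Nat.card {e // G.ends e = s(v, v)}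

/-- Stability: every vertex of weight zero has valence at least three. -/
def Stable (G : WGraph) : Prop :=
  ∀ v, G.w v = 0 → 3 ≤ G.valence v

/-- `|E| - |V| + 1 + ∑ w(v)`. -/
noncomputable def genus (G : WGraph) : ℤ :=
  (Nat.card G.E : ℤ) - Nat.card G.V + 1 + ∑ᶠ v, (G.w v : ℤ)

/-- Contraction of all edges in `S`. The new vertices are the connected components of the graph
`(V, S)`. Contracting a non-loop adds up the weights of its ends and contracting a loop adds one to
the weight, so that in total a component `c` becomes a vertex whose weight is the sum of the weights
in `c` plus the first Betti number of `c`. (The truncated subtraction is exact, since `c` is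
connected.) -/
noncomputable def contract (G : WGraph) (S : Set G.E) : WGraph where
  V := Quotient (G.joined S)
  E := {e : G.E // e ∉ S}
  finV := inferInstance
  finE := inferInstance
  ends := fun e => (G.ends e.1).map (Quotient.mk _)
  w := fun c => (∑ᶠ v : {v : G.V // Quotient.mk (G.joined S) v = c}, G.w v.1) +
    (Nat.card {e : G.E // e ∈ S ∧ ∀ v ∈ G.ends e, Quotient.mk (G.joined S) v = c} + 1
      - Nat.card {v : G.V // Quotient.mk (G.joined S) v = c})

/-- The loops of the graph obtained from `G` by adding `w(v)` loops at every vertex `v`. -/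
abbrev AllLoops (G : WGraph) : Type :=
  {p : G.V × G.E // G.ends p.2 = s(p.1, p.1)} ⊕ (Σ v : G.V, Fin (G.w v))

/-- The vertex at which a loop is based. -/
def base (G : WGraph) : G.AllLoops → G.V
  | Sum.inl p => p.1.1
  | Sum.inr q => q.1

/-- The loopless graph obtained by adding `w(v)` loops at every vertex `v` and then placing a
new vertex in the interior of every loop, which cuts the loop into two edges. -/
def loopless (G : WGraph) : WGraph where
  V := G.V ⊕ G.AllLoops
  E := {e : G.E // ¬ (G.ends e).IsDiag} ⊕ (G.AllLoops × Bool)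
  finV := inferInstance
  finE := inferInstance
  ends := Sum.elim (fun e => (G.ends e.1).map Sum.inl)
    (fun p => s(Sum.inl (G.base p.1), Sum.inr p.1))
  w := fun _ => 0

/-- A finite simple graph as a multigraph of weight zero. -/
def ofSimple {W : Type} [Finite W] (T : SimpleGraph W) : WGraph where
  V := W
  E := T.edgeSet
  finV := inferInstance
  finE := inferInstance
  ends := fun e => e.1
  w := fun _ => 0

end WGraph

/-! ### Harmonic morphisms of loopless graphs -/

/-- Morphisms of loopless graphs: vertices go to vertices, an edge goes either to a vertex
(`Sum.inl`), and then its ends go to the same vertex, or to an edge (`Sum.inr`) which joins the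
images of its ends. -/
structure Mor (G H : WGraph) where
  onV : G.V → H.V
  onE : G.E → H.V ⊕ H.E
  vertical : ∀ e y, onE e = Sum.inl y → ∀ x ∈ G.ends e, onV x = y
  horizontal : ∀ e e', onE e = Sum.inr e' → H.ends e' = (G.ends e).map onV

namespace Mor

variable {G H : WGraph} (φ : Mor G H)

/-- The number of edges at `x` that lie over the edge `e'`. -/
noncomputable def mult (x : G.V) (e' : H.E) : ℕ :=
  Nat.card {e : G.E // x ∈ G.ends e ∧ φ.onE e = Sum.inr e'}

/-- The multiplicity at `x` does not depend on the choice of an edge at `φ x`. -/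
def Harmonic : Prop :=
  ∀ x, ∀ e' e'', φ.onV x ∈ H.ends e' → φ.onV x ∈ H.ends e'' → φ.mult x e' = φ.mult x e''

/-- The horizontal multiplicity is positive at every vertex. -/
def Nondegenerate : Prop :=
  ∀ x, ∃ e', φ.onV x ∈ H.ends e' ∧ 0 < φ.mult x e'

/-- `φ` has (positive) degree `d`: every edge of the target has `d` edges over it. -/
def HasDegree (d : ℕ) : Prop :=
  Nonempty H.E ∧ ∀ e', Nat.card {e : G.E // φ.onE e = Sum.inr e'} = d

end Mor

/-! ### Constrained types -/

/-- A weighted graph with an equivalence relation on its edges. -/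
structure CGraph : Type 1 extends WGraph where
  rel : Setoid E

/-- A constrained type: the weighted graph is connected and stable. -/
def CGraph.IsType (T : CGraph) : Prop :=
  T.toWGraph.Connected ∧ T.toWGraph.Stable

/-- An isomorphism of weighted graphs is compatible with the relations on the edges. -/
def WIso.Compat {S T : CGraph} (f : WIso S.toWGraph T.toWGraph) : Prop :=
  ∀ e e', S.rel e e' ↔ T.rel (f.onE e) (f.onE e')

def CGraph.Isom (S T : CGraph) : Prop :=
  ∃ f : WIso S.toWGraph T.toWGraph, f.Compat

/-- 2-edge-connected hyperelliptic types. There is a harmonic morphism `φ` from the loopless graph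
to a tree, which is either nondegenerate of degree two, or the (constant) morphism of a
graph with two vertices to a point. Two distinct edges are related if and only if they are not loops
and `φ` sends them to the same edge of the tree. -/
def CGraph.IsHyp (T : CGraph) : Prop :=
  T.toWGraph.TwoEdgeConnected ∧
  ∃ (W : Type) (_ : Finite W) (B : SimpleGraph W) (_ : B.IsTree)
    (φ : Mor T.toWGraph.loopless (WGraph.ofSimple B)),
    φ.Harmonic ∧
    ((φ.Nondegenerate ∧ φ.HasDegree 2) ∨
      (Nat.card T.toWGraph.loopless.V = 2 ∧ Nat.card W = 1)) ∧
    ∀ e e', T.rel e e' ↔ e = e' ∨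
      ∃ (h : ¬ (T.ends e).IsDiag) (h' : ¬ (T.ends e').IsDiag) (t : B.edgeSet),
        φ.onE (Sum.inl ⟨e, h⟩) = Sum.inr t ∧ φ.onE (Sum.inl ⟨e', h'⟩) = Sum.inr t

/-- The collection of 2-edge-connected hyperelliptic types of genus `g`. -/
def HypType (g : ℕ) : Type 1 :=
  {T : CGraph // T.IsType ∧ T.IsHyp ∧ T.toWGraph.genus = g}

/-- Isomorphism of types. -/
instance HypType.setoid (g : ℕ) : Setoid (HypType g) where
  r S T := S.1.Isom T.1
  iseqv :=
    { refl := fun S => ⟨WIso.refl _, fun _ _ => Iff.rfl⟩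
      symm := by
        rintro S T ⟨f, hf⟩
        refine ⟨f.symm, fun e e' => ?_⟩
        rw [hf]
        simp [WIso.symm]
      trans := by
        rintro S T U ⟨f, hf⟩ ⟨k, hk⟩
        exact ⟨f.trans k, fun e e' => (hf e e').trans (hk _ _)⟩ }

/-- Isomorphism classes of 2-edge-connected hyperelliptic types of genus `g`. -/
abbrev HypClass (g : ℕ) : Type 1 := Quotient (HypType.setoid g)

/-! ### The cones of a type, and the space of curves -/

/-- The set of equivalence classes of edges, which indexes the coordinates of the cone. -/
abbrev CGraph.Coord (T : CGraph) : Type := Quotient T.rel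

noncomputable instance (T : CGraph) : Fintype T.Coord := Fintype.ofFinite _

noncomputable instance (T : CGraph) : DecidableEq T.Coord := Classical.decEq _

/-- A weighted graph with edge lengths. -/
structure LenGraph : Type 1 extends WGraph where
  len : E → ℝ

/-- Isomorphism of weighted graphs with edge lengths. -/
def LenGraph.Isom (A B : LenGraph) : Prop :=
  ∃ f : WIso A.toWGraph B.toWGraph, ∀ e, B.len (f.onE e) = A.len e

theorem LenGraph.isom_equivalence : Equivalence LenGraph.Isom where
  refl A := ⟨WIso.refl _, fun _ => rfl⟩
  symm := by
    rintro A B ⟨f, hf⟩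
    refine ⟨f.symm, fun e => ?_⟩
    rw [← hf]
    simp [WIso.symm]
  trans := by
    rintro A B C ⟨f, hf⟩ ⟨k, hk⟩
    exact ⟨f.trans k, fun e => (hk _).trans (hf e)⟩

/-- The edge lengths on the type `T` that are given by a point with coordinates `x`. -/
def CGraph.withLen (T : CGraph) (x : T.Coord → ℝ) : LenGraph :=
  { T.toWGraph with len := fun e => x (Quotient.mk _ e) }

/-- Contraction of all edges of length zero. -/
noncomputable def LenGraph.reduce (A : LenGraph) : LenGraph :=
  { A.toWGraph.contract {e | A.len e = 0} with len := fun e => A.len e.1 }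

/-- Points of the disjoint union of the closed orthants of all types of genus `g`. -/
abbrev PreSpace (g : ℕ) : Type 1 :=
  Σ T : HypType g, {x : T.1.Coord → ℝ // ∀ q, 0 ≤ x q}

/-- Two points are equivalent if the tropical curves obtained by contracting all edges of
length zero are isomorphic. -/
noncomputable def PreSpace.setoid (g : ℕ) : Setoid (PreSpace g) :=
  Setoid.comap (fun p => (p.1.1.withLen p.2.1).reduce) ⟨LenGraph.Isom, LenGraph.isom_equivalence⟩

/-- The space of 2-edge-connected hyperelliptic tropical curves of genus `g`, with the quotient
topology. (Points of an orthant that differ by an automorphism of the type are equivalent, so that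
this is also the quotient of the disjoint union of the quotients of the orthants by the
automorphism groups.) -/
def H2tr (g : ℕ) : Type 1 :=
  Quotient (PreSpace.setoid g)

instance (g : ℕ) : TopologicalSpace (H2tr g) :=
  inferInstanceAs (TopologicalSpace (Quotient (PreSpace.setoid g)))

/-! ### Stacky fans -/

section StackyFan

variable {N : Type*} [Fintype N] [DecidableEq N]

/-- The action of an integral invertible matrix on real vectors. -/
def act (A : GL N ℤ) (x : N → ℝ) : N → ℝ :=
  ((A : Matrix N N ℤ).map (Int.cast : ℤ → ℝ)).mulVec x

theorem act_one (x : N → ℝ) : act (1 : GL N ℤ) x = x := by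
  simp [act]

theorem act_mul (A B : GL N ℤ) (x : N → ℝ) : act (A * B) x = act A (act B x) := by
  have h : ((A : Matrix N N ℤ) * B).map (Int.cast : ℤ → ℝ) =
      (A : Matrix N N ℤ).map Int.cast * (B : Matrix N N ℤ).map Int.cast :=
    Matrix.map_mul (f := Int.castRingHom ℝ)
  simp [act, h, Matrix.mulVec_mulVec]

/-- Lying in the same orbit of `Γ`, for points of the set `S`. -/
def orbitSetoid (Γ : Subgroup (GL N ℤ)) (S : Set (N → ℝ)) : Setoid S where
  r x y := ∃ A ∈ Γ, act A x.1 = y.1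
  iseqv :=
    { refl := fun x => ⟨1, Γ.one_mem, act_one _⟩
      symm := by
        rintro x y ⟨A, hA, h⟩
        exact ⟨A⁻¹, Γ.inv_mem hA, by rw [← h, ← act_mul, inv_mul_cancel, act_one]⟩
      trans := by
        rintro x y z ⟨A, hA, h⟩ ⟨B, hB, h'⟩
        exact ⟨B * A, Γ.mul_mem hB hA, by rw [act_mul, h, h']⟩ }

/-- The topological quotient `S / Γ`. -/
abbrev OrbitSpace (Γ : Subgroup (GL N ℤ)) (S : Set (N → ℝ)) : Type _ :=
  Quotient (orbitSetoid Γ S)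

/-- The map `X / Γ → cl X / Γ`. -/
def OrbitSpace.incl (Γ : Subgroup (GL N ℤ)) (S : Set (N → ℝ)) :
    OrbitSpace Γ S → OrbitSpace Γ (closure S) :=
  Quotient.map' (inclusion subset_closure) fun _ _ h => h

/-- Full-dimensional rational open polyhedral cones: the set of all positive combinations of
finitely many integral vectors, which span the whole space. -/
def IsRationalOpenCone (X : Set (N → ℝ)) : Prop :=
  (∃ (t : ℕ) (v : Fin t → N → ℤ),
    X = {x | ∃ a : Fin t → ℝ, (∀ i, 0 < a i) ∧ x = ∑ i, a i • fun k => (v i k : ℝ)}) ∧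
  Submodule.span ℝ X = ⊤

/-- Faces of a closed cone: the zero sets of linear forms that are nonnegative on the cone. -/
def IsFace (C F : Set (N → ℝ)) : Prop :=
  ∃ u : (N → ℝ) →ₗ[ℝ] ℝ, (∀ x ∈ C, 0 ≤ u x) ∧ F = {x ∈ C | u x = 0}

end StackyFan

section StackyFan

variable {X ι : Type*} [TopologicalSpace X] {N : ι → Type*} [∀ i, Fintype (N i)]
  [∀ i, DecidableEq (N i)] {cone : ∀ i, Set (N i → ℝ)} {Γ : ∀ i, Subgroup (GL (N i) ℤ)}

/-- The open cell, i.e. the image of `X_i / Γ_i`. -/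
def openCell (α : ∀ i, OrbitSpace (Γ i) (closure (cone i)) → X) (i : ι) : Set X :=
  range fun p => α i (OrbitSpace.incl (Γ i) (cone i) p)

/-- The closed cell, i.e. the image of `cl X_i / Γ_i`. -/
def closedCell (α : ∀ i, OrbitSpace (Γ i) (closure (cone i)) → X) (i : ι) : Set X :=
  range (α i)

/-- The face `F` of the cone with index `i` is glued to the cone with index `l`: the image of `F` is
the closed cell of `l`, and there is a linear isomorphism `L` from the span of `F` onto the space
of the cone `l` (so that the dimensions agree) which maps `F` onto the closed cone, maps the lattice
points onto the lattice points, and is compatible with the maps to `X`. -/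
def FaceGluing (α : ∀ i, OrbitSpace (Γ i) (closure (cone i)) → X) (i : ι) (F : Set (N i → ℝ))
    (l : ι) : Prop :=
  {p | ∃ (x : N i → ℝ) (hx : x ∈ closure (cone i)),
      x ∈ F ∧ α i (Quotient.mk _ ⟨x, hx⟩) = p} = closedCell α l ∧
  ∃ L : Submodule.span ℝ F ≃ₗ[ℝ] (N l → ℝ),
    L '' {x | x.1 ∈ F} = closure (cone l) ∧
    L '' {x | ∀ k, ∃ z : ℤ, x.1 k = (z : ℝ)} = {y | ∀ k, ∃ z : ℤ, y k = (z : ℝ)} ∧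
    ∀ (x : Submodule.span ℝ F) (hx : x.1 ∈ closure (cone i)) (hL : L x ∈ closure (cone l)),
      x.1 ∈ F → α i (Quotient.mk _ ⟨x.1, hx⟩) = α l (Quotient.mk _ ⟨L x, hL⟩)

/-- The closed cell of `l` is a stacky face of the closed cell of `i`. -/
def IsStackyFace (α : ∀ i, OrbitSpace (Γ i) (closure (cone i)) → X) (l i : ι) : Prop :=
  ∃ F, IsFace (closure (cone i)) F ∧ FaceGluing α i F l

variable (cone Γ) in
/-- `X` is a stacky fan with the finitely many cells `cone i / Γ i`, where `α i` are the maps from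
the quotients of the closed cones to `X`. -/
structure IsStackyFan (α : ∀ i, OrbitSpace (Γ i) (closure (cone i)) → X) : Prop where
  finite : Finite ι
  rational : ∀ i, IsRationalOpenCone (cone i)
  stable : ∀ i, ∀ A ∈ Γ i, act A '' cone i = cone i
  cont : ∀ i, Continuous (α i)
  /-- The restriction of `α i` to `cone i / Γ i` is a homeomorphism onto its image. -/
  homeo : ∀ i, Topology.IsEmbedding fun p => α i (OrbitSpace.incl (Γ i) (cone i) p)
  /-- `X` is the disjoint union of the open cells. -/
  cover : ⋃ i, openCell α i = univ
  disj : ∀ i j, i ≠ j → Disjoint (openCell α i) (openCell α j)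
  faces : ∀ i F, IsFace (closure (cone i)) F → ∃ l, FaceGluing α i F l
  /-- Two closed cells meet in the union of their common stacky faces. -/
  inter : ∀ i j, closedCell α i ∩ closedCell α j =
    ⋃ l ∈ {l | IsStackyFace α l i ∧ IsStackyFace α l j}, closedCell α l

/-- A cell is maximal if its closure is not properly contained in the closure of a cell. -/
def IsMaxCell (α : ∀ i, OrbitSpace (Γ i) (closure (cone i)) → X) (i : ι) : Prop :=
  ∀ j, closedCell α i ⊆ closedCell α j → closedCell α j ⊆ closedCell α i

/-- The largest dimension of a cell is `d`, and all maximal cells have dimension `d`. -/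
def IsPureOfDim (α : ∀ i, OrbitSpace (Γ i) (closure (cone i)) → X) (d : ℕ) : Prop :=
  IsGreatest (range fun i => Fintype.card (N i)) d ∧
  ∀ i, IsMaxCell α i → Fintype.card (N i) = d

end StackyFan

/-! ### The cells of the space of curves -/

/-- The open orthant of a type. -/
def CGraph.orthant (T : CGraph) : Set (T.Coord → ℝ) := {x | ∀ q, 0 < x q}

/-- The permutation of the coordinates that an automorphism induces. -/
def CGraph.coordPerm (T : CGraph) (f : WIso T.toWGraph T.toWGraph) (h : f.Compat (S := T) (T := T)) :
    Equiv.Perm T.Coord :=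
  Quotient.congr f.onE h

/-- The image of the automorphism group of a type in the integral matrices, acting on the orthant
by permuting the coordinates. -/
noncomputable def CGraph.autGL (T : CGraph) : Subgroup (GL T.Coord ℤ) where
  carrier := {A | ∃ (f : WIso T.toWGraph T.toWGraph) (h : f.Compat (S := T) (T := T)),
    (A : Matrix T.Coord T.Coord ℤ) = (T.coordPerm f h).permMatrix ℤ}
  mul_mem' := by
    rintro A B ⟨f, hf, hA⟩ ⟨k, hk, hB⟩
    refine ⟨f.trans k, fun e e' => (hf e e').trans (hk _ _), ?_⟩
    rw [Units.val_mul, hA, hB, ← Matrix.permMatrix_mul]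
    congr 1
    ext q
    induction q using Quotient.inductionOn
    rfl
  one_mem' := by
    refine ⟨WIso.refl _, fun _ _ => Iff.rfl, ?_⟩
    rw [Units.val_one, ← Matrix.permMatrix_one]
    congr 1
    ext q
    induction q using Quotient.inductionOn
    rfl
  inv_mem' := by
    rintro A ⟨f, hf, hA⟩
    have hs : f.symm.Compat (S := T) (T := T) := fun e e' => by
      have := hf (f.onE.symm e) (f.onE.symm e')
      simp only [Equiv.apply_symm_apply] at this
      exact this.symm
    refine ⟨f.symm, hs, ?_⟩
    rw [← Units.mul_eq_one_iff_inv_eq, hA, ← Matrix.permMatrix_mul, ← Matrix.permMatrix_one]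
    congr 1
    ext q
    induction q using Quotient.inductionOn with
    | h e => exact congrArg (Quotient.mk _) (f.onE.symm_apply_apply e)

theorem WIso.joined_map {A B : WGraph} (f : WIso A B) {S : Set A.E} {S' : Set B.E}
    (h : ∀ e, e ∈ S → f.onE e ∈ S') {x y : A.V} (hxy : A.joined S x y) :
    B.joined S' (f.onV x) (f.onV y) := by
  induction hxy with
  | rel x y hr =>
    obtain ⟨e, he, hr⟩ := hr
    exact Relation.EqvGen.rel _ _ ⟨f.onE e, h e he, by rw [f.ends_eq, hr]; rfl⟩
  | refl x => exact Relation.EqvGen.refl _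
  | symm x y _ ih => exact Relation.EqvGen.symm _ _ ih
  | trans x y z _ _ ih ih' => exact Relation.EqvGen.trans _ _ _ ih ih'

theorem WIso.joined_iff {A B : WGraph} (f : WIso A B) {S : Set A.E} {S' : Set B.E}
    (h : ∀ e, e ∈ S ↔ f.onE e ∈ S') (x y : A.V) :
    A.joined S x y ↔ B.joined S' (f.onV x) (f.onV y) := by
  refine ⟨f.joined_map fun e => (h e).1, fun hxy => ?_⟩
  have := f.symm.joined_map (S := S') (S' := S)
    (fun e he => by rw [h]; simpa [WIso.symm] using he) hxy
  simpa [WIso.symm] using this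

/-- An isomorphism induces an isomorphism of contractions. -/
noncomputable def WIso.contract {A B : WGraph} (f : WIso A B) {S : Set A.E} {S' : Set B.E}
    (h : ∀ e, e ∈ S ↔ f.onE e ∈ S') : WIso (A.contract S) (B.contract S') where
  onV := Quotient.congr f.onV (f.joined_iff h)
  onE := f.onE.subtypeEquiv fun e => not_congr (h e)
  ends_eq := fun (e : {e : A.E // e ∉ S}) => by
    have key : (B.ends (f.onE e.1)).map (Quotient.mk (B.joined S')) =
        ((A.ends e.1).map (Quotient.mk (A.joined S))).map
          (Quotient.congr f.onV (f.joined_iff h)) := by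
      rw [f.ends_eq, Sym2.map_map, Sym2.map_map]
      rfl
    exact key
  w_eq := fun (c : Quotient (A.joined S)) => by
    have hm : ∀ v, Quotient.mk (A.joined S) v = c ↔ Quotient.mk (B.joined S') (f.onV v) =
        Quotient.congr f.onV (f.joined_iff h) c := fun v =>
      (Quotient.congr f.onV (f.joined_iff h)).apply_eq_iff_eq.symm
    let i : {v : A.V // Quotient.mk (A.joined S) v = c} ≃ {v : B.V //
        Quotient.mk (B.joined S') v = Quotient.congr f.onV (f.joined_iff h) c} :=
      Equiv.subtypeEquiv (p := fun v => Quotient.mk (A.joined S) v = c)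
        (q := fun v => Quotient.mk (B.joined S') v = Quotient.congr f.onV (f.joined_iff h) c)
        f.onV hm
    have h1 : (∑ᶠ v : {v : A.V // Quotient.mk (A.joined S) v = c}, A.w v.1) =
        ∑ᶠ v : {v : B.V // Quotient.mk (B.joined S') v =
          Quotient.congr f.onV (f.joined_iff h) c}, B.w v.1 :=
      finsum_eq_of_bijective i i.bijective fun v => (f.w_eq v.1).symm
    have h2 := Nat.card_congr i
    have h3 : Nat.card {e : A.E // e ∈ S ∧ ∀ v ∈ A.ends e, Quotient.mk (A.joined S) v = c} =
        Nat.card {e : B.E // e ∈ S' ∧ ∀ v ∈ B.ends e, Quotient.mk (B.joined S') v =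
          Quotient.congr f.onV (f.joined_iff h) c} :=
      Nat.card_congr (f.onE.subtypeEquiv fun e => and_congr (h e) (by
        rw [f.ends_eq]
        simp only [Sym2.mem_map, forall_exists_index, and_imp, forall_apply_eq_imp_iff₂]
        exact forall₂_congr fun v _ => hm v))
    exact (congrArg₂ _ h1 (congrArg₂ _ (congrArg (· + 1) h3) h2)).symm

theorem LenGraph.reduce_isom {A B : LenGraph} (h : A.Isom B) : A.reduce.Isom B.reduce := by
  obtain ⟨f, hf⟩ := h
  exact ⟨f.contract fun e => by simp [hf], fun e => hf e.1⟩

theorem CGraph.nonneg_of_mem_closure (T : CGraph) {x : T.Coord → ℝ}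
    (hx : x ∈ closure T.orthant) (q : T.Coord) : 0 ≤ x q := by
  have hc : IsClosed {x : T.Coord → ℝ | 0 ≤ x q} :=
    isClosed_le continuous_const (continuous_apply q)
  have hs : T.orthant ⊆ {x | 0 ≤ x q} := fun y hy => (hy q).le
  exact closure_minimal hs hc hx

/-- The map from the closed orthant of a type, modulo automorphisms, to the space of curves. -/
noncomputable def cellMap {g : ℕ} (T : HypType g) :
    OrbitSpace T.1.autGL (closure T.1.orthant) → H2tr g :=
  Quotient.lift
    (fun x => Quotient.mk (PreSpace.setoid g) ⟨T, x.1, T.1.nonneg_of_mem_closure x.2⟩) <| by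
    rintro x y ⟨A, ⟨f, hf, hA⟩, h⟩
    refine Quotient.sound (Setoid.symm' _ (LenGraph.reduce_isom ⟨f, fun e => ?_⟩))
    have hy : y.1 = x.1 ∘ T.1.coordPerm f hf := by
      rw [← h, act, hA, ← Matrix.permMatrix_mulVec]
      congr 1
      ext i j
      simp [Equiv.Perm.permMatrix, PEquiv.toMatrix_apply]
    exact (congrFun hy (Quotient.mk T.1.rel e)).symm

/-! ### Trees and ladders -/

/-- The number of edges that join the two copies of a vertex in a ladder. -/
noncomputable def rungs {W : Type} (T : SimpleGraph W) (v : W) : ℕ :=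
  if (T.neighborSet v).ncard = 1 then 2 else if (T.neighborSet v).ncard = 2 then 1 else 0

/-- The ladder `L(T)`: two copies of `T`, together with two edges between the two copies of every
vertex of degree one, and one edge between the two copies of every vertex of degree two. All weights
are zero, and distinct edges are related exactly when they are the two copies of an edge of `T`. -/
noncomputable def ladder {W : Type} [Finite W] (T : SimpleGraph W) : CGraph where
  V := W × Bool
  E := (T.edgeSet × Bool) ⊕ (Σ v : W, Fin (rungs T v))
  finV := inferInstance
  finE := inferInstance
  ends := Sum.elim (fun e => e.1.1.map fun v => (v, e.2)) fun p => s((p.1, false), (p.1, true))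
  w := fun _ => 0
  rel := Setoid.ker (Sum.map Prod.fst id)

/-- Trees on `n` vertices with maximum valence at most three. -/
def CubicTree (n : ℕ) : Type :=
  {T : SimpleGraph (Fin n) // T.IsTree ∧ ∀ v, (T.neighborSet v).ncard ≤ 3}

/-- Isomorphism of trees. -/
instance CubicTree.setoid (n : ℕ) : Setoid (CubicTree n) where
  r S T := Nonempty (S.1 ≃g T.1)
  iseqv :=
    { refl := fun _ => ⟨SimpleGraph.Iso.refl⟩
      symm := fun ⟨f⟩ => ⟨f.symm⟩
      trans := fun ⟨f⟩ ⟨k⟩ => ⟨f.trans k⟩ }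

end HypTrop

/-!
A *generalised ladder* is the double `LegTree.dbl R` of a tree `R` with legs: two copies of the tree,
one edge between the two copies of the foot of each leg, weights zero, and the relation identifying the
two copies of each edge of the tree. Everything rests on one description of the constrained types:
the 2-edge-connected hyperelliptic types of genus `g` are exactly the contractions, along unions of
relation classes, of the generalised ladders over trees with `g + 1` legs all of whose vertices have
valence three.

*Every hyperelliptic type is such a contraction.* A hyperelliptic morphism restricts to a map of the
graph onto a tree with at most two vertices over each vertex (`CGraph.IsHyp.hypDatum`). Since the base
is a tree, the two sheets can be labelled consistently (`HypDatum.exists_section`). Adding legs for the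
edges inside the fibres, for the weights, and for the fibres with a single vertex presents the type as
a contraction of the double of a tree with legs (`HypDatum.spec_dbl`). The canonical divisor is pushed
forward by contractions (`Contr.canon_eq`), so the stability condition forces all valences of that tree
to be at least three (`HypDatum.three_le_val`). Splitting vertices then lowers them to exactly three
(`LegTree.exists_resolution`). *Conversely*, contracting relation classes of a generalised ladder
yields a hyperelliptic type: the projection to the contracted tree, with one further leaf for each
loop, weights counted as loops, is the required morphism (`LegTree.contract_isHyp`).

The relation is determined by the graph: in a generalised ladder two distinct edges are related if
and only if they together disconnect the graph (`LegTree.dbl_joined_compl_iff`), and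
contractions inherit this (`HypType.rel_iff`). So isomorphisms of the underlying graphs are
isomorphisms of types (`HypType.compat`), and a point of the moduli space determines the type obtained
by contracting its edges of length zero.

Contractions are handled through the structure `Contr`, in which the weights enter as the push-forward
of the function `w - 1` corrected by the number of contracted edges; genus, connectivity and canonical
divisor then behave well without truncated subtraction. For the topology, the image of a closed subset
of an orthant is closed, because its preimage in any other orthant is a finite union of closed
sets, one for each isomorphism between contractions of the two types (`isClosed_point_image`); with the
previous
paragraph this makes each open cell an embedded quotient by the automorphism group. The faces of an
orthant are the orthants of the contractions (`faceGluing`), and one closed cell contains another if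
and only if the second type is a contraction of the first (`closedCell_subset_iff`).

Hence the maximal cells are those of the generalised ladders with all valences three, which have
`3g - 3` edges in `2g - 1` classes. Such a tree with legs is determined by its tree of `g - 1`
vertices, the legs filling the valences up to three, so these are the ladders `L(T)`. The tree is
recovered from the ladder: two vertices lie over the same vertex of the tree according to a condition on
the ladder and its relation alone (`ladder_fst_eq_iff`), so isomorphic ladders have isomorphic trees
(`nonempty_iso_of_ladder_isom`).
-/

namespace HypTrop

open WGraph

/-! ### Push-forward of integer-valued functions along maps of finite sets -/

open Classical in
/-- The push-forward of an integer-valued function: `push f a b` is the sum of `a` over the fibre of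
`f` over `b`. -/
noncomputable def push {α β : Type*} [Finite α] (f : α → β) (a : α → ℤ) (b : β) : ℤ :=
  letI := Fintype.ofFinite α
  ∑ x : α, if f x = b then a x else 0

section push

variable {α α' β γ : Type*} [Finite α] [Finite α']

theorem push_eq_sum [Fintype α] [DecidableEq β] (f : α → β) (a : α → ℤ) (b : β) :
    push f a b = ∑ x : α, if f x = b then a x else 0 := by
  unfold push
  convert rfl

theorem push_push [Finite β] (g : β → γ) (f : α → β) (a : α → ℤ) :
    push g (push f a) = push (g ∘ f) a := by
  classical
  let _ := Fintype.ofFinite α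
  let _ := Fintype.ofFinite β
  ext c
  rw [push_eq_sum g, push_eq_sum (g ∘ f)]
  simp only [push_eq_sum f, Function.comp_apply]
  have : ∀ y : β, (if g y = c then ∑ x, if f x = y then a x else 0 else 0) =
      ∑ x, if f x = y then (if g (f x) = c then a x else 0) else 0 := by
    intro y
    split_ifs with h
    · refine Finset.sum_congr rfl fun x _ => ?_
      split_ifs with h1 h2 <;> simp_all
    · symm
      refine Finset.sum_eq_zero fun x _ => ?_
      split_ifs with h1 h2 <;> simp_all
  simp only [this]
  rw [Finset.sum_comm]
  simp

theorem push_add (f : α → β) (a b : α → ℤ) : push f (a + b) = push f a + push f b := by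
  classical
  let _ := Fintype.ofFinite α
  ext c
  simp only [push_eq_sum, Pi.add_apply, ← Finset.sum_add_distrib]
  refine Finset.sum_congr rfl fun x _ => ?_
  split_ifs <;> simp

theorem push_mul_left (f : α → β) (n : ℤ) (a : α → ℤ) (c : β) :
    push f (fun x => n * a x) c = n * push f a c := by
  classical
  let _ := Fintype.ofFinite α
  simp only [push_eq_sum, Finset.mul_sum]
  refine Finset.sum_congr rfl fun x _ => ?_
  split_ifs <;> simp

/-- Restriction of a push-forward to a subset that contains the support. -/
theorem push_of_injective (i : α' → α) (hi : Function.Injective i) {f : α → γ} {f' : α' → γ}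
    {a : α → ℤ} {a' : α' → ℤ} (h0 : ∀ x, x ∉ range i → a x = 0) (ha : ∀ x, a (i x) = a' x)
    (hf : ∀ x, a' x ≠ 0 → f (i x) = f' x) : push f a = push f' a' := by
  classical
  let _ := Fintype.ofFinite α
  let _ := Fintype.ofFinite α'
  ext c
  rw [push_eq_sum, push_eq_sum]
  symm
  refine Finset.sum_of_injOn i hi.injOn (by simp) (fun x _ hx => ?_) (fun x _ => ?_)
  · rw [h0 x (by simpa using hx), ite_self]
  · by_cases h : a' x = 0
    · simp [ha, h]
    · rw [hf x h, ha]

theorem push_congr {f f' : α → γ} {a a' : α → ℤ} (ha : ∀ x, a x = a' x)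
    (hf : ∀ x, a x ≠ 0 → f x = f' x) : push f a = push f' a' :=
  push_of_injective id Function.injective_id (fun x hx => absurd ⟨x, rfl⟩ hx) ha
    fun x hx => hf x (by simpa [ha] using hx)

theorem push_equiv (i : α' ≃ α) (f : α → γ) (a : α → ℤ) : push f a = push (f ∘ i) (a ∘ i) :=
  push_of_injective i i.injective (fun x hx => absurd (i.surjective x) hx) (fun _ => rfl)
    fun _ _ => rfl

theorem push_indicator (f : α → γ) (S : Set α) (b : γ) :
    push f (S.indicator 1) b = Nat.card {x // x ∈ S ∧ f x = b} := by
  classical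
  let _ := Fintype.ofFinite α
  rw [push_eq_sum, Nat.card_eq_fintype_card, Fintype.card_subtype, Finset.card_filter]
  push_cast
  refine Finset.sum_congr rfl fun x _ => ?_
  by_cases h : x ∈ S <;> simp [h]

theorem push_one (f : α → γ) (b : γ) : push f 1 b = Nat.card {x // f x = b} := by
  have := push_indicator f univ b
  simpa using this

theorem push_nonneg {f : α → γ} {a : α → ℤ} {b : γ} (h : ∀ x, 0 ≤ a x) : 0 ≤ push f a b := by
  classical
  let _ := Fintype.ofFinite α
  rw [push_eq_sum]
  exact Finset.sum_nonneg fun x _ => by split_ifs <;> simp [h]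

theorem le_push {f : α → γ} {a : α → ℤ} (h : ∀ x, 0 ≤ a x) (x : α) : a x ≤ push f a (f x) := by
  classical
  let _ := Fintype.ofFinite α
  rw [push_eq_sum]
  refine le_trans (by simp) (Finset.single_le_sum
    (f := fun y => if f y = f x then a y else 0) (fun y _ => ?_) (Finset.mem_univ x))
  split_ifs <;> simp [h]

/-- The sum of a function over a finite type. -/
noncomputable def total (a : α → ℤ) : ℤ := push (fun _ => ()) a ()

theorem total_push [Finite β] (f : α → β) (a : α → ℤ) : total (push f a) = total a := by
  unfold total
  rw [push_push]

theorem total_eq_sum [Fintype α] (a : α → ℤ) : total a = ∑ x, a x := by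
  simp [total, push_eq_sum]

theorem total_add (a b : α → ℤ) : total (a + b) = total a + total b := by
  unfold total
  rw [push_add]
  rfl

theorem total_one : total (1 : α → ℤ) = Nat.card α := by
  let _ := Fintype.ofFinite α
  simp [total_eq_sum]

end push

/-! ### Ends, valences and genus of multigraphs -/

namespace WGraph

variable (G : WGraph)

/-- One of the two ends of an edge. -/
noncomputable def tail (e : G.E) : G.V := (Quot.out (G.ends e)).1

/-- The end of an edge that is not chosen by `tail`. -/
noncomputable def head (e : G.E) : G.V := (Quot.out (G.ends e)).2

theorem ends_eq_mk (e : G.E) : G.ends e = s(G.tail e, G.head e) :=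
  (Quot.out_eq (G.ends e)).symm

theorem tail_mem (e : G.E) : G.tail e ∈ G.ends e := by
  rw [ends_eq_mk]; exact Sym2.mem_mk_left _ _

variable {G}

theorem joined_of_mem {S : Set G.E} {e : G.E} (he : e ∈ S) {x y : G.V} (hx : x ∈ G.ends e)
    (hy : y ∈ G.ends e) : G.joined S x y := by
  rw [ends_eq_mk, Sym2.mem_iff] at hx hy
  have h : G.joined S (G.tail e) (G.head e) := Relation.EqvGen.rel _ _ ⟨e, he, G.ends_eq_mk e⟩
  rcases hx with rfl | rfl <;> rcases hy with rfl | rfl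
  · exact Setoid.refl' _ _
  · exact h
  · exact Setoid.symm' _ h
  · exact Setoid.refl' _ _

theorem joined_of_ends {S : Set G.E} {e : G.E} (he : e ∈ S) {x y : G.V} (h : G.ends e = s(x, y)) :
    G.joined S x y :=
  Relation.EqvGen.rel _ _ ⟨e, he, h⟩

/-- To be joined in `S` is the least equivalence relation that contains the edges of `S`. -/
theorem joined_le {S : Set G.E} (r : Setoid G.V)
    (h : ∀ e ∈ S, ∀ x y, G.ends e = s(x, y) → r x y) {x y : G.V} (hxy : G.joined S x y) : r x y := by
  induction hxy with
  | rel x y hr => obtain ⟨e, he, hr⟩ := hr; exact h e he x y hr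
  | refl x => exact r.refl' x
  | symm x y _ ih => exact r.symm' ih
  | trans x y z _ _ ih ih' => exact r.trans' ih ih'

theorem joined_mono {S S' : Set G.E} (h : S ⊆ S') {x y : G.V} (hxy : G.joined S x y) :
    G.joined S' x y :=
  joined_le _ (fun _ he _ _ hr => joined_of_ends (h he) hr) hxy

theorem valence_eq_of_ends {t h : G.E → G.V} (hth : ∀ e, G.ends e = s(t e, h e)) (v : G.V) :
    (G.valence v : ℤ) = push t 1 v + push h 1 v := by
  classical
  let _ := Fintype.ofFinite G.E
  unfold valence
  rw [push_eq_sum, push_eq_sum]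
  simp only [Nat.card_eq_fintype_card, Fintype.card_subtype, Finset.card_filter]
  push_cast
  rw [← Finset.sum_add_distrib, ← Finset.sum_add_distrib]
  refine Finset.sum_congr rfl fun e _ => ?_
  rw [hth e]
  simp only [Sym2.mem_iff, Sym2.eq_iff, Pi.one_apply, or_self]
  by_cases h1 : t e = v <;> by_cases h2 : h e = v <;>
    simp [h1, h2, eq_comm (a := v)]

theorem valence_eq_push (v : G.V) : (G.valence v : ℤ) = push G.tail 1 v + push G.head 1 v :=
  valence_eq_of_ends G.ends_eq_mk v

theorem genus_eq_total :
    G.genus = Nat.card G.E + 1 + total (fun v => (G.w v : ℤ) - 1) := by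
  let _ := Fintype.ofFinite G.V
  unfold genus
  rw [total_eq_sum, finsum_eq_sum_of_fintype, Finset.sum_sub_distrib]
  simp
  ring

/-- The degree of the canonical divisor at a vertex. It is additive under contractions. -/
noncomputable def canon (G : WGraph) (v : G.V) : ℤ := G.valence v + 2 * ((G.w v : ℤ) - 1)

theorem fromEdgeSet_connected [Nonempty G.V] {S : Set G.E} (h : ∀ x y, G.joined S x y) :
    (SimpleGraph.fromEdgeSet (G.ends '' S)).Connected := by
  refine ⟨fun x y => ?_⟩
  refine joined_le (G := G) (S := S) (SimpleGraph.reachableSetoid _) (fun e heS x y he => ?_) (h x y)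
  by_cases hxy : x = y
  · subst hxy; exact SimpleGraph.Reachable.refl _
  · exact SimpleGraph.Adj.reachable (by simpa [hxy] using ⟨e, heS, he⟩)

/-- A graph that is connected by the edges in `S` has at most `|S| + 1` vertices. -/
theorem card_le_of_joined [Nonempty G.V] {S : Set G.E} (h : ∀ x y, G.joined S x y) :
    Nat.card G.V ≤ Nat.card S + 1 := by
  have h1 := (fromEdgeSet_connected h).card_vert_le_card_edgeSet_add_one
  have h2 : Nat.card (SimpleGraph.fromEdgeSet (G.ends '' S)).edgeSet ≤ Nat.card (G.ends '' S) :=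
    Nat.card_mono (Set.toFinite _) (by simp [SimpleGraph.edgeSet_fromEdgeSet])
  have h3 : Nat.card (G.ends '' S) ≤ Nat.card S := Nat.card_image_le (Set.toFinite _)
  omega

theorem Connected.card_le (h : G.Connected) : Nat.card G.V ≤ Nat.card G.E + 1 := by
  have := h.1
  simpa using card_le_of_joined h.2

/-- A tree, given as a connected multigraph with the right number of edges, is a simple graph, and
a tree in the sense of simple graphs. -/
theorem Connected.isTree (h : G.Connected) (hc : Nat.card G.E + 1 = Nat.card G.V) :
    (SimpleGraph.fromEdgeSet (range G.ends)).IsTree ∧ Function.Injective G.ends ∧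
      ∀ e, ¬ (G.ends e).IsDiag := by
  let H : SimpleGraph G.V := SimpleGraph.fromEdgeSet (range G.ends)
  have hH : H.Connected := by
    have := h.1
    simpa using fromEdgeSet_connected h.2
  have h1 := hH.card_vert_le_card_edgeSet_add_one
  have hsub : H.edgeSet ⊆ range G.ends := by simp [H, SimpleGraph.edgeSet_fromEdgeSet]
  have h2 : Nat.card H.edgeSet ≤ Nat.card (range G.ends) := Nat.card_mono (Set.toFinite _) hsub
  have h3 : Nat.card (range G.ends) ≤ Nat.card G.E := Finite.card_range_le _
  have h5 : Nat.card H.edgeSet + 1 = Nat.card G.V := by omega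
  refine ⟨SimpleGraph.isTree_iff_connected_and_card.2 ⟨hH, h5⟩, ?_, ?_⟩
  · have h4 : Nat.card (range G.ends) = Nat.card G.E := by omega
    have hb : Function.Bijective (rangeFactorization G.ends) :=
      (Nat.bijective_iff_surjective_and_card _).2 ⟨rangeFactorization_surjective, h4.symm⟩
    intro a b hab
    exact hb.1 (Subtype.ext hab)
  · intro e he
    have : H.edgeSet = range G.ends :=
      Set.eq_of_subset_of_ncard_le hsub
        (by simp only [← Nat.card_coe_set_eq]; omega) (Set.toFinite _)
    have hm : G.ends e ∈ H.edgeSet := this ▸ mem_range_self e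
    exact H.not_isDiag_of_mem_edgeSet hm he

end WGraph

/-! ### Contractions of weighted multigraphs -/

/-- `Contr G T S` exhibits `T` as the contraction of the set `S` of edges of `G`, up to isomorphism.
The last field is the formula for the weights: `w - 1` is additive if every contracted edge
contributes one. -/
structure Contr (G T : WGraph) (S : Set G.E) where
  onV : G.V → T.V
  surj : Function.Surjective onV
  ker : ∀ x y, onV x = onV y ↔ G.joined S x y
  onE : {e // e ∉ S} ≃ T.E
  ends_eq : ∀ e, T.ends (onE e) = (G.ends e.1).map onV
  w_eq : ∀ v, (T.w v : ℤ) - 1 =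
    push onV (fun x => (G.w x : ℤ) - 1) v + push (fun e => onV (G.tail e)) (S.indicator 1) v

namespace Contr

variable {G T U : WGraph} {S : Set G.E} (c : Contr G T S)

/-- The preimage of a set of edges under a contraction; it contains the contracted edges. -/
def preE (A : Set T.E) : Set G.E := {e | ∀ h : e ∉ S, c.onE ⟨e, h⟩ ∈ A}

theorem subset_preE (A : Set T.E) : S ⊆ c.preE A := fun _ he h => absurd he h

theorem mem_preE_iff {A : Set T.E} {e : G.E} (h : e ∉ S) : e ∈ c.preE A ↔ c.onE ⟨e, h⟩ ∈ A :=
  ⟨fun he => he h, fun he _ => he⟩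

theorem not_mem_preE_iff {A : Set T.E} {e : G.E} :
    e ∉ c.preE A ↔ ∃ h : e ∉ S, c.onE ⟨e, h⟩ ∉ A := by
  simp [preE]

theorem onV_eq_of_mem {e : G.E} (he : e ∈ S) {x y : G.V} (hx : x ∈ G.ends e) (hy : y ∈ G.ends e) :
    c.onV x = c.onV y :=
  (c.ker _ _).2 (joined_of_mem he hx hy)

/-- Connectivity by a set of edges can be tested before the contraction. -/
theorem joined_iff (A : Set T.E) (x y : G.V) :
    T.joined A (c.onV x) (c.onV y) ↔ G.joined (c.preE A) x y := by
  constructor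
  · intro h
    have key : ∀ a b, T.joined A a b → ∀ x y, c.onV x = a → c.onV y = b →
        G.joined (c.preE A) x y := by
      intro a b hab
      induction hab with
      | rel a b hr =>
        obtain ⟨e', he', hr⟩ := hr
        obtain ⟨⟨e, he⟩, rfl⟩ := c.onE.surjective e'
        rw [c.ends_eq, ends_eq_mk, Sym2.map_mk] at hr
        have ht : G.joined (c.preE A) (G.tail e) (G.head e) :=
          joined_of_ends ((c.mem_preE_iff he).2 he') (G.ends_eq_mk e)
        have hS : ∀ {x y}, c.onV x = c.onV y → G.joined (c.preE A) x y := fun h =>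
          joined_mono (c.subset_preE A) ((c.ker _ _).1 h)
        intro x y hx hy
        subst hx hy
        rcases Sym2.eq_iff.1 hr with ⟨h1, h2⟩ | ⟨h1, h2⟩
        · exact Setoid.trans' _ (hS h1.symm) (Setoid.trans' _ ht (hS h2))
        · exact Setoid.trans' _ (hS h2.symm) (Setoid.trans' _ (Setoid.symm' _ ht) (hS h1))
      | refl a =>
        intro x y hx hy
        exact joined_mono (c.subset_preE A) ((c.ker _ _).1 (hx.trans hy.symm))
      | symm a b _ ih => exact fun x y hx hy => Setoid.symm' _ (ih y x hy hx)
      | trans a b d _ _ ih ih' =>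
        intro x y hx hy
        obtain ⟨z, rfl⟩ := c.surj b
        exact Setoid.trans' _ (ih x z hx rfl) (ih' z y rfl hy)
    exact key _ _ h x y rfl rfl
  · intro h
    refine joined_le ((T.joined A).comap c.onV) (fun e he x y hr => ?_) h
    by_cases heS : e ∈ S
    · change T.joined A (c.onV x) (c.onV y)
      rw [(c.ker _ _).2 (joined_of_ends heS hr)]
    · exact joined_of_ends (he heS) (by rw [c.ends_eq, hr]; rfl)

theorem w_eq_fun : (fun v => (T.w v : ℤ) - 1) = push c.onV (fun x => (G.w x : ℤ) - 1) +
    push (fun e => c.onV (G.tail e)) (S.indicator 1) :=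
  funext c.w_eq

/-- Push-forwards of functions on the edges of a contraction can be computed before contracting. -/
theorem push_edges {γ : Type*} {f : T.E → γ} {f' : G.E → γ} {a : T.E → ℤ} {a' : G.E → ℤ}
    (h0 : ∀ e ∈ S, a' e = 0) (ha : ∀ e h, a' e = a (c.onE ⟨e, h⟩))
    (hf : ∀ e h, a' e ≠ 0 → f' e = f (c.onE ⟨e, h⟩)) : push f a = push f' a' := by
  symm
  refine push_of_injective (fun e => (c.onE.symm e).1)
    (Subtype.val_injective.comp c.onE.symm.injective) (fun e he => ?_) (fun e => ?_) fun e he => ?_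
  · by_contra h
    refine he ⟨c.onE ⟨e, fun h' => h (h0 e h')⟩, by simp⟩
  · rw [ha _ (c.onE.symm e).2]; simp
  · rw [hf _ (c.onE.symm e).2]
    · simp
    · rw [ha _ (c.onE.symm e).2]; simpa using he

theorem preE_iff {S' : Set T.E} {e : G.E} : e ∈ c.preE S' ↔ e ∈ S ∨ ∃ h, c.onE ⟨e, h⟩ ∈ S' := by
  by_cases h : e ∈ S <;> simp [preE, h]

/-- Contracting in two stages. -/
noncomputable def comp {S' : Set T.E} (d : Contr T U S') {S'' : Set G.E} (hS : S'' = c.preE S') :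
    Contr G U S'' where
  onV := d.onV ∘ c.onV
  surj := d.surj.comp c.surj
  ker x y := by rw [Function.comp, Function.comp, d.ker, c.joined_iff, hS]
  onE := Equiv.ofBijective (fun e => d.onE
      ⟨c.onE ⟨e.1, fun h => e.2 (hS.ge (c.subset_preE _ h))⟩,
        fun h => e.2 (hS.ge ((c.mem_preE_iff _).2 h))⟩) <| by
    subst hS
    constructor
    · intro e e' h
      simpa [Subtype.ext_iff] using h
    · intro u
      obtain ⟨⟨t, ht⟩, rfl⟩ := d.onE.surjective u
      obtain ⟨⟨e, he⟩, rfl⟩ := c.onE.surjective t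
      exact ⟨⟨e, c.not_mem_preE_iff.2 ⟨he, ht⟩⟩, rfl⟩
  ends_eq e := by
    rw [Equiv.ofBijective_apply, d.ends_eq, c.ends_eq, Sym2.map_map]
  w_eq v := by
    rw [d.w_eq, c.w_eq_fun, push_add, push_push, push_push, Pi.add_apply, add_assoc]
    congr 1
    have h1 : push (fun e => d.onV (T.tail e)) (S'.indicator 1) =
        push (fun e => d.onV (c.onV (G.tail e))) ((c.preE S' \ S).indicator 1) := by
      refine c.push_edges (fun e he => by simp [he]) (fun e h => ?_) (fun e h hne => ?_)
      · by_cases h' : c.onE ⟨e, h⟩ ∈ S' <;> simp [h, h', c.mem_preE_iff h]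
      · have he : e ∈ c.preE S' \ S := by
          by_contra h'; exact hne (indicator_of_notMem h' _)
        refine d.onV_eq_of_mem (he.1 h) ?_ (T.tail_mem _)
        rw [c.ends_eq]
        exact Sym2.mem_map.2 ⟨_, G.tail_mem e, rfl⟩
    rw [h1]
    change push (fun e => d.onV (c.onV (G.tail e))) _ v + _ = push (fun e => d.onV (c.onV (G.tail e))) _ v
    rw [← Pi.add_apply, ← push_add]
    congr 1
    ext e
    rw [hS, Pi.add_apply]
    have := c.subset_preE S'
    by_cases h1 : e ∈ S
    · simp [h1, this h1]
    · by_cases h2 : e ∈ c.preE S' <;> simp [h1, h2]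

/-- The trivial contraction given by an isomorphism. -/
noncomputable def ofIso (f : WIso G T) : Contr G T ∅ where
  onV := f.onV
  surj := f.onV.surjective
  ker x y := by
    rw [f.onV.apply_eq_iff_eq]
    refine ⟨fun h => h ▸ Setoid.refl' _ _, fun h => ?_⟩
    exact joined_le (S := (∅ : Set G.E)) ⊥ (fun e he => absurd he (by simp)) h
  onE := (Equiv.subtypeUnivEquiv (fun e => by simp)).trans f.onE
  ends_eq e := f.ends_eq _
  w_eq v := by
    have : (fun x => (G.w x : ℤ) - 1) = (fun v => (T.w v : ℤ) - 1) ∘ f.onV := by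
      ext x; simp [f.w_eq]
    rw [show push f.onV (fun x => (G.w x : ℤ) - 1) v = push id (fun v => (T.w v : ℤ) - 1) v from
      congrFun (by rw [this]; exact (push_equiv f.onV id _).symm) v]
    classical
    let _ := Fintype.ofFinite G.E
    let _ := Fintype.ofFinite T.V
    rw [push_eq_sum, push_eq_sum]
    simp

/-- A contraction is determined up to isomorphism by the set of contracted edges. -/
noncomputable def uniq (c : Contr G T S) (d : Contr G U S) : WIso T U where
  onV := Equiv.ofBijective (fun t => d.onV (Function.surjInv c.surj t)) <| by
    constructor
    · intro a b h
      have := (c.ker _ _).2 ((d.ker _ _).1 h)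
      rwa [Function.surjInv_eq c.surj, Function.surjInv_eq c.surj] at this
    · intro u
      obtain ⟨x, rfl⟩ := d.surj u
      exact ⟨c.onV x, (d.ker _ _).2 ((c.ker _ _).1 (Function.surjInv_eq _ _))⟩
  onE := c.onE.symm.trans d.onE
  ends_eq t := by
    obtain ⟨e, rfl⟩ := c.onE.surjective t
    simp only [Equiv.trans_apply, Equiv.symm_apply_apply, d.ends_eq, c.ends_eq, Sym2.map_map]
    congr 1
    ext x
    exact (d.ker _ _).2 ((c.ker _ _).1 (Function.surjInv_eq _ _).symm)
  w_eq t := by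
    have h : ∀ x, d.onV (Function.surjInv c.surj (c.onV x)) = d.onV x := fun x =>
      (d.ker _ _).2 ((c.ker _ _).1 (Function.surjInv_eq _ _))
    have hinj : ∀ x, d.onV x = d.onV (Function.surjInv c.surj t) ↔ c.onV x = t := fun x => by
      rw [d.ker, ← c.ker, Function.surjInv_eq c.surj]
    zify
    have h1 := c.w_eq t
    have h2 := d.w_eq (d.onV (Function.surjInv c.surj t))
    classical
    let _ := Fintype.ofFinite G.E
    let _ := Fintype.ofFinite G.V
    rw [push_eq_sum, push_eq_sum] at h1 h2
    simp only [hinj] at h2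
    rw [← h1] at h2
    exact sub_left_injective h2

theorem uniq_onE (c : Contr G T S) (d : Contr G U S) (e : {e // e ∉ S}) :
    (c.uniq d).onE (c.onE e) = d.onE e := by
  simp [uniq]

end Contr

/-- A component of the graph `(V, S)` has at most one vertex more than it has edges. -/
theorem WGraph.card_component_le (G : WGraph) (S : Set G.E) (c : Quotient (G.joined S)) :
    Nat.card {v : G.V // Quotient.mk (G.joined S) v = c} ≤
      Nat.card {e : G.E // e ∈ S ∧ ∀ v ∈ G.ends e, Quotient.mk (G.joined S) v = c} + 1 := by
  let K : WGraph :=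
    { V := {v : G.V // Quotient.mk (G.joined S) v = c}
      E := {e : G.E // e ∈ S ∧ ∀ v ∈ G.ends e, Quotient.mk (G.joined S) v = c}
      finV := inferInstance
      finE := inferInstance
      ends := fun e => s(⟨G.tail e.1, e.2.2 _ (G.tail_mem _)⟩,
        ⟨G.head e.1, e.2.2 _ (by rw [G.ends_eq_mk]; exact Sym2.mem_mk_right _ _)⟩)
      w := fun _ => 0 }
  have hK : K.Connected := by
    obtain ⟨v, rfl⟩ := Quotient.exists_rep c
    refine ⟨⟨⟨v, rfl⟩⟩, ?_⟩
    have key : ∀ x y, G.joined S x y → ∀ (hx : Quotient.mk (G.joined S) x = ⟦v⟧)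
        (hy : Quotient.mk (G.joined S) y = ⟦v⟧), K.joined univ ⟨x, hx⟩ ⟨y, hy⟩ := by
      intro x y hxy
      induction hxy with
      | rel x y hr =>
        obtain ⟨e, he, hr⟩ := hr
        intro hx hy
        have h0 : ∀ v' ∈ G.ends e, Quotient.mk (G.joined S) v' = ⟦v⟧ := by
          rw [hr]; intro v' hv'
          rcases Sym2.mem_iff.1 hv' with rfl | rfl
          exacts [hx, hy]
        refine joined_of_ends (e := (⟨e, he, h0⟩ : K.E)) (mem_univ _) ?_
        have h1 := hr
        rw [G.ends_eq_mk e] at h1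
        change s(_, _) = s(_, _)
        rcases Sym2.eq_iff.1 h1 with ⟨h1, h2⟩ | ⟨h1, h2⟩
        · exact Sym2.eq_iff.2 (Or.inl ⟨Subtype.ext h1, Subtype.ext h2⟩)
        · exact Sym2.eq_iff.2 (Or.inr ⟨Subtype.ext h1, Subtype.ext h2⟩)
      | refl x => exact fun _ _ => Setoid.refl' _ _
      | symm x y _ ih => exact fun hx hy => Setoid.symm' _ (ih hy hx)
      | trans x y z h1 h2 ih ih' =>
        intro hx hz
        have hy : Quotient.mk (G.joined S) y = ⟦v⟧ := by rw [← hx]; exact (Quotient.sound h1).symm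
        exact Setoid.trans' _ (ih hx hy) (ih' hy hz)
    exact fun x y => key _ _ (Quotient.exact (x.2.trans y.2.symm)) x.2 y.2
  exact hK.card_le

/-- The weight of a contracted vertex, without truncated subtraction: `w - 1` is the sum of `w - 1` over
the vertices contracted to it, plus the number of edges contracted to it. -/
theorem WGraph.contract_w (G : WGraph) (S : Set G.E) (c : Quotient (G.joined S)) :
    ((G.contract S).w c : ℤ) - 1 = push (Quotient.mk (G.joined S)) (fun x => (G.w x : ℤ) - 1) c +
      push (fun e => Quotient.mk (G.joined S) (G.tail e)) (S.indicator 1) c := by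
  have h := G.card_component_le S c
  have hE : Nat.card {e : G.E // e ∈ S ∧ ∀ v ∈ G.ends e, Quotient.mk (G.joined S) v = c} =
      Nat.card {e : G.E // e ∈ S ∧ Quotient.mk (G.joined S) (G.tail e) = c} := by
    refine Nat.card_congr (Equiv.subtypeEquivRight fun e => and_congr_right fun he => ?_)
    refine ⟨fun h => h _ (G.tail_mem e), fun h v hv => ?_⟩
    rw [← h]
    exact Quotient.sound (joined_of_mem he hv (G.tail_mem e))
  have hw : ((∑ᶠ v : {v : G.V // Quotient.mk (G.joined S) v = c}, G.w v.1 : ℕ) : ℤ) =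
      push (Quotient.mk (G.joined S)) (fun x => (G.w x : ℤ)) c := by
    classical
    let _ := Fintype.ofFinite G.V
    rw [finsum_eq_sum_of_fintype, push_eq_sum, ← Finset.sum_filter]
    push_cast
    exact (Finset.sum_subtype (Finset.univ.filter fun v => Quotient.mk (G.joined S) v = c)
      (fun v => by rw [Finset.mem_filter]; simp) fun v => (G.w v : ℤ)).symm
  have hp : push (Quotient.mk (G.joined S)) (fun x => (G.w x : ℤ) - 1) c =
      push (Quotient.mk (G.joined S)) (fun x => (G.w x : ℤ)) c -
        Nat.card {v : G.V // Quotient.mk (G.joined S) v = c} := by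
    rw [← push_one, eq_sub_iff_add_eq, ← Pi.add_apply, ← push_add]
    congr 1
    ext x
    exact sub_add_cancel _ _
  rw [hp, push_indicator, ← hw, ← hE]
  change (((∑ᶠ v : {v : G.V // Quotient.mk (G.joined S) v = c}, G.w v.1) +
    (Nat.card {e : G.E // e ∈ S ∧ ∀ v ∈ G.ends e, Quotient.mk (G.joined S) v = c} + 1
    - Nat.card {v : G.V // Quotient.mk (G.joined S) v = c}) : ℕ) : ℤ) - 1 = _
  omega

/-- The contraction of a set of edges. -/
noncomputable def WGraph.toContract (G : WGraph) (S : Set G.E) : Contr G (G.contract S) S where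
  onV := Quotient.mk (G.joined S)
  surj := Quotient.mk_surjective
  ker _ _ := Quotient.eq
  onE := Equiv.refl _
  ends_eq _ := rfl
  w_eq := G.contract_w S

namespace Contr

variable {G T : WGraph} {S : Set G.E}

theorem connected (c : Contr G T S) (h : G.Connected) : T.Connected := by
  obtain ⟨⟨v⟩, h⟩ := h
  refine ⟨⟨c.onV v⟩, fun a b => ?_⟩
  obtain ⟨x, rfl⟩ := c.surj a
  obtain ⟨y, rfl⟩ := c.surj b
  rw [c.joined_iff]
  exact joined_mono (fun e _ => fun _ => mem_univ _) (h x y)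

/-- The complement of a set of edges that are not contracted is connected if and only if it is
connected after contraction. -/
theorem joined_compl_iff (c : Contr G T S) (A : Set T.E) : (∀ a b, T.joined Aᶜ a b) ↔
    ∀ x y, G.joined {e | ∃ h, c.onE ⟨e, h⟩ ∈ A}ᶜ x y := by
  have : {e | ∃ h, c.onE ⟨e, h⟩ ∈ A}ᶜ = c.preE Aᶜ := by
    ext e; simp [preE]
  rw [this]
  constructor
  · exact fun h x y => (c.joined_iff _ _ _).1 (h _ _)
  · intro h a b
    obtain ⟨x, rfl⟩ := c.surj a
    obtain ⟨y, rfl⟩ := c.surj b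
    exact (c.joined_iff _ _ _).2 (h x y)

theorem joined_compl_singleton_iff (c : Contr G T S) (e : {e // e ∉ S}) :
    (∀ a b, T.joined {c.onE e}ᶜ a b) ↔ ∀ x y, G.joined {e.1}ᶜ x y := by
  rw [c.joined_compl_iff]
  have : {e' | ∃ h, c.onE ⟨e', h⟩ ∈ ({c.onE e} : Set T.E)} = {e.1} := by
    ext e'
    constructor
    · rintro ⟨h, h'⟩
      simpa [← Subtype.val_inj] using h'
    · rintro rfl
      exact ⟨e.2, rfl⟩
  rw [this]

theorem joined_compl_pair_iff (c : Contr G T S) (e e' : {e // e ∉ S}) :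
    (∀ a b, T.joined {c.onE e, c.onE e'}ᶜ a b) ↔ ∀ x y, G.joined {e.1, e'.1}ᶜ x y := by
  rw [c.joined_compl_iff]
  have : {f | ∃ h, c.onE ⟨f, h⟩ ∈ ({c.onE e, c.onE e'} : Set T.E)} = {e.1, e'.1} := by
    ext f
    constructor
    · rintro ⟨h, h'⟩
      simpa [← Subtype.val_inj] using h'
    · rintro (rfl | rfl)
      · exact ⟨e.2, Or.inl rfl⟩
      · exact ⟨e'.2, Or.inr rfl⟩
  rw [this]

theorem twoEdgeConnected (c : Contr G T S) (h : G.TwoEdgeConnected) : T.TwoEdgeConnected := by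
  refine ⟨c.connected h.1, fun e => ?_⟩
  obtain ⟨e, rfl⟩ := c.onE.surjective e
  exact (c.joined_compl_singleton_iff e).2 (h.2 e.1)

theorem card_edges (c : Contr G T S) : Nat.card G.E = Nat.card T.E + Nat.card S := by
  classical
  rw [← Nat.card_congr (Equiv.sumCompl (fun e => e ∈ S)), Nat.card_sum, add_comm,
    ← Nat.card_congr c.onE]

theorem genus_eq (c : Contr G T S) : T.genus = G.genus := by
  rw [genus_eq_total, genus_eq_total, c.w_eq_fun, total_add, total_push, total_push, c.card_edges]
  have : total (S.indicator (1 : G.E → ℤ)) = Nat.card S := by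
    unfold total; rw [push_indicator]; simp
  rw [this]
  push_cast
  ring

/-- The canonical divisor of a contraction is the push-forward of the canonical divisor. -/
theorem canon_eq (c : Contr G T S) (v : T.V) : T.canon v = push c.onV G.canon v := by
  have hG : G.canon = push G.tail 1 + push G.head 1 + (fun x => 2 * ((G.w x : ℤ) - 1)) := by
    ext x; simp [canon, valence_eq_push]
  have hT : (T.valence v : ℤ) = push (fun e => c.onV (G.tail e)) (Sᶜ.indicator 1) v +
      push (fun e => c.onV (G.head e)) (Sᶜ.indicator 1) v := by
    classical
    let _ := Fintype.ofFinite T.E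
    let _ := Fintype.ofFinite {e // e ∉ S}
    have h1 : ∀ f : G.E → T.V, push f (Sᶜ.indicator 1) = push (fun e : {e // e ∉ S} => f e.1) 1 :=
      fun f => push_of_injective _ Subtype.val_injective (fun e he => by simpa using he)
        (fun e => by simp) fun _ _ => rfl
    rw [valence_eq_push, h1, h1, push_equiv c.onE T.tail, push_equiv c.onE T.head]
    simp only [push_eq_sum]
    rw [← Finset.sum_add_distrib, ← Finset.sum_add_distrib]
    refine Finset.sum_congr rfl fun e _ => ?_
    have h := c.ends_eq e
    rw [G.ends_eq_mk, T.ends_eq_mk, Sym2.map_mk] at h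
    simp only [Function.comp_apply, Pi.one_apply]
    rcases Sym2.eq_iff.1 h with ⟨h1, h2⟩ | ⟨h1, h2⟩
    · rw [h1, h2]
    · rw [h1, h2, add_comm]
  have hS : push (fun e => c.onV (G.head e)) (S.indicator 1) =
      push (fun e => c.onV (G.tail e)) (S.indicator 1) := by
    refine push_congr (fun _ => rfl) fun e he => ?_
    have heS : e ∈ S := by
      by_contra h; exact he (indicator_of_notMem h _)
    refine c.onV_eq_of_mem heS ?_ (G.tail_mem e)
    rw [G.ends_eq_mk]; exact Sym2.mem_mk_right _ _
  have hsplit : ∀ f : G.E → T.V, push f 1 = push f (S.indicator 1) + push f (Sᶜ.indicator 1) := by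
    intro f
    rw [← push_add, indicator_self_add_compl]
  unfold canon at hG ⊢
  rw [hG, push_add, push_add, push_push, push_push, hT, c.w_eq]
  have h2 : push c.onV (fun x => 2 * ((G.w x : ℤ) - 1)) v =
      2 * push c.onV (fun x => (G.w x : ℤ) - 1) v := push_mul_left _ _ _ _
  simp only [Pi.add_apply]
  rw [h2]
  change _ = push (fun e => c.onV (G.tail e)) 1 v + push (fun e => c.onV (G.head e)) 1 v + _
  rw [hsplit, hsplit, hS]
  simp only [Pi.add_apply]
  ring

/-- Contracting a graph whose canonical divisor is positive gives a stable graph. -/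
theorem stable (c : Contr G T S) (h : ∀ x, 1 ≤ G.canon x) : T.Stable := by
  intro v hv
  have h1 := c.canon_eq v
  obtain ⟨x, rfl⟩ := c.surj v
  have h2 : G.canon x ≤ push c.onV G.canon (c.onV x) := le_push (fun y => by linarith [h y]) x
  have := h x
  change (T.valence _ : ℤ) + 2 * ((T.w _ : ℤ) - 1) = _ at h1
  rw [hv] at h1
  push_cast at h1
  omega

end Contr

/-! ### Trees with legs and generalised ladders -/

theorem push_sum {α β γ : Type*} [Finite α] [Finite β] (f : α ⊕ β → γ) (a : α ⊕ β → ℤ) (c : γ) :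
    push f a c = push (f ∘ Sum.inl) (a ∘ Sum.inl) c + push (f ∘ Sum.inr) (a ∘ Sum.inr) c := by
  classical
  let _ := Fintype.ofFinite α
  let _ := Fintype.ofFinite β
  simp [push_eq_sum, Fintype.sum_sum_type]

theorem push_prod_bool {α γ : Type*} [Finite α] (f : α × Bool → γ) (a : α × Bool → ℤ) (c : γ) :
    push f a c = push (fun x => f (x, false)) (fun x => a (x, false)) c +
      push (fun x => f (x, true)) (fun x => a (x, true)) c := by
  classical
  let _ := Fintype.ofFinite α
  simp [push_eq_sum, Fintype.sum_prod_type, Finset.sum_add_distrib, add_comm]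

/-- A finite tree with legs. An edge `e` consists of the two half-edges `(e, false)` and `(e, true)`,
and `root` and `leg` give the vertices at which the half-edges and the legs are attached. To be a tree
means to be connected and to have one edge less than vertices. -/
structure LegTree : Type 1 where
  W : Type
  E : Type
  L : Type
  finW : Finite W
  finE : Finite E
  finL : Finite L
  root : E × Bool → W
  leg : L → W
  conn : WGraph.Connected ⟨W, E, finW, finE, fun e => s(root (e, false), root (e, true)), fun _ => 0⟩
  card : Nat.card E + 1 = Nat.card W

attribute [instance] LegTree.finW LegTree.finE LegTree.finL

namespace LegTree

variable (R : LegTree)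

/-- The underlying tree, as a multigraph of weight zero. -/
abbrev base : WGraph where
  V := R.W
  E := R.E
  finV := inferInstance
  finE := inferInstance
  ends := fun e => s(R.root (e, false), R.root (e, true))
  w := fun _ => 0

/-- The generalised ladder of a tree with legs: two copies of the tree, with an edge between the two
copies of a vertex for every leg at this vertex. The two copies of an edge of the tree are related. -/
abbrev dbl : CGraph where
  V := R.W × Bool
  E := (R.E × Bool) ⊕ R.L
  finV := inferInstance
  finE := inferInstance
  ends := Sum.elim (fun e => s((R.root (e.1, false), e.2), (R.root (e.1, true), e.2)))
    fun l => s((R.leg l, false), (R.leg l, true))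
  w := fun _ => 0
  rel := Setoid.ker (Sum.map Prod.fst id)

/-- The valence of a vertex, legs included. -/
noncomputable def val (y : R.W) : ℕ :=
  Nat.card {h : (R.E × Bool) ⊕ R.L // Sum.elim R.root R.leg h = y}

theorem val_eq_push (y : R.W) : (R.val y : ℤ) = push (fun e => R.root (e, false)) 1 y +
    push (fun e => R.root (e, true)) 1 y + push R.leg 1 y := by
  rw [val, ← push_one, push_sum, push_prod_bool]
  rfl

theorem canon_dbl (x : R.dbl.V) : R.dbl.canon x = R.val x.1 - 2 := by
  obtain ⟨y, b⟩ := x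
  have h := valence_eq_of_ends (G := R.dbl.toWGraph)
    (t := Sum.elim (fun e => (R.root (e.1, false), e.2)) fun l => (R.leg l, false))
    (h := Sum.elim (fun e => (R.root (e.1, true), e.2)) fun l => (R.leg l, true))
    (by rintro (e | l) <;> rfl) (y, b)
  have h2 : (R.dbl.valence (y, b) : ℤ) = R.val y := by
    rw [h, val_eq_push]
    classical
    let _ := Fintype.ofFinite R.E
    let _ := Fintype.ofFinite R.L
    have hE : ∀ r : R.E → R.W, push (fun e : R.E × Bool => (r e.1, e.2)) 1 (y, b) = push r 1 y := by
      intro r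
      rw [push_prod_bool]
      simp only [push_eq_sum]
      cases b <;> simp
    have hL : ∀ b', push (fun l => (R.leg l, b')) 1 (y, b) = if b' = b then push R.leg 1 y else 0 := by
      intro b'
      simp only [push_eq_sum]
      by_cases h : b' = b <;> simp [h]
    have e1 := push_sum (Sum.elim (fun e : R.E × Bool => (R.root (e.1, false), e.2))
      fun l => (R.leg l, false)) 1 (y, b)
    have e2 := push_sum (Sum.elim (fun e : R.E × Bool => (R.root (e.1, true), e.2))
      fun l => (R.leg l, true)) 1 (y, b)
    have e1' := e1.trans (congrArg₂ (· + ·) (hE fun e => R.root (e, false)) (hL false))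
    have e2' := e2.trans (congrArg₂ (· + ·) (hE fun e => R.root (e, true)) (hL true))
    refine (congrArg₂ (· + ·) e1' e2').trans ?_
    cases b <;> simp <;> ring
  unfold canon
  rw [h2]
  simp
  ring

theorem genus_dbl : R.dbl.genus = (Nat.card R.L : ℤ) - 1 := by
  have h : R.dbl.genus = (Nat.card ((R.E × Bool) ⊕ R.L) : ℤ) - Nat.card (R.W × Bool) + 1 +
    ∑ᶠ v : R.W × Bool, ((0 : ℕ) : ℤ) := rfl
  rw [h, Nat.card_sum, Nat.card_prod, Nat.card_prod, ← R.card]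
  simp
  ring

/-- The handshake lemma. -/
theorem total_val : total (fun y => (R.val y : ℤ)) = 2 * Nat.card R.E + Nat.card R.L := by
  have : (fun y => (R.val y : ℤ)) = push (fun e => R.root (e, false)) 1 +
      push (fun e => R.root (e, true)) 1 + push R.leg 1 := funext R.val_eq_push
  rw [this, total_add, total_add, total_push, total_push, total_push, total_one, total_one]
  ring

/-- A nonempty set `D` of vertices of a tree spans less than `|D|` edges. -/
theorem card_inner_lt {D : Set R.W} (hD : D.Nonempty) :
    Nat.card {e // R.root (e, false) ∈ D ∧ R.root (e, true) ∈ D} < Nat.card D := by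
  classical
  let col : R.W → Option {w // w ∉ D} := fun w => if h : w ∈ D then none else some ⟨w, h⟩
  have hcol : ∀ {w w'}, w ∈ D → w' ∈ D → col w = col w' := fun h h' => by simp [col, h, h']
  -- the set `D` is collapsed to a point
  let K : WGraph :=
    { V := Option {w // w ∉ D}
      E := R.E
      finV := inferInstance
      finE := inferInstance
      ends := fun e => s(col (R.root (e, false)), col (R.root (e, true)))
      w := fun _ => 0 }
  let S : Set R.E := {e | R.root (e, false) ∈ D ∧ R.root (e, true) ∈ D}
  have hK : ∀ x y, K.joined Sᶜ x y := by
    have key : ∀ u v, K.joined Sᶜ (col u) (col v) := by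
      intro u v
      refine joined_le (G := R.base) (S := univ) ((K.joined Sᶜ).comap col) (fun e _ x y he => ?_)
        (R.conn.2 u v)
      change K.joined Sᶜ (col x) (col y)
      have he' : K.ends e = s(col x, col y) := congrArg (Sym2.map col) he
      by_cases h : e ∈ S
      · have h1 : col x = col y := by
          rcases Sym2.eq_iff.1 he with ⟨h1, h2⟩ | ⟨h1, h2⟩
          · rw [← h1, ← h2]; exact hcol h.1 h.2
          · rw [← h1, ← h2]; exact hcol h.2 h.1
        rw [h1]
      · exact joined_of_ends (G := K) (S := Sᶜ) h he'
    have hs : Function.Surjective col := by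
      rintro (_ | ⟨w, hw⟩)
      · obtain ⟨w, hw⟩ := hD
        exact ⟨w, by simp [col, hw]⟩
      · exact ⟨w, by simp [col, hw]⟩
    intro x y
    obtain ⟨u, rfl⟩ := hs x
    obtain ⟨v, rfl⟩ := hs y
    exact key u v
  have : Nonempty K.V := ⟨none⟩
  have h1 := card_le_of_joined hK
  have h2 : Nat.card K.V = Nat.card {w // w ∉ D} + 1 := Finite.card_option
  have h3 : Nat.card D + Nat.card {w // w ∉ D} = Nat.card R.W := by
    rw [← Nat.card_sum]; exact Nat.card_congr (Equiv.sumCompl _)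
  have h4 : Nat.card S + Nat.card (Sᶜ : Set R.E) = Nat.card R.E := by
    rw [← Nat.card_sum]; exact Nat.card_congr (Equiv.Set.sumCompl _)
  have h5 := R.card
  change Nat.card S < _
  have h6 : Nat.card (Sᶜ : Set K.E) = Nat.card (Sᶜ : Set R.E) := rfl
  omega

/-- If all valences are at least three, then at least three edges and legs leave a nonempty set of
vertices. -/
theorem three_le_boundary (h3 : ∀ y, 3 ≤ R.val y) {D : Set R.W} (hD : D.Nonempty) :
    3 ≤ Nat.card {e // Xor (R.root (e, false) ∈ D) (R.root (e, true) ∈ D)} +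
      Nat.card {l // R.leg l ∈ D} := by
  classical
  let _ := Fintype.ofFinite R.E
  let _ := Fintype.ofFinite R.L
  let _ := Fintype.ofFinite R.W
  have h1 := R.card_inner_lt hD
  have h2 : push (· ∈ D) (fun y => (R.val y : ℤ)) True =
      2 * Nat.card {e // R.root (e, false) ∈ D ∧ R.root (e, true) ∈ D} +
      Nat.card {e // Xor (R.root (e, false) ∈ D) (R.root (e, true) ∈ D)} +
      Nat.card {l // R.leg l ∈ D} := by
    have : (fun y => (R.val y : ℤ)) = push (fun e => R.root (e, false)) 1 +
        push (fun e => R.root (e, true)) 1 + push R.leg 1 := funext R.val_eq_push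
    rw [this, push_add, push_add, push_push, push_push, push_push]
    simp only [Pi.add_apply, push_eq_sum, Nat.card_eq_fintype_card, Fintype.card_subtype,
      Finset.card_filter, Function.comp_apply, eq_iff_iff, iff_true]
    push_cast
    rw [Finset.mul_sum, ← Finset.sum_add_distrib, ← Finset.sum_add_distrib]
    congr 1
    refine Finset.sum_congr rfl fun e _ => ?_
    by_cases ha : R.root (e, false) ∈ D <;> by_cases hb : R.root (e, true) ∈ D <;>
      simp [ha, hb, Xor]
  have h4 : 3 * (Nat.card D : ℤ) ≤ push (· ∈ D) (fun y => (R.val y : ℤ)) True := by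
    rw [push_eq_sum, Nat.card_eq_fintype_card, Fintype.card_subtype, Finset.card_filter]
    push_cast
    rw [Finset.mul_sum]
    refine Finset.sum_le_sum fun y _ => ?_
    have := h3 y
    by_cases hy : y ∈ D <;> simp [hy]
    exact_mod_cast this
  omega

/-- The only pairs of edges that disconnect a generalised ladder are the pairs of related edges. -/
theorem dbl_joined_compl_iff (h3 : ∀ y, 3 ≤ R.val y) (e e' : R.dbl.E) :
    (∀ x y, R.dbl.joined {e, e'}ᶜ x y) ↔ e = e' ∨ ¬ R.dbl.rel e e' := by
  constructor
  · intro h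
    by_contra! hc
    obtain ⟨hne, hr⟩ := hc
    have hr' : Sum.map Prod.fst id e = Sum.map Prod.fst id e' := hr
    rcases e with ⟨t, b⟩ | l
    swap
    · rcases e' with ⟨t', b'⟩ | l'
      · simp at hr'
      · simp at hr'; exact hne (by rw [hr'])
    rcases e' with ⟨t', b'⟩ | l'
    swap
    · simp at hr'
    obtain rfl : t = t' := by simpa using hr'
    have hb : b' = !b := by
      have hbb : b ≠ b' := fun h => hne (by rw [h])
      cases b <;> cases b' <;> simp at hbb ⊢
    subst hb
    have hj : ∀ x y, R.base.joined {t}ᶜ x y := by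
      intro x y
      refine joined_le (G := R.dbl.toWGraph) ((R.base.joined {t}ᶜ).comap (fun z : R.W × Bool => z.1))
        (fun a ha u v hu => ?_) (h (x, false) (y, false))
      change R.base.joined {t}ᶜ u.1 v.1
      have hu' := congrArg (Sym2.map (fun z : R.W × Bool => z.1)) hu
      rcases a with ⟨a, b'⟩ | l
      · have hat : a ≠ t := by
          rintro rfl
          refine ha ?_
          cases b <;> cases b' <;> first | exact Or.inl rfl | exact Or.inr rfl
        exact joined_of_ends (G := R.base) (S := {t}ᶜ) (e := a) hat hu'
      · have : s(R.leg l, R.leg l) = s(u.1, v.1) := hu'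
        have huv : u.1 = v.1 := by
          rcases Sym2.eq_iff.1 this with ⟨h1, h2⟩ | ⟨h1, h2⟩ <;> rw [← h1, ← h2]
        rw [huv]
    have : Nonempty R.base.V := R.conn.1
    have h1 := card_le_of_joined hj
    have h2 : Nat.card ({t} : Set R.E) + Nat.card (({t}ᶜ : Set R.E)) = Nat.card R.E := by
      classical
      rw [← Nat.card_sum]; exact Nat.card_congr (Equiv.Set.sumCompl _)
    have h3 : Nat.card ({t} : Set R.E) = 1 := by simp
    have h4 : Nat.card (({t}ᶜ : Set R.base.E)) = Nat.card (({t}ᶜ : Set R.E)) := rfl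
    have h5 : Nat.card R.base.V = Nat.card R.W := rfl
    have := R.card
    omega
  · intro h
    by_contra! hc
    obtain ⟨x, y, hxy⟩ := hc
    let X : Set (R.W × Bool) := {z | R.dbl.joined {e, e'}ᶜ x z}
    have hx : x ∈ X := Setoid.refl' (R.dbl.joined {e, e'}ᶜ) x
    have hy : y ∉ X := hxy
    have hcut : ∀ a u v, R.dbl.ends a = s(u, v) → u ∈ X → v ∉ X → a = e ∨ a = e' := by
      intro a u v ha hu hv
      by_contra hn
      exact hv (Setoid.trans' _ hu (joined_of_ends (S := {e, e'}ᶜ) (by simpa using hn) ha))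
    have hcut' : ∀ a u v, R.dbl.ends a = s(u, v) → Xor (u ∈ X) (v ∈ X) → a = e ∨ a = e' := by
      rintro a u v ha (⟨hu, hv⟩ | ⟨hu, hv⟩)
      · exact hcut a u v ha hu hv
      · exact hcut a v u (by rw [ha, Sym2.eq_swap]) hu hv
    let D : Set R.W := {w | Xor ((w, false) ∈ X) ((w, true) ∈ X)}
    rcases D.eq_empty_or_nonempty with hD | hD
    · have hXb : ∀ w b b', (w, b) ∈ X ↔ (w, b') ∈ X := by
        intro w b b'
        have : w ∉ D := by rw [hD]; simp
        have h1 : (w, false) ∈ X ↔ (w, true) ∈ X := by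
          simpa [D, xor_iff_not_iff] using this
        cases b <;> cases b' <;> simp [h1]
      have : ∃ t : R.E, ¬ ((R.root (t, false), false) ∈ X ↔ (R.root (t, true), false) ∈ X) := by
        by_contra! hn
        let r : Setoid R.W := Setoid.comap (fun w => ((w, false) ∈ X)) ⊥
        have h1 : r x.1 y.1 := joined_le (G := R.base) (S := univ) r (fun a _ u v ha => by
          have h2 : ((R.root (a, false), false) ∈ X) = ((R.root (a, true), false) ∈ X) :=
            propext (hn a)
          rcases Sym2.eq_iff.1 ha with ⟨h3, h4⟩ | ⟨h3, h4⟩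
          · rw [← h3, ← h4]; exact h2
          · rw [← h3, ← h4]; exact h2.symm) (R.conn.2 x.1 y.1)
        have h2 : ((x.1, false) ∈ X) = ((y.1, false) ∈ X) := h1
        have h3 : (x.1, false) ∈ X := (hXb x.1 false x.2).2 hx
        rw [h2] at h3
        exact hy ((hXb y.1 false y.2).1 h3)
      obtain ⟨t, ht⟩ := this
      have hb : ∀ b, Sum.inl (t, b) = e ∨ Sum.inl (t, b) = e' := by
        intro b
        refine hcut' _ _ _ rfl ?_
        rw [xor_iff_not_iff]
        exact fun h => ht ((hXb _ false b).trans (h.trans (hXb _ b false)))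
      have h0 : ∀ b b', R.dbl.rel (Sum.inl (t, b)) (Sum.inl (t, b')) := fun _ _ => rfl
      have hft : (Sum.inl (t, false) : (R.E × Bool) ⊕ R.L) ≠ Sum.inl (t, true) := by simp
      rcases hb false with rfl | rfl <;> rcases hb true with h' | h'
      · exact hft h'.symm
      · subst h'; exact h.elim hft fun h => h (h0 _ _)
      · subst h'; exact h.elim (fun h => hft h.symm) fun h => h (h0 _ _)
      · exact hft h'.symm
    · have h1 := R.three_le_boundary h3 hD
      have hsel : ∀ t, Xor (R.root (t, false) ∈ D) (R.root (t, true) ∈ D) →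
          ∃ b, Xor ((R.root (t, false), b) ∈ X) ((R.root (t, true), b) ∈ X) := by
        intro t ht
        by_contra! hn
        have hf := hn false
        have htt := hn true
        simp only [D, mem_ofPred_eq, xor_iff_not_iff, not_not] at ht hf htt
        rw [hf, htt] at ht
        exact ht Iff.rfl
      choose! b hb using hsel
      let i : {t // Xor (R.root (t, false) ∈ D) (R.root (t, true) ∈ D)} ⊕ {l // R.leg l ∈ D} →
          ({e, e'} : Set R.dbl.E) :=
        Sum.elim (fun t => ⟨Sum.inl (t.1, b t.1), hcut' _ _ _ rfl (hb t.1 t.2)⟩)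
          fun l => ⟨Sum.inr l.1, hcut' _ _ _ rfl l.2⟩
      have hi : Function.Injective i := by
        rintro (⟨t, _⟩ | ⟨l, _⟩) (⟨t', _⟩ | ⟨l', _⟩) hh
        · have := congrArg Subtype.val hh
          exact congrArg Sum.inl (Subtype.ext (Prod.mk.inj (Sum.inl.inj this)).1)
        · have := congrArg Subtype.val hh
          simp [i] at this
        · have := congrArg Subtype.val hh
          simp [i] at this
        · have := congrArg Subtype.val hh
          exact congrArg Sum.inr (Subtype.ext (Sum.inr.inj this))
      have h2 := Nat.card_le_card_of_injective i hi
      rw [Nat.card_sum, Nat.card_coe_set_eq] at h2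
      have h4 : ({e, e'} : Set R.dbl.E).ncard ≤ 2 := by
        exact (Set.ncard_insert_le _ _).trans (by simp)
      omega

theorem dbl_twoEdgeConnected (h3 : ∀ y, 3 ≤ R.val y) : R.dbl.TwoEdgeConnected := by
  have h : ∀ e x y, R.dbl.joined {e}ᶜ x y := by
    intro e
    have := (R.dbl_joined_compl_iff h3 e e).2 (Or.inl rfl)
    rwa [pair_eq_singleton] at this
  obtain ⟨w⟩ := R.conn.1
  refine ⟨⟨⟨(w, false)⟩, fun x y => ?_⟩, h⟩
  have hh : Nonempty R.dbl.E := by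
    have := h3 w
    have : Nonempty {h : (R.E × Bool) ⊕ R.L // Sum.elim R.root R.leg h = w} := by
      by_contra hn
      rw [not_nonempty_iff] at hn
      rw [val, Nat.card_of_isEmpty] at this
      omega
    exact this.map Subtype.val
  obtain ⟨e⟩ := hh
  exact joined_mono (subset_univ _) (h e x y)

end LegTree

/-! ### Specialisations of constrained graphs -/

/-- A contraction is described by the inclusion `i` of the edges that are not contracted, where
`t e` is the vertex to which the edge `e` is contracted. -/
noncomputable def Contr.ofIncl {G T : WGraph} {S : Set G.E} (f : G.V → T.V)
    (hf : Function.Surjective f) (t : G.E → T.V) (ht : ∀ e ∈ S, ∀ x ∈ G.ends e, f x = t e)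
    (hj : ∀ x y, f x = f y → G.joined S x y) (i : T.E → G.E) (hi : Function.Injective i)
    (hr : ∀ e, e ∈ range i ↔ e ∉ S) (he : ∀ a, T.ends a = (G.ends (i a)).map f)
    (hw : ∀ v, (T.w v : ℤ) - 1 = push f (fun x => (G.w x : ℤ) - 1) v + push t (S.indicator 1) v) :
    Contr G T S where
  onV := f
  surj := hf
  ker x y := by
    refine ⟨hj x y, fun h => ?_⟩
    exact joined_le (Setoid.ker f) (fun e heS u v huv =>
      (ht e heS u (by simp [huv])).trans (ht e heS v (by simp [huv])).symm) h
  onE := ((Equiv.ofInjective i hi).trans (Equiv.subtypeEquivRight hr)).symm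
  ends_eq e := by
    obtain ⟨a, rfl⟩ := ((Equiv.ofInjective i hi).trans (Equiv.subtypeEquivRight hr)).surjective e
    rw [Equiv.symm_apply_apply, he]
    rfl
  w_eq v := by
    rw [hw v]
    congr 1
    refine congrFun (push_congr (fun _ => rfl) fun e h => ?_) v
    have heS : e ∈ S := by
      by_contra h'; exact h (indicator_of_notMem h' _)
    exact (ht e heS _ (G.tail_mem e)).symm

theorem Contr.ofIncl_onE {G T : WGraph} {S : Set G.E} (f : G.V → T.V)
    (hf : Function.Surjective f) (t : G.E → T.V) (ht : ∀ e ∈ S, ∀ x ∈ G.ends e, f x = t e)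
    (hj : ∀ x y, f x = f y → G.joined S x y) (i : T.E → G.E) (hi : Function.Injective i)
    (hr : ∀ e, e ∈ range i ↔ e ∉ S) (he : ∀ a, T.ends a = (G.ends (i a)).map f)
    (hw : ∀ v, (T.w v : ℤ) - 1 = push f (fun x => (G.w x : ℤ) - 1) v + push t (S.indicator 1) v)
    (e : {e // e ∉ S}) :
    i ((Contr.ofIncl f hf t ht hj i hi hr he hw).onE e) = e.1 := by
  obtain ⟨a, rfl⟩ := ((Equiv.ofInjective i hi).trans (Equiv.subtypeEquivRight hr)).surjective e
  simp only [ofIncl, Equiv.symm_apply_apply]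
  rfl

/-- A set of edges that is a union of classes of the relation. -/
def CGraph.Saturated (G : CGraph) (S : Set G.E) : Prop :=
  ∀ e e', G.rel e e' → e ∈ S → e' ∈ S

/-- A contraction is compatible with the relations on the edges. -/
def Contr.Compat {G T : CGraph} {S : Set G.E} (c : Contr G.toWGraph T.toWGraph S) : Prop :=
  ∀ e e', T.rel (c.onE e) (c.onE e') ↔ G.rel e.1 e'.1

/-- `T.Spec G` means that the constrained graph `T` is a specialisation of `G`: it arises by
contracting a set of edges that is a union of classes. -/
def CGraph.Spec (T G : CGraph) : Prop :=
  ∃ S, G.Saturated S ∧ ∃ c : Contr G.toWGraph T.toWGraph S, c.Compat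

theorem Contr.ofIncl_compat {G T : CGraph} {S : Set G.E} (f : G.V → T.V)
    (hf : Function.Surjective f) (t : G.E → T.V) (ht : ∀ e ∈ S, ∀ x ∈ G.ends e, f x = t e)
    (hj : ∀ x y, f x = f y → G.joined S x y) (i : T.E → G.E) (hi : Function.Injective i)
    (hr : ∀ e, e ∈ range i ↔ e ∉ S) (he : ∀ a, T.ends a = (G.ends (i a)).map f)
    (hw : ∀ v, (T.w v : ℤ) - 1 = push f (fun x => (G.w x : ℤ) - 1) v + push t (S.indicator 1) v)
    (hrel : ∀ a a', T.rel a a' ↔ G.rel (i a) (i a')) :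
    (Contr.ofIncl (G := G.toWGraph) (T := T.toWGraph) f hf t ht hj i hi hr he hw).Compat := by
  intro e e'
  rw [hrel]
  exact iff_of_eq (congrArg₂ _ (Contr.ofIncl_onE f hf t ht hj i hi hr he hw e)
    (Contr.ofIncl_onE f hf t ht hj i hi hr he hw e'))

theorem CGraph.Spec.trans {T U G : CGraph} (h : T.Spec U) (h' : U.Spec G) : T.Spec G := by
  obtain ⟨S, hS, c, hc⟩ := h
  obtain ⟨S', hS', c', hc'⟩ := h'
  refine ⟨c'.preE S, fun e e' hr he => ?_, c'.comp c rfl, fun e e' => ?_⟩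
  · intro h
    have h' : e ∉ S' := fun h1 => h (hS' e e' hr h1)
    exact hS _ _ ((hc' ⟨e, h'⟩ ⟨e', h⟩).2 hr) (he h')
  · exact (hc _ _).trans (hc' _ _)

theorem CGraph.Isom.spec {T G : CGraph} (h : T.Isom G) : G.Spec T := by
  obtain ⟨f, hf⟩ := h
  exact ⟨∅, fun _ _ _ h => h, Contr.ofIso f, fun e e' => (hf _ _).symm⟩

/-- Contraction of a set of edges, with the induced relation. -/
noncomputable def CGraph.contract (G : CGraph) (S : Set G.E) : CGraph :=
  { G.toWGraph.contract S with rel := G.rel.comap Subtype.val }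

theorem CGraph.contract_spec (G : CGraph) {S : Set G.E} (hS : G.Saturated S) :
    (G.contract S).Spec G :=
  ⟨S, hS, G.toWGraph.toContract S, fun _ _ => Iff.rfl⟩

/-- Two contractions of the same edges that are compatible with the relations are isomorphic. -/
theorem Contr.Compat.isom {G T U : CGraph} {S : Set G.E} {c : Contr G.toWGraph T.toWGraph S}
    (hc : c.Compat) {d : Contr G.toWGraph U.toWGraph S} (hd : d.Compat) : T.Isom U := by
  refine ⟨c.uniq d, fun e e' => ?_⟩
  obtain ⟨e, rfl⟩ := c.onE.surjective e
  obtain ⟨e', rfl⟩ := c.onE.surjective e'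
  rw [c.uniq_onE, c.uniq_onE, hc, hd]

theorem CGraph.Isom.symm {T G : CGraph} (h : T.Isom G) : G.Isom T := by
  obtain ⟨f, hf⟩ := h
  refine ⟨f.symm, fun e e' => ?_⟩
  rw [hf]
  simp [WIso.symm]

theorem CGraph.Isom.trans {T U G : CGraph} (h : T.Isom U) (h' : U.Isom G) : T.Isom G := by
  obtain ⟨f, hf⟩ := h
  obtain ⟨k, hk⟩ := h'
  exact ⟨f.trans k, fun e e' => (hf e e').trans (hk _ _)⟩

theorem CGraph.Isom.refl (G : CGraph) : G.Isom G := ⟨WIso.refl _, fun _ _ => Iff.rfl⟩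

theorem CGraph.Spec.exists_isom {T G : CGraph} (h : T.Spec G) :
    ∃ S, G.Saturated S ∧ T.Isom (G.contract S) := by
  obtain ⟨S, hS, c, hc⟩ := h
  exact ⟨S, hS, Contr.Compat.isom (U := G.contract S) hc (d := G.toWGraph.toContract S)
    fun _ _ => Iff.rfl⟩

/-! ### Resolution of trees with legs -/

namespace LegTree

variable (R : LegTree)

section split

variable (y : R.W) (H : Set ((R.E × Bool) ⊕ R.L))

open Classical in
/-- The new root of a half-edge or leg after those in `H` were moved to a new vertex. -/
noncomputable def splitAt (h : (R.E × Bool) ⊕ R.L) : Option R.W :=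
  if h ∈ H then none else some (Sum.elim R.root R.leg h)

/-- The roots of the half-edges after splitting a vertex; the new edge `none` joins the old vertex
`y` and the new vertex `none`. -/
noncomputable def splitRoot : Option R.E × Bool → Option R.W
  | (some e, b) => R.splitAt H (Sum.inl (e, b))
  | (none, false) => some y
  | (none, true) => none

variable {y H}

theorem splitAt_getD (hH : ∀ h ∈ H, Sum.elim R.root R.leg h = y) (h : (R.E × Bool) ⊕ R.L) :
    (R.splitAt H h).getD y = Sum.elim R.root R.leg h := by
  unfold splitAt
  split_ifs with hh
  · simp [hH h hh]
  · simp

/-- Splitting the vertex `y` of a tree into two vertices: the half-edges and legs in `H` are moved to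
a new vertex, which is joined to `y` by a new edge. -/
noncomputable def split (hH : ∀ h ∈ H, Sum.elim R.root R.leg h = y) : LegTree where
  W := Option R.W
  E := Option R.E
  L := R.L
  finW := inferInstance
  finE := inferInstance
  finL := inferInstance
  root := R.splitRoot y H
  leg := fun l => R.splitAt H (Sum.inr l)
  conn := by
    refine ⟨⟨none⟩, ?_⟩
    set K : WGraph := ⟨Option R.W, Option R.E, inferInstance, inferInstance,
      fun e => s(R.splitRoot y H (e, false), R.splitRoot y H (e, true)), fun _ => 0⟩
    have hn : K.joined univ (some y) none :=
      joined_of_ends (G := K) (e := (none : Option R.E)) (mem_univ _) rfl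
    have hat : ∀ h, K.joined univ (some (Sum.elim R.root R.leg h)) (R.splitAt H h) := by
      intro h
      unfold splitAt
      split_ifs with hh
      · rw [hH h hh]; exact hn
      · exact Setoid.refl' _ _
    have key : ∀ u v, K.joined univ (some u) (some v) := by
      intro u v
      refine joined_le (G := R.base) (S := univ) ((K.joined univ).comap some) (fun e _ u v he => ?_)
        (R.conn.2 u v)
      have h1 : K.joined univ (R.splitAt H (Sum.inl (e, false))) (R.splitAt H (Sum.inl (e, true))) :=
        joined_of_ends (G := K) (e := (some e : Option R.E)) (mem_univ _) rfl
      have h2 := Setoid.trans' _ (hat (Sum.inl (e, false)))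
        (Setoid.trans' _ h1 (Setoid.symm' _ (hat (Sum.inl (e, true)))))
      change K.joined univ (some u) (some v)
      rcases Sym2.eq_iff.1 he with ⟨h3, h4⟩ | ⟨h3, h4⟩
      · rw [← h3, ← h4]; exact h2
      · rw [← h3, ← h4]; exact Setoid.symm' _ h2
    rintro (_ | u) (_ | v)
    · exact Setoid.refl' _ _
    · exact Setoid.trans' _ (Setoid.symm' _ hn) (key _ _)
    · exact Setoid.trans' _ (key _ _) hn
    · exact key _ _
  card := by
    rw [Finite.card_option, Finite.card_option, R.card]

/-- Moving at least two of the half-edges and legs at `y` to a new vertex, and leaving at least two,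
keeps all valences at least three, as the new edge adds one on both sides. -/
theorem val_split (hH : ∀ h ∈ H, Sum.elim R.root R.leg h = y) (h3 : ∀ z, 3 ≤ R.val z)
    (hy : H.ncard + 2 ≤ R.val y) (h2 : 2 ≤ H.ncard) (z : (R.split hH).W) :
    3 ≤ (R.split hH).val z := by
  let i : (R.E × Bool) ⊕ R.L → (Option R.E × Bool) ⊕ R.L :=
    Sum.map (Prod.map some id) id
  have hi : Function.Injective i :=
    Sum.map_injective.2 ⟨(Option.some_injective _).prodMap Function.injective_id,
      Function.injective_id⟩
  have hat : ∀ h, Sum.elim (R.split hH).root (R.split hH).leg (i h) = R.splitAt H h := by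
    rintro (⟨e, b⟩ | l) <;> rfl
  have hin : ∀ h b, i h ≠ Sum.inl (none, b) := by
    rintro (⟨e, b⟩ | l) b' <;> simp [i]
  -- the half-edges of the old tree at the new vertex `z`, together with one half of the new edge
  have hopt : ∀ (z : Option R.W) (b : Bool) (P : (R.E × Bool) ⊕ R.L → Prop),
      R.splitRoot y H (none, b) = z → (∀ h, P h → R.splitAt H h = z) →
      Nat.card {h // P h} + 1 ≤ (R.split hH).val z := by
    intro z b P hb hP
    rw [← Finite.card_option]
    refine Nat.card_le_card_of_injective (fun o : Option {h // P h} =>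
      o.elim ⟨Sum.inl (none, b), hb⟩ fun h => ⟨i h.1, (hat _).trans (hP _ h.2)⟩) ?_
    rintro (_ | ⟨h, _⟩) (_ | ⟨h', _⟩) hh
    · rfl
    · exact absurd (congrArg Subtype.val hh).symm (hin _ _)
    · exact absurd (congrArg Subtype.val hh) (hin _ _)
    · exact congrArg some (Subtype.ext (hi (congrArg Subtype.val hh)))
  have hdif : ∀ h, h ∉ H → R.splitAt H h = some (Sum.elim R.root R.leg h) := fun h hh => by
    simp [splitAt, hh]
  rcases z with _ | z
  · have := hopt none true (· ∈ H) rfl fun h hh => by simp [splitAt, hh]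
    have h4 : Nat.card {h // h ∈ H} = H.ncard := Nat.card_coe_set_eq H
    omega
  · by_cases hz : z = y
    · subst hz
      have := hopt (some z) false (fun h => Sum.elim R.root R.leg h = z ∧ h ∉ H) rfl
        fun h hh => by rw [hdif h hh.2, hh.1]
      have h4 : Nat.card {h // Sum.elim R.root R.leg h = z ∧ h ∉ H} =
          ({h | Sum.elim R.root R.leg h = z} \ H).ncard := Nat.card_coe_set_eq _
      have h5 : R.val z = {h | Sum.elim R.root R.leg h = z}.ncard := Nat.card_coe_set_eq _
      have h6 := Set.ncard_sdiff_add_ncard_of_subset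
        (show H ⊆ {h | Sum.elim R.root R.leg h = z} from hH) (Set.toFinite _)
      omega
    · refine (h3 z).trans ?_
      refine Nat.card_le_card_of_injective (fun h : {h // Sum.elim R.root R.leg h = z} =>
        ⟨i h.1, ?_⟩) ?_
      · rw [hat, hdif, h.2]
        exact fun hh => hz (h.2.symm.trans (hH _ hh))
      · exact fun h h' hh => Subtype.ext (hi (congrArg Subtype.val hh))

/-- Contracting the two copies of the new edge undoes the splitting of a vertex. -/
theorem dbl_spec_split (hH : ∀ h ∈ H, Sum.elim R.root R.leg h = y) :
    R.dbl.Spec (R.split hH).dbl := by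
  classical
  let f : Option R.W × Bool → R.W × Bool := fun x => (x.1.getD y, x.2)
  let t : (Option R.E × Bool) ⊕ R.L → R.W × Bool := Sum.elim (fun e => (y, e.2)) fun l => (y, true)
  let S : Set ((Option R.E × Bool) ⊕ R.L) := range fun b => Sum.inl (none, b)
  let i : (R.E × Bool) ⊕ R.L → (Option R.E × Bool) ⊕ R.L := Sum.map (Prod.map some id) id
  have hi : Function.Injective i :=
    Sum.map_injective.2 ⟨(Option.some_injective _).prodMap Function.injective_id,
      Function.injective_id⟩
  have hS : ∀ b, Sum.inl (none, b) ∈ S := fun b => ⟨b, rfl⟩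
  refine ⟨S, ?_, Contr.ofIncl (G := (R.split hH).dbl.toWGraph) (T := R.dbl.toWGraph) f ?_ t ?_ ?_ i hi
    ?_ ?_ ?_, ?_⟩
  · rintro e e' hr ⟨b, rfl⟩
    have hr' : Sum.map Prod.fst id (Sum.inl (none, b)) = Sum.map Prod.fst id e' := hr
    rcases e' with ⟨o, b'⟩ | l
    · have h1 : none = o := Sum.inl.inj hr'
      subst h1
      exact hS b'
    · simp at hr'
  · rintro ⟨w, b⟩
    exact ⟨(some w, b), rfl⟩
  · rintro _ ⟨b, rfl⟩ x hx
    rcases Sym2.mem_iff.1 hx with rfl | rfl <;> rfl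
  · rintro ⟨u, b⟩ ⟨v, b'⟩ huv
    have h1 : u.getD y = v.getD y := (Prod.mk.inj huv).1
    obtain rfl : b = b' := (Prod.mk.inj huv).2
    have hn : (R.split hH).dbl.joined S (some y, b) (none, b) :=
      joined_of_ends (G := (R.split hH).dbl.toWGraph) (hS b) rfl
    rcases u with _ | u <;> rcases v with _ | v
    · exact Setoid.refl' _ _
    · obtain rfl : y = v := h1
      exact Setoid.symm' _ hn
    · obtain rfl : u = y := h1
      exact hn
    · obtain rfl : u = v := h1
      exact Setoid.refl' _ _
  · rintro (⟨_ | e, b⟩ | l)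
    · refine iff_of_false ?_ (not_not.2 (hS b))
      rintro ⟨⟨e, b'⟩ | l, h⟩
      · exact absurd (Prod.mk.inj (Sum.inl.inj h)).1 (Option.some_ne_none e)
      · exact absurd h Sum.inr_ne_inl
    · refine iff_of_true ⟨Sum.inl (e, b), rfl⟩ ?_
      rintro ⟨b', h⟩
      exact absurd (Prod.mk.inj (Sum.inl.inj h)).1 (Option.some_ne_none e).symm
    · refine iff_of_true ⟨Sum.inr l, rfl⟩ ?_
      rintro ⟨b', h⟩
      exact absurd h Sum.inl_ne_inr
  · have hg := R.splitAt_getD hH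
    rintro (⟨e, b⟩ | l)
    · change s(_, _) = s(f (R.splitAt H (Sum.inl (e, false)), b),
        f (R.splitAt H (Sum.inl (e, true)), b))
      simp only [f, hg]
      rfl
    · change s(_, _) = s(f (R.splitAt H (Sum.inr l), false), f (R.splitAt H (Sum.inr l), true))
      simp only [f, hg]
      rfl
  · rintro ⟨w, b⟩
    have h1 : push t (S.indicator 1) = push (fun b => (y, b)) 1 :=
      push_of_injective (fun b => Sum.inl (none, b)) (fun b b' h => by simpa using h)
        (fun x hx => by simpa [S] using hx) (fun b => by simp [S]) fun b _ => rfl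
    let _ := Fintype.ofFinite R.W
    have h2 : push f (fun _ => (-1 : ℤ)) (w, b) + push (fun b => (y, b)) 1 (w, b) = -1 := by
      simp only [push_eq_sum, Fintype.sum_prod_type, Fintype.sum_option, f]
      by_cases hw : y = w <;> cases b <;> simp [hw]
    have h3 : push f (fun x => (((R.split hH).dbl.w x : ℕ) : ℤ) - 1) (w, b) =
        push f (fun _ => (-1 : ℤ)) (w, b) := by
      congr 1
    exact h2.symm.trans (congrArg₂ (· + ·) h3.symm (congrFun h1 _).symm)
  · refine Contr.ofIncl_compat _ _ _ _ _ _ _ _ _ _ fun a a' => ?_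
    have h1 : ∀ a : (R.E × Bool) ⊕ R.L, Sum.map Prod.fst id (i a) =
        Sum.map some id (Sum.map Prod.fst id a) := by
      rintro (⟨a, b⟩ | l) <;> rfl
    have h2 : Function.Injective (Sum.map (some : R.E → _) (id : R.L → R.L)) :=
      Sum.map_injective.2 ⟨Option.some_injective _, Function.injective_id⟩
    exact h2.eq_iff.symm.trans (iff_of_eq (congrArg₂ Eq (h1 a).symm (h1 a').symm))

end split

/-- The number of vertices is bounded in terms of the number of legs if all valences are at least
three. -/
theorem card_add_two_le (h3 : ∀ y, 3 ≤ R.val y) : Nat.card R.W + 2 ≤ Nat.card R.L := by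
  let _ := Fintype.ofFinite R.W
  have h1 := R.total_val
  have h2 : 3 * (Nat.card R.W : ℤ) ≤ total fun y => (R.val y : ℤ) := by
    rw [total_eq_sum, Nat.card_eq_fintype_card, mul_comm, ← nsmul_eq_mul, ← Finset.card_univ]
    exact Finset.card_nsmul_le_sum _ _ _ fun y _ => by exact_mod_cast h3 y
  have := R.card
  omega

/-- A tree all of whose vertices have valence three, legs included, has two vertices less than it has
legs. -/
theorem card_add_two (h3 : ∀ y, R.val y = 3) : Nat.card R.W + 2 = Nat.card R.L := by
  let _ := Fintype.ofFinite R.W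
  have h1 := R.total_val
  have h2 : total (fun y => (R.val y : ℤ)) = 3 * (Nat.card R.W : ℤ) := by
    rw [total_eq_sum]
    simp [h3, mul_comm]
  have := R.card
  omega

/-- Every tree with legs and valences at least three is a specialisation of a trivalent one. -/
theorem exists_resolution (h3 : ∀ y, 3 ≤ R.val y) :
    ∃ R' : LegTree, (∀ y, R'.val y = 3) ∧ Nat.card R'.L = Nat.card R.L ∧ R.dbl.Spec R'.dbl := by
  induction hn : Nat.card R.L - Nat.card R.W using Nat.strong_induction_on generalizing R with
  | _ n ih =>
    by_cases hc : ∀ y, R.val y = 3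
    · exact ⟨R, hc, rfl, (CGraph.Isom.refl _).spec⟩
    · push Not at hc
      obtain ⟨y, hy⟩ := hc
      have hy' := h3 y
      have : Nontrivial {h : (R.E × Bool) ⊕ R.L // Sum.elim R.root R.leg h = y} := by
        rw [← Finite.one_lt_card_iff_nontrivial]
        change 1 < R.val y
        omega
      obtain ⟨h1, h2, hne⟩ := exists_pair_ne
        {h : (R.E × Bool) ⊕ R.L // Sum.elim R.root R.leg h = y}
      let H : Set ((R.E × Bool) ⊕ R.L) := {h1.1, h2.1}
      have hH : ∀ h ∈ H, Sum.elim R.root R.leg h = y := by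
        rintro h (rfl | rfl)
        exacts [h1.2, h2.2]
      have hcard : H.ncard = 2 := Set.ncard_pair fun h => hne (Subtype.ext h)
      have h3' := R.val_split hH h3 (by omega) (by omega)
      have hW : Nat.card (R.split hH).W = Nat.card R.W + 1 := Finite.card_option
      have hL : Nat.card (R.split hH).L = Nat.card R.L := rfl
      have h4 := R.card_add_two_le h3
      obtain ⟨R', hR, hRL, hs⟩ := ih _ (by omega) (R.split hH) h3' rfl
      exact ⟨R', hR, hRL.trans hL, (R.dbl_spec_split hH).trans hs⟩

end LegTree

/-! ### Specialisations of generalised ladders are hyperelliptic types -/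

namespace LegTree

variable {R : LegTree} {S : Set R.dbl.E}

/-- The edges of the tree whose copies lie in `S`. -/
def under (S : Set R.dbl.E) : Set R.E := {t | (Sum.inl (t, false) : (R.E × Bool) ⊕ R.L) ∈ S}

theorem mem_under_iff (hS : R.dbl.Saturated S) (t : R.E) (b : Bool) :
    (Sum.inl (t, b) : (R.E × Bool) ⊕ R.L) ∈ S ↔ t ∈ under S :=
  ⟨fun h => hS (Sum.inl (t, b)) (Sum.inl (t, false)) rfl h, fun h => hS (Sum.inl (t, false)) (Sum.inl (t, b)) rfl h⟩

/-- The vertices of the contracted tree. -/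
abbrev TreeV (S : Set R.dbl.E) : Type := Quotient (R.base.joined (under S))

/-- The two copies of a vertex of the contracted tree are identified by the contraction of `S`. -/
def Merged (S : Set R.dbl.E) (y : TreeV S) : Prop :=
  ∃ l, (Sum.inr l : (R.E × Bool) ⊕ R.L) ∈ S ∧ Quotient.mk _ (R.leg l) = y

/-- The components of the contracted edges of a generalised ladder: over each vertex of the contracted
tree there is one if an edge between the copies of a foot is contracted, and two otherwise. -/
theorem dbl_joined_iff (hS : R.dbl.Saturated S) (x x' : R.W × Bool) :
    R.dbl.joined S x x' ↔ R.base.joined (under S) x.1 x'.1 ∧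
      (x.2 = x'.2 ∨ Merged S (Quotient.mk _ x.1)) := by
  constructor
  · let r : Setoid (R.W × Bool) :=
      { r := fun x x' => R.base.joined (under S) x.1 x'.1 ∧
          (x.2 = x'.2 ∨ Merged S (Quotient.mk _ x.1))
        iseqv :=
          { refl := fun x => ⟨Setoid.refl' _ _, Or.inl rfl⟩
            symm := fun {x y} h => ⟨Setoid.symm' _ h.1, by
              have : Quotient.mk (R.base.joined (under S)) x.1 = Quotient.mk _ y.1 :=
                Quotient.sound h.1
              rw [← this]
              exact h.2.imp_left Eq.symm⟩
            trans := fun {x y z} h h' => ⟨Setoid.trans' _ h.1 h'.1, by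
              have : Quotient.mk (R.base.joined (under S)) x.1 = Quotient.mk _ y.1 :=
                Quotient.sound h.1
              have h2 := h'.2
              rw [← this] at h2
              rcases h.2 with h3 | h3
              · rcases h2 with h2 | h2
                · exact Or.inl (h3.trans h2)
                · exact Or.inr h2
              · exact Or.inr h3⟩ } }
    refine fun h => joined_le (G := R.dbl.toWGraph) r ?_ h
    rintro (⟨t, b⟩ | l) he u v huv
    · have h1 : R.base.joined (under S) (R.root (t, false)) (R.root (t, true)) :=
        joined_of_ends (G := R.base) ((mem_under_iff hS t b).1 he) rfl
      have h2 : r (R.root (t, false), b) (R.root (t, true), b) := ⟨h1, Or.inl rfl⟩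
      rcases Sym2.eq_iff.1 huv with ⟨h3, h4⟩ | ⟨h3, h4⟩
      · rw [← h3, ← h4]; exact h2
      · rw [← h3, ← h4]; exact Setoid.symm' _ h2
    · have h2 : r (R.leg l, false) (R.leg l, true) := ⟨Setoid.refl' _ _, Or.inr ⟨l, he, rfl⟩⟩
      rcases Sym2.eq_iff.1 huv with ⟨h3, h4⟩ | ⟨h3, h4⟩
      · rw [← h3, ← h4]; exact h2
      · rw [← h3, ← h4]; exact Setoid.symm' _ h2
  · have h1 : ∀ w w' b, R.base.joined (under S) w w' → R.dbl.joined S (w, b) (w', b) := by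
      intro w w' b h
      refine joined_le (G := R.base) ((R.dbl.joined S).comap fun w => (w, b)) (fun t ht u v huv => ?_) h
      exact joined_of_ends (G := R.dbl.toWGraph) ((mem_under_iff hS t b).2 ht)
        (congrArg (Sym2.map fun w => (w, b)) huv)
    rintro ⟨h, hb⟩
    obtain ⟨w, b⟩ := x
    obtain ⟨w', b'⟩ := x'
    refine Setoid.trans' _ ?_ (h1 w w' b' h)
    rcases hb with hb | ⟨l, hl, hw⟩
    · obtain rfl : b = b' := hb
      exact Setoid.refl' _ _
    · have h2 : R.base.joined (under S) (R.leg l) w := Quotient.exact hw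
      have h3 : R.dbl.joined S (R.leg l, false) (R.leg l, true) :=
        joined_of_ends (G := R.dbl.toWGraph) hl rfl
      have h4 : ∀ b b', R.dbl.joined S (R.leg l, b) (R.leg l, b') := by
        intro b b'
        cases b <;> cases b'
        exacts [Setoid.refl' _ _, h3, Setoid.symm' _ h3, Setoid.refl' _ _]
      exact Setoid.trans' _ (Setoid.symm' _ (h1 _ _ b h2)) (Setoid.trans' _ (h4 b b') (h1 _ _ b' h2))

/-- The contracted tree is a tree of weight zero. -/
theorem base_contract (Q : Set R.E) : (R.base.contract Q).Connected ∧
    Nat.card {t // t ∉ Q} + 1 = Nat.card (R.base.contract Q).V ∧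
    ∀ y, (R.base.contract Q).w y = 0 := by
  have hc := (R.base.toContract Q).connected R.conn
  have hg := (R.base.toContract Q).genus_eq
  have h0 : R.base.genus = 0 := by
    have h : R.base.genus = (Nat.card R.E : ℤ) - Nat.card R.W + 1 +
      ∑ᶠ v : R.W, ((0 : ℕ) : ℤ) := rfl
    rw [h, ← R.card]
    simp
  rw [h0] at hg
  have h1 := hc.card_le
  have h2 : (R.base.contract Q).genus = (Nat.card {t // t ∉ Q} : ℤ) -
    Nat.card (R.base.contract Q).V + 1 + ∑ᶠ y, ((R.base.contract Q).w y : ℤ) := rfl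
  have h3 : Nat.card (R.base.contract Q).E = Nat.card {t // t ∉ Q} := rfl
  let _ := Fintype.ofFinite (R.base.contract Q).V
  rw [finsum_eq_sum_of_fintype] at h2
  have h4 : ∀ y ∈ Finset.univ, 0 ≤ ((R.base.contract Q).w y : ℤ) := fun y _ => by positivity
  have h5 := Finset.sum_nonneg h4
  refine ⟨hc, by omega, fun y => ?_⟩
  have h6 : ∑ y, ((R.base.contract Q).w y : ℤ) = 0 := by omega
  exact_mod_cast (Finset.sum_eq_zero_iff_of_nonneg h4).1 h6 y (Finset.mem_univ _)

theorem root_ne {Q : Set R.E} {t : R.E} (ht : t ∉ Q) :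
    Quotient.mk (R.base.joined Q) (R.root (t, false)) ≠ Quotient.mk _ (R.root (t, true)) := by
  intro h
  obtain ⟨hc, hcard, _⟩ := R.base_contract Q
  exact (hc.isTree hcard).2.2 ⟨t, ht⟩ (show (s(_, _) : Sym2 _).IsDiag from h)

section

variable (S)

/-- The vertices of the contraction of the generalised ladder that lie over a vertex of the contracted
tree. -/
def vtx (hS : R.dbl.Saturated S) (y : TreeV S) (b : Bool) : Quotient (R.dbl.joined S) :=
  Quotient.map' (s₁ := R.base.joined (under S)) (s₂ := R.dbl.joined S) (fun w => (w, b))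
    (fun w w' h => (dbl_joined_iff hS (w, b) (w', b)).2 ⟨h, Or.inl rfl⟩) y

/-- The projection to the contracted tree. -/
def proj (hS : R.dbl.Saturated S) : Quotient (R.dbl.joined S) → TreeV S :=
  Quotient.map' (s₁ := R.dbl.joined S) (s₂ := R.base.joined (under S)) Prod.fst
    fun x x' h => ((dbl_joined_iff hS x x').1 h).1

end

variable (hS : R.dbl.Saturated S)

theorem vtx_eq_iff (y : TreeV S) (b b' : Bool) :
    vtx S hS y b = vtx S hS y b' ↔ b = b' ∨ Merged S y := by
  induction y using Quotient.inductionOn with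
  | h w =>
    refine (Quotient.eq (r := R.dbl.joined S)).trans ((dbl_joined_iff hS (w, b) (w, b')).trans ?_)
    exact and_iff_right (Setoid.refl' _ _)

theorem exists_vtx (v : Quotient (R.dbl.joined S)) : ∃ b, vtx S hS (proj S hS v) b = v := by
  induction v using Quotient.inductionOn with
  | h x => exact ⟨x.2, rfl⟩

/-- A vertex of the contraction whose two copies are not identified has weight zero. -/
theorem contract_w_eq_zero (v : Quotient (R.dbl.joined S)) (hv : ¬ Merged S (proj S hS v)) :
    (R.dbl.toWGraph.contract S).w v = 0 := by
  obtain ⟨b, hb⟩ := exists_vtx hS v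
  set y := proj S hS v with hy
  have h1 := R.dbl.toWGraph.contract_w S v
  have h2 := R.base.contract_w (under S) y
  have h3 : (R.base.contract (under S)).w y = 0 := (R.base_contract (under S)).2.2 y
  have hx : ∀ w b', Quotient.mk (R.dbl.joined S) (w, b') = v ↔
      Quotient.mk (R.base.joined (under S)) w = y ∧ b' = b := by
    intro w b'
    constructor
    · intro h
      have h4 : Quotient.mk (R.base.joined (under S)) w = y := by rw [hy, ← h]; rfl
      refine ⟨h4, ?_⟩
      rw [← hb, ← h4] at h
      have h5 := ((vtx_eq_iff hS (Quotient.mk _ w) b' b).1 h)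
      rw [h4] at h5
      exact h5.resolve_right hv
    · rintro ⟨h, rfl⟩
      rw [← hb, ← h]
      rfl
  have hneg : ∀ (V U : Type) [Finite V] (f : V → U) (u : U),
      push f (fun _ => ((0 : ℕ) : ℤ) - 1) u = - Nat.card {x // f x = u} := by
    intro V U _ f u
    rw [← push_one, eq_neg_iff_add_eq_zero, ← Pi.add_apply, ← push_add]
    classical
    let _ := Fintype.ofFinite V
    rw [push_eq_sum]
    simp
  have h4 : ((R.dbl.toWGraph.contract S).w v : ℤ) - 1 =
      - Nat.card {x // Quotient.mk (R.dbl.joined S) x = v} +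
      Nat.card {e // e ∈ S ∧ Quotient.mk (R.dbl.joined S) (R.dbl.tail e) = v} := by
    rw [h1, push_indicator]
    congr 1
    exact hneg (R.W × Bool) _ _ v
  have h5 : ((R.base.contract (under S)).w y : ℤ) - 1 =
      - Nat.card {x // Quotient.mk (R.base.joined (under S)) x = y} +
      Nat.card {t // t ∈ under S ∧ Quotient.mk (R.base.joined (under S)) (R.base.tail t) = y} := by
    rw [h2, push_indicator]
    congr 1
    exact hneg R.W _ _ y
  have h6 : Nat.card {x // Quotient.mk (R.base.joined (under S)) x = y} ≤
      Nat.card {x // Quotient.mk (R.dbl.joined S) x = v} := by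
    refine Nat.card_le_card_of_injective (fun w => ⟨(w.1, b), (hx _ _).2 ⟨w.2, rfl⟩⟩) ?_
    intro w w' h
    exact Subtype.ext (Prod.mk.inj (congrArg Subtype.val h)).1
  have htail : ∀ t b', t ∈ under S → Quotient.mk (R.dbl.joined S) (R.dbl.tail (Sum.inl (t, b'))) =
      Quotient.mk _ (R.root (t, false), b') := by
    intro t b' ht
    refine Quotient.sound (joined_of_mem (G := R.dbl.toWGraph) ((mem_under_iff hS t b').2 ht)
      (R.dbl.toWGraph.tail_mem _) ?_)
    exact Sym2.mem_mk_left _ _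
  have htail' : ∀ t, t ∈ under S → Quotient.mk (R.base.joined (under S)) (R.base.tail t) =
      Quotient.mk _ (R.root (t, false)) := by
    intro t ht
    refine Quotient.sound (joined_of_mem (G := R.base) ht (R.base.tail_mem _) ?_)
    exact Sym2.mem_mk_left _ _
  have h7 : Nat.card {e // e ∈ S ∧ Quotient.mk (R.dbl.joined S) (R.dbl.tail e) = v} ≤
      Nat.card {t // t ∈ under S ∧ Quotient.mk (R.base.joined (under S)) (R.base.tail t) = y} := by
    refine Nat.card_le_card_of_surjective (fun t => ⟨Sum.inl (t.1, b),
      (mem_under_iff hS t.1 b).2 t.2.1, ?_⟩) ?_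
    · rw [htail _ _ t.2.1, hx, ← htail' _ t.2.1]
      exact ⟨t.2.2, rfl⟩
    · rintro ⟨⟨t, b'⟩ | l, he, hev⟩
      · have ht := (mem_under_iff hS t b').1 he
        rw [htail _ _ ht, hx, ← htail' _ ht] at hev
        obtain ⟨h8, rfl⟩ := hev
        exact ⟨⟨t, ht, h8⟩, rfl⟩
      · refine absurd ⟨l, he, ?_⟩ hv
        rw [hy, ← hev]
        have h9 : R.dbl.tail (Sum.inr l) = (R.leg l, false) ∨ R.dbl.tail (Sum.inr l) = (R.leg l, true) :=
          Sym2.mem_iff.1 (R.dbl.toWGraph.tail_mem (Sum.inr l))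
        rcases h9 with h9 | h9 <;> rw [h9] <;> rfl
  omega

/-- The fibres over the base points of loops and over vertices of positive weight are single
points. -/
theorem merged_of_loop (l : (R.dbl.toWGraph.contract S).AllLoops) :
    Merged S (proj S hS ((R.dbl.toWGraph.contract S).base l)) := by
  rcases l with ⟨⟨v, ⟨⟨t, b⟩ | l, he⟩⟩, hl⟩ | ⟨v, i⟩
  · exfalso
    have ht : t ∉ under S := fun h => he ((mem_under_iff hS t b).2 h)
    have h1 : s(Quotient.mk (R.dbl.joined S) (R.root (t, false), b),
      Quotient.mk (R.dbl.joined S) (R.root (t, true), b)) = s(v, v) := hl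
    have h2 : Quotient.mk (R.dbl.joined S) (R.root (t, false), b) =
        Quotient.mk (R.dbl.joined S) (R.root (t, true), b) := by
      rcases Sym2.eq_iff.1 h1 with ⟨h3, h4⟩ | ⟨h3, h4⟩ <;> rw [h3, h4]
    exact root_ne ht (congrArg (proj S hS) h2)
  · have h1 : s(Quotient.mk (R.dbl.joined S) (R.leg l, false),
      Quotient.mk (R.dbl.joined S) (R.leg l, true)) = s(v, v) := hl
    have h2 : Quotient.mk (R.dbl.joined S) (R.leg l, false) = v := by
      rcases Sym2.eq_iff.1 h1 with ⟨h3, h4⟩ | ⟨h3, h4⟩ <;> rw [h3]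
    have h3 : Quotient.mk (R.dbl.joined S) (R.leg l, true) = v := by
      rcases Sym2.eq_iff.1 h1 with ⟨h3, h4⟩ | ⟨h3, h4⟩ <;> rw [h4]
    have h4 : vtx S hS (Quotient.mk _ (R.leg l)) false = vtx S hS (Quotient.mk _ (R.leg l)) true :=
      h2.trans h3.symm
    have h5 := ((vtx_eq_iff hS _ _ _).1 h4).resolve_left (by simp)
    change Merged S (proj S hS v)
    rw [← h2]
    exact h5
  · by_contra h
    have := contract_w_eq_zero hS v h
    have h1 := i.2
    have h2 : (R.dbl.toWGraph.contract S).w v = 0 := this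
    omega

end LegTree

namespace LegTree

variable {R : LegTree} {S : Set R.dbl.E} (hS : R.dbl.Saturated S)

/-- The target of the hyperelliptic morphism: the contracted tree, with a new leaf for every loop of
the contracted generalised ladder. -/
noncomputable abbrev target : WGraph where
  V := TreeV S ⊕ (R.dbl.toWGraph.contract S).AllLoops
  E := {t : R.E // t ∉ under S} ⊕ (R.dbl.toWGraph.contract S).AllLoops
  finV := inferInstance
  finE := inferInstance
  ends := Sum.elim (fun t => s(Sum.inl (Quotient.mk _ (R.root (t.1, false))),
      Sum.inl (Quotient.mk _ (R.root (t.1, true)))))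
    fun l => s(Sum.inl (proj S hS ((R.dbl.toWGraph.contract S).base l)), Sum.inr l)
  w := fun _ => 0

theorem target_connected : (target hS).Connected := by
  obtain ⟨hc, -, -⟩ := R.base_contract (under S)
  obtain ⟨⟨y⟩, hc⟩ := hc
  refine ⟨⟨Sum.inl y⟩, ?_⟩
  have h1 : ∀ y y', (target hS).joined univ (Sum.inl y) (Sum.inl y') := by
    intro y y'
    refine joined_le (G := R.base.contract (under S)) (S := univ)
      (((target hS).joined univ).comap Sum.inl) (fun t _ u v huv => ?_) (hc y y')
    exact joined_of_ends (G := target hS) (e := Sum.inl t) (mem_univ _)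
      (congrArg (Sym2.map Sum.inl) huv)
  have h2 : ∀ l, (target hS).joined univ
      (Sum.inl (proj S hS ((R.dbl.toWGraph.contract S).base l))) (Sum.inr l) := fun l =>
    joined_of_ends (G := target hS) (e := Sum.inr l) (mem_univ _) rfl
  rintro (y | l) (y' | l')
  · exact h1 _ _
  · exact Setoid.trans' _ (h1 _ _) (h2 l')
  · exact Setoid.trans' _ (Setoid.symm' _ (h2 l)) (h1 _ _)
  · exact Setoid.trans' _ (Setoid.symm' _ (h2 l)) (Setoid.trans' _ (h1 _ _) (h2 l'))

theorem target_card : Nat.card (target hS).E + 1 = Nat.card (target hS).V := by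
  obtain ⟨-, hc, -⟩ := R.base_contract (under S)
  have h1 : Nat.card (target hS).V = Nat.card (TreeV S) +
    Nat.card (R.dbl.toWGraph.contract S).AllLoops := Nat.card_sum
  have h2 : Nat.card (target hS).E = Nat.card {t // t ∉ under S} +
    Nat.card (R.dbl.toWGraph.contract S).AllLoops := Nat.card_sum
  have : Nat.card (R.base.contract (under S)).V = Nat.card (TreeV S) := rfl
  omega

/-- The target as a simple graph. -/
noncomputable abbrev targetGraph : SimpleGraph (target hS).V := SimpleGraph.fromEdgeSet (range (target hS).ends)

theorem targetGraph_isTree : (targetGraph hS).IsTree :=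
  ((target_connected hS).isTree (target_card hS)).1

/-- The edges of the target, as edges of a simple graph. -/
noncomputable def targetEdge (k : (target hS).E) : (WGraph.ofSimple (targetGraph hS)).E :=
  ⟨(target hS).ends k, by
    rw [SimpleGraph.edgeSet_fromEdgeSet]
    exact ⟨mem_range_self k, ((target_connected hS).isTree (target_card hS)).2.2 k⟩⟩

theorem targetEdge_injective : Function.Injective (targetEdge hS) := fun _ _ h =>
  ((target_connected hS).isTree (target_card hS)).2.1 (congrArg Subtype.val h)

theorem targetEdge_surjective : Function.Surjective (targetEdge hS) := by
  rintro ⟨e, he⟩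
  rw [SimpleGraph.edgeSet_fromEdgeSet] at he
  obtain ⟨⟨k, rfl⟩, -⟩ := he
  exact ⟨k, rfl⟩

/-- The contracted generalised ladder. -/
noncomputable abbrev quot (S : Set R.dbl.E) : WGraph := R.dbl.toWGraph.contract S

theorem not_isDiag (hS : R.dbl.Saturated S) {t : R.E} (ht : t ∉ under S) {b : Bool}
    (h : (Sum.inl (t, b) : (R.E × Bool) ⊕ R.L) ∉ S) :
    ¬ ((quot S).ends (⟨Sum.inl (t, b), h⟩ : {e // e ∉ S})).IsDiag := by
  intro hd
  have h1 : Quotient.mk (R.dbl.joined S) (R.root (t, false), b) =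
    Quotient.mk (R.dbl.joined S) (R.root (t, true), b) := hd
  exact root_ne ht (congrArg (proj S hS) h1)

/-- The images of the edges of the contracted generalised ladder: a copy of an edge of the tree lies
over this edge, and the other edges are vertical. -/
def edgeImage (hS : R.dbl.Saturated S) : {e : R.dbl.E // e ∉ S} → TreeV S ⊕ {t : R.E // t ∉ under S}
  | ⟨Sum.inl (t, b), h⟩ => Sum.inr ⟨t, fun ht => h ((mem_under_iff hS t b).2 ht)⟩
  | ⟨Sum.inr l, _⟩ => Sum.inl (Quotient.mk _ (R.leg l))

/-- The hyperelliptic morphism. -/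
noncomputable def hypMor : Mor (quot S).loopless (WGraph.ofSimple (targetGraph hS)) where
  onV := Sum.map (proj S hS) id
  onE := Sum.elim (fun e => Sum.map Sum.inl (fun t => targetEdge hS (Sum.inl t)) (edgeImage hS e.1))
    fun p => Sum.inr (targetEdge hS (Sum.inr p.1))
  vertical := by
    rintro (⟨⟨⟨t, b⟩ | l, he⟩, hd⟩ | p) y h x hx
    · cases h
    · have hy : Sum.inl (Quotient.mk _ (R.leg l)) = y := Sum.inl.inj h
      have hx' : x ∈ s((Sum.inl (Quotient.mk (R.dbl.joined S) (R.leg l, false)) :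
        (quot S).V ⊕ (quot S).AllLoops), Sum.inl (Quotient.mk (R.dbl.joined S) (R.leg l, true))) := hx
      rw [← hy]
      rcases Sym2.mem_iff.1 hx' with rfl | rfl <;> rfl
    · cases h
  horizontal := by
    rintro (⟨⟨⟨t, b⟩ | l, he⟩, hd⟩ | p) e' h
    · obtain rfl := Sum.inr.inj h
      rfl
    · cases h
    · obtain rfl := Sum.inr.inj h
      rfl

/-- The two edges over an edge of the target. -/
noncomputable def copies : (target hS).E → Bool → (quot S).loopless.E
  | Sum.inl t, b => Sum.inl ⟨⟨Sum.inl (t.1, b), fun h => t.2 ((mem_under_iff hS t.1 b).1 h)⟩,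
      not_isDiag hS t.2 _⟩
  | Sum.inr l, b => Sum.inr (l, b)

theorem hypMor_onE_iff (e : (quot S).loopless.E) (k : (target hS).E) :
    (hypMor hS).onE e = Sum.inr (targetEdge hS k) ↔ ∃ b, copies hS k b = e := by
  constructor
  · intro h
    rcases e with ⟨⟨⟨t, b⟩ | l, he⟩, hd⟩ | p
    · obtain rfl := targetEdge_injective hS (Sum.inr.inj h)
      exact ⟨b, rfl⟩
    · cases h
    · obtain rfl := targetEdge_injective hS (Sum.inr.inj h)
      exact ⟨p.2, rfl⟩
  · rintro ⟨b, rfl⟩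
    rcases k with t | l <;> rfl

theorem copies_injective (k : (target hS).E) : Function.Injective (copies hS k) := by
  intro b b' h
  rcases k with t | l
  · have h1 := congrArg (fun e => e.1.1) (Sum.inl.inj h)
    exact (Prod.mk.inj (Sum.inl.inj h1)).2
  · exact (Prod.mk.inj (Sum.inr.inj h)).2

theorem card_copies (k : (target hS).E) (P : (quot S).loopless.E → Prop) :
    Nat.card {e // P e ∧ (hypMor hS).onE e = Sum.inr (targetEdge hS k)} =
      Nat.card {b // P (copies hS k b)} := by
  symm
  refine Nat.card_congr (Equiv.ofBijective
    (fun b => ⟨copies hS k b.1, b.2, (hypMor_onE_iff hS _ _).2 ⟨_, rfl⟩⟩) ⟨?_, ?_⟩)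
  · intro b b' h
    exact Subtype.ext (copies_injective hS k (congrArg Subtype.val h))
  · rintro ⟨e, hP, he⟩
    obtain ⟨b, rfl⟩ := (hypMor_onE_iff hS _ _).1 he
    exact ⟨⟨b, hP⟩, rfl⟩

/-- The horizontal multiplicities. -/
noncomputable def mul : (quot S).loopless.V → ℕ
  | Sum.inl v => Nat.card {b // vtx S hS (proj S hS v) b = v}
  | Sum.inr _ => 2

theorem mul_pos (x : (quot S).loopless.V) : 0 < mul hS x := by
  rcases x with v | l
  · obtain ⟨b, hb⟩ := exists_vtx hS v
    have : Nonempty {b // vtx S hS (proj S hS v) b = v} := ⟨⟨b, hb⟩⟩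
    exact Finite.card_pos
  · exact two_pos

/-- The number of edges over an edge of the target does not depend on that edge: it is `2` at vertices
that are alone in their fibre and `1` at the others. -/
theorem hypMor_mult (x : (quot S).loopless.V) (e' : (targetGraph hS).edgeSet)
    (h : (hypMor hS).onV x ∈ e'.1) : (hypMor hS).mult x e' = mul hS x := by
  obtain ⟨k, rfl⟩ := targetEdge_surjective hS e'
  unfold Mor.mult
  refine (card_copies hS k (fun e => x ∈ (quot S).loopless.ends e)).trans ?_
  have hbool : ∀ P : Bool → Prop, (∀ b, P b) → Nat.card {b // P b} = 2 := fun P hP => by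
    rw [Nat.card_congr (Equiv.subtypeUnivEquiv hP)]; simp
  rcases x with v | l
  · rcases k with t | l
    · -- an edge of the tree
      have h1 : Sum.inl (proj S hS v) ∈
        s((Sum.inl (Quotient.mk _ (R.root (t.1, false))) : (target hS).V),
          Sum.inl (Quotient.mk _ (R.root (t.1, true)))) := h
      refine Nat.card_congr (Equiv.subtypeEquivRight fun b => ?_)
      have h2 : Sum.inl v ∈ (quot S).loopless.ends (copies hS (Sum.inl t) b) ↔
          v = Quotient.mk (R.dbl.joined S) (R.root (t.1, false), b) ∨
          v = Quotient.mk (R.dbl.joined S) (R.root (t.1, true), b) := by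
        refine Sym2.mem_iff.trans ?_
        exact or_congr Sum.inl_injective.eq_iff Sum.inl_injective.eq_iff
      refine h2.trans ?_
      constructor
      · rintro (h3 | h3) <;> rw [h3] <;> rfl
      · intro h3
        rcases Sym2.mem_iff.1 h1 with h4 | h4
        · rw [Sum.inl.inj h4] at h3; exact Or.inl h3.symm
        · rw [Sum.inl.inj h4] at h3; exact Or.inr h3.symm
    · -- an edge to a leaf that comes from a loop
      have h1 : Sum.inl (proj S hS v) ∈
        s((Sum.inl (proj S hS ((quot S).base l)) : (target hS).V), Sum.inr l) := h
      have h2 : proj S hS v = proj S hS ((quot S).base l) := by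
        rcases Sym2.mem_iff.1 h1 with h4 | h4
        · exact Sum.inl.inj h4
        · cases h4
      have h3 := merged_of_loop hS l
      have h4 : ∀ u, proj S hS u = proj S hS v → ∀ b, vtx S hS (proj S hS v) b = u := by
        intro u hu b
        obtain ⟨b', hb'⟩ := exists_vtx hS u
        rw [hu] at hb'
        rw [← hb', vtx_eq_iff, h2]
        exact Or.inr h3
      have h5 : v = (quot S).base l := (h4 v rfl false).symm.trans (h4 _ h2.symm false)
      refine (hbool _ fun b => ?_).trans (hbool _ fun b => h4 v rfl b).symm
      exact Sym2.mem_iff.2 (Or.inl (congrArg Sum.inl h5))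
  · rcases k with t | l'
    · exfalso
      have h1 : Sum.inr l ∈ s((Sum.inl (Quotient.mk _ (R.root (t.1, false))) : (target hS).V),
          Sum.inl (Quotient.mk _ (R.root (t.1, true)))) := h
      rcases Sym2.mem_iff.1 h1 with h4 | h4 <;> cases h4
    · have h1 : Sum.inr l ∈
        s((Sum.inl (proj S hS ((quot S).base l')) : (target hS).V), Sum.inr l') := h
      obtain rfl : l = l' := by
        rcases Sym2.mem_iff.1 h1 with h4 | h4
        · cases h4
        · exact Sum.inr.inj h4
      exact hbool _ fun b => Sym2.mem_mk_right _ _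

theorem hypMor_harmonic : (hypMor hS).Harmonic := fun x e' e'' h h' => by
  rw [hypMor_mult hS x e' h, hypMor_mult hS x e'' h']

theorem hypMor_degree [Nonempty (target hS).E] :
    (hypMor hS).Nondegenerate ∧ (hypMor hS).HasDegree 2 := by
  obtain ⟨k⟩ := ‹Nonempty (target hS).E›
  constructor
  · intro x
    have : Nontrivial (target hS).V := by
      obtain ⟨⟨e, he⟩, hk⟩ : ∃ e, e = targetEdge hS k := ⟨_, rfl⟩
      induction e using Sym2.ind with
      | _ a b => exact ⟨a, b, ((targetGraph hS).mem_edgeSet.1 he).ne⟩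
    obtain ⟨z, hz⟩ := (targetGraph_isTree hS).1.preconnected.exists_adj_of_nontrivial
      ((hypMor hS).onV x)
    let e' : (targetGraph hS).edgeSet := ⟨s(_, z), (targetGraph hS).mem_edgeSet.2 hz⟩
    have h1 : (hypMor hS).onV x ∈ e'.1 := Sym2.mem_mk_left _ _
    exact ⟨e', h1, by rw [hypMor_mult hS x e' h1]; exact mul_pos hS x⟩
  · refine ⟨⟨targetEdge hS k⟩, fun e' => ?_⟩
    obtain ⟨k, rfl⟩ := targetEdge_surjective hS e'
    have h1 := card_copies hS k fun _ => True
    simp only [true_and] at h1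
    rw [h1]
    simp

/-- If the target is a point, then the contracted generalised ladder consists of two vertices and the
edges between them. -/
theorem card_of_isEmpty [IsEmpty (target hS).E] (hL : 2 ≤ Nat.card R.L) :
    Nat.card (quot S).loopless.V = 2 ∧ Nat.card (target hS).V = 1 := by
  have h1 := target_card hS
  rw [Nat.card_of_isEmpty] at h1
  have hl : IsEmpty (quot S).AllLoops := ⟨fun l => isEmptyElim (Sum.inr l : (target hS).E)⟩
  have ht : ∀ t, t ∈ under S := fun t => by
    by_contra h; exact isEmptyElim (Sum.inl ⟨t, h⟩ : (target hS).E)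
  have h2 : Nat.card (TreeV S) = 1 := by
    rw [Nat.card_sum, Nat.card_of_isEmpty (α := (R.dbl.toWGraph.contract S).AllLoops)] at h1
    omega
  obtain ⟨hsub, ⟨y⟩⟩ := Nat.card_eq_one_iff_unique.1 h2
  have hV : ∀ v, ∃ b, vtx S hS y b = v := fun v => by
    obtain ⟨b, hb⟩ := exists_vtx hS v
    exact ⟨b, by rw [← hb]; congr 1; exact Subsingleton.elim _ _⟩
  refine ⟨?_, h1.symm⟩
  have hVV : Nat.card (quot S).loopless.V = Nat.card (quot S).V + Nat.card (quot S).AllLoops :=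
    Nat.card_sum
  rw [hVV, Nat.card_of_isEmpty (α := (quot S).AllLoops), add_zero]
  have hm : ¬ Merged S y := by
    intro hm
    have hone : Nat.card (quot S).V = 1 := by
      refine Nat.card_eq_one_iff_unique.2 ⟨⟨fun a b => ?_⟩, ⟨vtx S hS y false⟩⟩
      obtain ⟨c, rfl⟩ := hV a
      obtain ⟨d, rfl⟩ := hV b
      exact (vtx_eq_iff hS y c d).2 (Or.inr hm)
    have hss : Subsingleton (quot S).V := (Nat.card_eq_one_iff_unique.1 hone).1
    have hE : IsEmpty (quot S).E := by
      refine ⟨?_⟩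
      intro e
      refine hl.elim (Sum.inl ⟨((quot S).tail e, e), ?_⟩)
      rw [(quot S).ends_eq_mk e]
      exact congrArg (fun z => s((quot S).tail e, z)) (hss.elim _ _)
    have hw : ∀ v, (quot S).w v = 0 := by
      intro v
      by_contra hv
      exact hl.elim (Sum.inr ⟨v, ⟨0, Nat.pos_of_ne_zero hv⟩⟩)
    have hg := (R.dbl.toWGraph.toContract S).genus_eq
    rw [R.genus_dbl] at hg
    have hg' : (quot S).genus = 0 := by
      unfold genus
      rw [Nat.card_of_isEmpty, hone]
      simp [hw]
    have : (quot S).genus = (R.dbl.toWGraph.contract S).genus := rfl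
    omega
  have hb : Function.Bijective (vtx S hS y) := by
    refine ⟨fun b b' h => ?_, hV⟩
    exact ((vtx_eq_iff hS y b b').1 h).resolve_right hm
  exact (Nat.card_congr (Equiv.ofBijective _ hb)).symm.trans (by simp)

/-- A specialisation of a generalised ladder is a 2-edge-connected hyperelliptic type. -/
theorem contract_isHyp (hS : R.dbl.Saturated S) (h3 : ∀ y, 3 ≤ R.val y) (hL : 2 ≤ Nat.card R.L) :
    (R.dbl.contract S).IsType ∧ (R.dbl.contract S).IsHyp ∧
      (R.dbl.contract S).genus = (Nat.card R.L : ℤ) - 1 := by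
  have hc := R.dbl_twoEdgeConnected h3
  have c := R.dbl.toWGraph.toContract S
  refine ⟨⟨c.connected hc.1, c.stable fun x => ?_⟩, ⟨c.twoEdgeConnected hc, (target hS).V,
    inferInstance, targetGraph hS, targetGraph_isTree hS, hypMor hS, hypMor_harmonic hS, ?_, ?_⟩, ?_⟩
  · have h1 := R.canon_dbl x
    have h2 := h3 x.1
    rw [h1]
    omega
  · rcases isEmpty_or_nonempty (target hS).E with h | h
    · exact Or.inr (card_of_isEmpty hS hL)
    · exact Or.inl (hypMor_degree hS)
  · rintro ⟨e, he⟩ ⟨e', he'⟩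
    constructor
    · intro h
      have h1 : Sum.map Prod.fst id e = Sum.map Prod.fst id e' := h
      rcases e with ⟨t, b⟩ | l <;> rcases e' with ⟨t', b'⟩ | l'
      · obtain rfl : t = t' := Sum.inl.inj h1
        have ht : t ∉ under S := fun ht => he ((mem_under_iff hS t b).2 ht)
        exact Or.inr ⟨not_isDiag hS ht he, not_isDiag hS ht he', targetEdge hS (Sum.inl ⟨t, ht⟩),
          rfl, rfl⟩
      · cases h1
      · cases h1
      · obtain rfl : l = l' := Sum.inr.inj h1
        exact Or.inl rfl
    · rintro (h | ⟨hd, hd', t, ht, ht'⟩)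
      · rw [h]; exact Setoid.refl' _ _
      · obtain ⟨k, rfl⟩ := targetEdge_surjective hS t
        obtain ⟨b, hb⟩ := (hypMor_onE_iff hS _ _).1 ht
        obtain ⟨b', hb'⟩ := (hypMor_onE_iff hS _ _).1 ht'
        rcases k with k | k
        · have h1 := congrArg (fun e => e.1.1) (Sum.inl.inj hb)
          have h2 := congrArg (fun e => e.1.1) (Sum.inl.inj hb')
          have h1' : Sum.inl (k.1, b) = e := h1
          have h2' : Sum.inl (k.1, b') = e' := h2
          subst h1' h2'
          exact rfl
        · cases hb
  · rw [← R.genus_dbl]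
    exact c.genus_eq

end LegTree

/-! ### Hyperelliptic types are contractions of generalised ladders -/

/-- Over a tree, local data that extend along every edge can be chosen coherently. -/
theorem IsTree.exists_section {W X : Type*} {B : SimpleGraph W} (hB : B.IsTree) {P : W → X → Prop}
    {Rel : W → W → X → X → Prop} (hsymm : ∀ y y' x x', Rel y y' x x' → Rel y' y x' x) {r : W} {x₀ : X}
    (h0 : P r x₀) (hext : ∀ y y' x, B.Adj y y' → P y x → ∃ x', P y' x' ∧ Rel y y' x x') :
    ∃ s : W → X, (∀ y, P y (s y)) ∧ ∀ y y', B.Adj y y' → Rel y y' (s y) (s y') := by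
  classical
  -- every vertex at distance `n + 1` from the root has a unique neighbour at distance `n`
  have hpar : ∀ n y, B.dist r y = n + 1 → ∃ q, B.Adj q y ∧ B.dist r q = n := by
    intro n y hy
    obtain ⟨w, hw, hl⟩ := hB.connected.exists_path_of_dist r y
    have hnil : ¬ w.Nil := by
      intro h
      rw [← SimpleGraph.Walk.length_eq_zero_iff] at h
      omega
    refine ⟨w.penultimate, w.adj_penultimate hnil, ?_⟩
    have h1 := SimpleGraph.dist_le w.dropLast
    have h2 : w.dropLast.length + 1 = w.length := w.length_dropLast_add_one hnil
    have h3 := hB.connected.dist_triangle (u := r) (v := w.penultimate) (w := y)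
    have h4 := SimpleGraph.dist_eq_one_iff_adj.2 (w.adj_penultimate hnil)
    omega
  have huniq : ∀ y q q', B.Adj q y → B.Adj q' y → B.dist r q + 1 = B.dist r y →
      B.dist r q' + 1 = B.dist r y → q = q' := by
    have key : ∀ y q, B.Adj q y → B.dist r q + 1 = B.dist r y → ∀ w : B.Walk r y, w.IsPath →
        q = w.penultimate := by
      intro y q hq hd w hw
      obtain ⟨u, hu, hul⟩ := hB.connected.exists_path_of_dist r q
      have hy : y ∉ u.support := by
        intro hy
        have h1 := SimpleGraph.dist_le (u.takeUntil y hy)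
        have h2 := u.length_takeUntil_le_length hy
        omega
      have hp : (u.concat hq).IsPath := hu.concat hy hq
      have h1 := (hB.isAcyclic.subsingleton_path r y).elim ⟨w, hw⟩ ⟨_, hp⟩
      have h2 : w = u.concat hq := congrArg Subtype.val h1
      rw [h2, SimpleGraph.Walk.penultimate_concat]
    intro y q q' hq hq' hd hd'
    obtain ⟨w, hw, -⟩ := hB.connected.exists_path_of_dist r y
    rw [key y q hq hd w hw, key y q' hq' hd' w hw]
  choose par hadj hdist using hpar
  choose ext hextP hextR using hext
  let s : ∀ n y, B.dist r y = n → {x // P y x} := fun n => Nat.rec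
    (fun y h => ⟨x₀, by
      have : r = y := (hB.connected.dist_eq_zero_iff).1 h
      exact this ▸ h0⟩)
    (fun n s y h => ⟨ext _ _ _ (hadj n y h) (s _ (hdist n y h)).2, hextP _ _ _ _ _⟩) n
  have hs : ∀ n y h, (s n y h).1 = (s _ y rfl).1 := by
    rintro n y rfl; rfl
  have hstep : ∀ y y', B.Adj y y' → B.dist r y' = B.dist r y + 1 →
      Rel y y' (s _ y rfl).1 (s _ y' rfl).1 := by
    intro y y' h hd
    rw [← hs _ y' hd]
    have hy : par _ _ hd = y :=
      huniq y' _ _ (hadj _ _ hd) h (by rw [hdist _ _ hd, hd]) hd.symm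
    have h2 := hextR _ _ _ (hadj _ _ hd) (s _ _ (hdist _ y' hd)).2
    have h3 : (s _ _ (hdist _ y' hd)).1 = (s _ y rfl).1 := by
      rw [hs]
      exact congrArg (fun u => (s _ u rfl).1) hy
    refine Eq.subst (motive := fun u => Rel u y' _ _) hy ?_
    refine Eq.subst (motive := fun u => Rel _ y' u _) h3 ?_
    exact h2
  refine ⟨fun y => (s _ y rfl).1, fun y => (s _ y rfl).2, fun y y' h => ?_⟩
  rcases hB.dist_eq_dist_add_one_of_adj r h with hd | hd
  · exact hsymm _ _ _ _ (hstep _ _ h.symm hd)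
  · exact hstep _ _ h hd

/-- The combinatorial content of a hyperelliptic morphism, restricted to the vertices of the graph
itself: a map of the vertices onto a tree, with at most two vertices over a vertex and exactly two
edges over an edge of the tree. The base of a loop, and a vertex of positive weight, is alone in its
fibre. -/
structure HypDatum (T : CGraph) where
  W : Type
  finW : Finite W
  B : SimpleGraph W
  tree : B.IsTree
  p : T.V → W
  edge : ∀ e, ((T.ends e).map p).IsDiag ∨ (T.ends e).map p ∈ B.edgeSet
  two : ∀ t ∈ B.edgeSet, Nat.card {e // (T.ends e).map p = t} = 2
  ex : ∀ t ∈ B.edgeSet, ∀ v, p v ∈ t → ∃ e, (T.ends e).map p = t ∧ v ∈ T.ends e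
  fib : ∀ y, ∃ x : Bool → T.V, (∀ b, p (x b) = y) ∧ ∀ v, p v = y → ∃ b, x b = v
  loop : ∀ (l : T.toWGraph.AllLoops) (v : T.V), p v = p (T.toWGraph.base l) → v = T.toWGraph.base l
  rel : ∀ e e', T.rel e e' ↔ e = e' ∨
    (T.ends e).map p = (T.ends e').map p ∧ (T.ends e).map p ∈ B.edgeSet

attribute [instance] HypDatum.finW

theorem Mor.onE_eq_inr_iff {G : WGraph} {W : Type} [Finite W] {B : SimpleGraph W}
    (φ : Mor G (WGraph.ofSimple B)) (e : G.E) (t : B.edgeSet) :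
    φ.onE e = Sum.inr t ↔ (G.ends e).map φ.onV = t.1 := by
  refine ⟨fun h => (φ.horizontal e t h).symm, fun h => ?_⟩
  rcases h' : φ.onE e with y | t'
  · have := φ.vertical e y h'
    refine absurd ?_ (B.not_isDiag_of_mem_edgeSet t.2)
    have h2 : φ.onV (G.tail e) = φ.onV (G.head e) := (this _ (G.tail_mem e)).trans
      (this _ (by rw [G.ends_eq_mk]; exact Sym2.mem_mk_right _ _)).symm
    have h3 : t.1 = s(φ.onV (G.tail e), φ.onV (G.head e)) := by
      rw [← h, G.ends_eq_mk]; rfl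
    rw [h3]
    exact h2
  · have := φ.horizontal e t' h'
    exact congrArg Sum.inr (Subtype.ext (this.trans h))

theorem Sym2.eq_of_mem_of_map_eq {V W : Type*} {p : V → W} {z : Sym2 V} (hz : ¬ (z.map p).IsDiag)
    {v v' : V} (hv : v ∈ z) (hv' : v' ∈ z) (h : p v = p v') : v = v' := by
  induction z using Sym2.inductionOn with
  | hf a b =>
    simp only [Sym2.map_mk, Sym2.mk_isDiag_iff] at hz
    rcases Sym2.mem_iff.1 hv with rfl | rfl <;> rcases Sym2.mem_iff.1 hv' with rfl | rfl
    · rfl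
    · exact absurd h hz
    · exact absurd h.symm hz
    · rfl

/-- In the exceptional case, the two vertices of the loopless graph are the whole fibre. -/
theorem HypDatum.of_dipole {T : CGraph} (hc : T.toWGraph.Connected)
    (h2 : Nat.card T.toWGraph.loopless.V = 2) (hrel : ∀ e e', T.rel e e' ↔ e = e') :
    Nonempty (HypDatum T) := by
  obtain ⟨⟨v₀⟩, -⟩ := hc
  have i : Bool ≃ T.toWGraph.loopless.V :=
    finTwoEquiv.symm.trans (Finite.equivFinOfCardEq h2).symm
  let r : T.toWGraph.loopless.V → T.V := Sum.elim id T.toWGraph.base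
  refine ⟨{
    W := Unit
    finW := inferInstance
    B := ⊥
    tree := SimpleGraph.IsTree.of_subsingleton
    p := fun _ => ()
    edge := fun e => Or.inl ?_
    two := fun t ht => absurd ht (by simp)
    ex := fun t ht => absurd ht (by simp)
    fib := fun y => ⟨fun b => r (i b), fun _ => rfl, fun v _ => ?_⟩
    loop := fun l v _ => ?_
    rel := fun e e' => by simp [hrel] }⟩
  · rw [T.ends_eq_mk, Sym2.map_mk, Sym2.mk_isDiag_iff]
  · exact ⟨i.symm (Sum.inl v), congrArg r (i.apply_symm_apply (Sum.inl v))⟩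
  · by_contra hv
    have h3 : Function.Injective (fun k : Fin 3 =>
        (![Sum.inl v, Sum.inl (T.toWGraph.base l), Sum.inr l] k : T.toWGraph.loopless.V)) := by
      intro a b hab
      have hv' : T.toWGraph.base l ≠ v := fun h => hv h.symm
      fin_cases a <;> fin_cases b <;> simp_all
    have h4 : Nat.card (Fin 3) ≤ 2 := (Nat.card_le_card_of_injective _ h3).trans_eq h2
    simp at h4

/-- A harmonic morphism of degree two restricts to a datum over the part of the tree over which vertices
of `T` lie. The midpoint of a loop lies over a leaf outside of this part, whose edge has the two halves
of the loop over it, so that there is no other vertex in the fibre of the base. -/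
theorem HypDatum.of_mor {T : CGraph} (hc : T.toWGraph.Connected) {W : Type} [Finite W]
    {B : SimpleGraph W} (hB : B.IsTree) (φ : Mor T.toWGraph.loopless (WGraph.ofSimple B))
    (hφ : φ.Harmonic) (hn : φ.Nondegenerate) (hd : φ.HasDegree 2)
    (hrel : ∀ e e', T.rel e e' ↔ e = e' ∨
      ∃ (h : ¬ (T.ends e).IsDiag) (h' : ¬ (T.ends e').IsDiag) (t : B.edgeSet),
        φ.onE (Sum.inl ⟨e, h⟩) = Sum.inr t ∧ φ.onE (Sum.inl ⟨e', h'⟩) = Sum.inr t) :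
    Nonempty (HypDatum T) := by
  classical
  set q : T.V → W := fun v => φ.onV (Sum.inl v) with hq
  have hon := φ.onE_eq_inr_iff
  -- every vertex lies on an edge over any given edge at its image
  have hex : ∀ x (t : B.edgeSet), φ.onV x ∈ t.1 →
      ∃ e, (T.toWGraph.loopless.ends e).map φ.onV = t.1 ∧ x ∈ T.toWGraph.loopless.ends e := by
    intro x t hx
    obtain ⟨t', ht', hpos⟩ := hn x
    rw [hφ x t' t ht' hx] at hpos
    obtain ⟨⟨e, he, he'⟩⟩ := (Nat.card_pos_iff.1 hpos).1
    exact ⟨e, (hon e t).1 he', he⟩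
  have htwo : ∀ t : B.edgeSet,
      Nat.card {e // (T.toWGraph.loopless.ends e).map φ.onV = t.1} = 2 := by
    intro t
    rw [← hd.2 t]
    exact Nat.card_congr (Equiv.subtypeEquivRight fun e => (hon e t).symm)
  -- both halves of a loop lie over the same edge of the tree
  have hloop : ∀ l : T.toWGraph.AllLoops, s(q (T.toWGraph.base l), φ.onV (Sum.inr l)) ∈ B.edgeSet := by
    intro l
    obtain ⟨t, ht, hpos⟩ := hn (Sum.inr l)
    obtain ⟨⟨e, he, he'⟩⟩ := (Nat.card_pos_iff.1 hpos).1
    rcases e with e | ⟨l', b⟩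
    · obtain ⟨v, -, hv⟩ := Sym2.mem_map.1 he
      cases hv
    · have h1 : Sum.inr l ∈ s((Sum.inl (T.toWGraph.base l') : T.V ⊕ T.toWGraph.AllLoops), Sum.inr l') :=
        he
      have h2 : l = l' := by simpa using h1
      subst h2
      exact Set.mem_of_eq_of_mem ((hon _ t).1 he') t.2
  have hloop2 : ∀ (l : T.toWGraph.AllLoops) (e : T.toWGraph.loopless.E),
      (T.toWGraph.loopless.ends e).map φ.onV = s(q (T.toWGraph.base l), φ.onV (Sum.inr l)) →
      ∃ b, e = Sum.inr (l, b) := by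
    intro l e he
    have h2 := htwo ⟨_, hloop l⟩
    let j : Bool → {e // (T.toWGraph.loopless.ends e).map φ.onV =
        s(q (T.toWGraph.base l), φ.onV (Sum.inr l))} := fun b => ⟨Sum.inr (l, b), rfl⟩
    have hj : Function.Injective j := fun b b' h => by
      have h3 := congrArg Subtype.val h
      exact (Prod.mk.inj (Sum.inr.inj h3)).2
    have hj' := (Nat.bijective_iff_injective_and_card j).2 ⟨hj, by rw [h2]; simp⟩
    obtain ⟨b, hb⟩ := hj'.2 ⟨e, he⟩
    exact ⟨b, (congrArg Subtype.val hb).symm⟩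
  have hloop3 : ∀ (l : T.toWGraph.AllLoops) v,
      q v ∈ s(q (T.toWGraph.base l), φ.onV (Sum.inr l)) → v = T.toWGraph.base l := by
    intro l v hv
    obtain ⟨e, he, hve⟩ := hex (Sum.inl v) ⟨_, hloop l⟩ hv
    obtain ⟨b, rfl⟩ := hloop2 l e he
    have h1 : Sum.inl v ∈ s((Sum.inl (T.toWGraph.base l) : T.V ⊕ T.toWGraph.AllLoops), Sum.inr l) :=
      hve
    simpa using h1
  have hloop4 : ∀ (l : T.toWGraph.AllLoops) v, q v ≠ φ.onV (Sum.inr l) := by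
    intro l v hv
    have h1 := hloop3 l v (by rw [hv]; exact Sym2.mem_mk_right _ _)
    subst h1
    exact (B.not_isDiag_of_mem_edgeSet (hloop l)) hv
  let p : T.V → range q := fun v => ⟨q v, v, rfl⟩
  have hval : ∀ z : Sym2 T.V, (z.map p).map Subtype.val = z.map q := fun z => by
    rw [Sym2.map_map]; rfl
  have hmem : ∀ t : Sym2 (range q), t ∈ (B.induce (range q)).edgeSet ↔ t.map Subtype.val ∈ B.edgeSet := by
    intro t
    induction t using Sym2.inductionOn with
    | hf a b => rfl
  have hinj : Function.Injective (Sym2.map (Subtype.val : range q → W)) :=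
    Sym2.map.injective Subtype.val_injective
  have hdiag : ∀ e, (T.ends e).IsDiag → ∀ t ∈ B.edgeSet, (T.ends e).map q ≠ t := by
    intro e he t ht h
    refine B.not_isDiag_of_mem_edgeSet ht ?_
    rw [← h]
    obtain ⟨v, hv⟩ : ∃ v, T.ends e = s(v, v) := by
      rw [T.ends_eq_mk, Sym2.mk_isDiag_iff] at he
      exact ⟨T.tail e, by rw [T.ends_eq_mk, ← he]⟩
    rw [hv]
    rfl
  -- the edges of `T` over an edge of the induced tree
  have hequiv : ∀ t : Sym2 (range q), t.map Subtype.val ∈ B.edgeSet → ∀ e : T.toWGraph.loopless.E,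
      (T.toWGraph.loopless.ends e).map φ.onV = t.map Subtype.val →
      ∃ (e' : T.E) (h : ¬ (T.ends e').IsDiag), e = Sum.inl ⟨e', h⟩ ∧ (T.ends e').map p = t := by
    rintro t ht (⟨e', h⟩ | ⟨l, b⟩) he
    · refine ⟨e', h, rfl, hinj ?_⟩
      rw [hval, ← he]
      exact (Sym2.map_map _).symm
    · have h1 : φ.onV (Sum.inr l) ∈ t.map Subtype.val := by
        rw [← he]
        exact Sym2.mem_mk_right _ _
      obtain ⟨⟨y, v, rfl⟩, -, hy⟩ := Sym2.mem_map.1 h1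
      exact absurd hy (hloop4 l v)
  have hlift : ∀ (t : Sym2 (range q)), t.map Subtype.val ∈ B.edgeSet → ∀ e, (T.ends e).map p = t →
      ∃ h, (T.toWGraph.loopless.ends (Sum.inl ⟨e, h⟩)).map φ.onV = t.map Subtype.val := by
    rintro t ht e rfl
    rw [hval] at ht ⊢
    exact ⟨fun h => hdiag e h _ ht rfl, Sym2.map_map _⟩
  obtain ⟨⟨v₀⟩, hc⟩ := hc
  have : Nonempty (range q) := ⟨p v₀⟩
  have hedge : ∀ e, ((T.ends e).map p).IsDiag ∨ (T.ends e).map p ∈ (B.induce (range q)).edgeSet := by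
    intro e
    have hd : ∀ a b, T.ends e = s(a, b) → q a = q b → ((T.ends e).map p).IsDiag := fun a b h hab => by
      rw [h]; exact Subtype.ext hab
    by_cases h : (T.ends e).IsDiag
    · rw [T.ends_eq_mk, Sym2.mk_isDiag_iff] at h
      exact Or.inl (hd _ _ (T.ends_eq_mk e) (congrArg q h))
    · rcases h' : φ.onE (Sum.inl ⟨e, h⟩) with y | t
      · left
        have h1 : ∀ x ∈ T.ends e, q x = y := fun x hx =>
          φ.vertical _ y h' (Sum.inl x) (Sym2.mem_map.2 ⟨x, hx, rfl⟩)
        refine hd _ _ (T.ends_eq_mk e) ((h1 _ (T.tail_mem e)).trans (h1 _ ?_).symm)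
        rw [T.ends_eq_mk]
        exact Sym2.mem_mk_right _ _
      · right
        rw [hmem, hval]
        have h1 := (hon _ t).1 h'
        exact Set.mem_of_eq_of_mem ((Sym2.map_map _).symm.trans h1) t.2
  have hex' : ∀ t ∈ (B.induce (range q)).edgeSet, ∀ v, p v ∈ t →
      ∃ e, (T.ends e).map p = t ∧ v ∈ T.ends e := by
    intro t ht v hv
    have ht' := (hmem t).1 ht
    obtain ⟨e, he, hve⟩ := hex (Sum.inl v) ⟨_, ht'⟩ (Sym2.mem_map.2 ⟨p v, hv, rfl⟩)
    obtain ⟨e', h, rfl, h'⟩ := hequiv t ht' e he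
    obtain ⟨u, hu, huv⟩ := Sym2.mem_map.1 hve
    exact ⟨e', h', Sum.inl.inj huv ▸ hu⟩
  refine ⟨{
    W := range q
    finW := inferInstance
    B := B.induce (range q)
    tree := ⟨⟨?_⟩, hB.isAcyclic.induce _⟩
    p := p
    edge := hedge
    two := ?_
    ex := hex'
    fib := ?_
    loop := fun l v hv => hloop3 l v (Sym2.mem_iff.2 (Or.inl (congrArg Subtype.val hv)))
    rel := ?_ }⟩
  · rintro ⟨_, v, rfl⟩ ⟨_, v', rfl⟩
    refine joined_le (G := T.toWGraph) (S := univ)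
      ((SimpleGraph.reachableSetoid (B.induce (range q))).comap p) (fun e _ u u' he => ?_) (hc v v')
    rcases hedge e with h | h <;> rw [he] at h
    · have h1 : p u = p u' := h
      change (B.induce (range q)).Reachable (p u) (p u')
      rw [h1]
    · exact SimpleGraph.Adj.reachable h
  · intro t ht
    have ht' := (hmem t).1 ht
    rw [← htwo ⟨_, ht'⟩]
    refine Nat.card_congr (Equiv.ofBijective
      (fun e => ⟨Sum.inl ⟨e.1, (hlift t ht' e.1 e.2).1⟩, (hlift t ht' e.1 e.2).2⟩) ⟨?_, ?_⟩)
    · intro e e' h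
      have h1 := Sum.inl.inj (congrArg Subtype.val h)
      exact Subtype.ext (congrArg (fun x => x.1) h1)
    · rintro ⟨e, he⟩
      obtain ⟨e', h, rfl, h'⟩ := hequiv t ht' e he
      exact ⟨⟨e', h'⟩, rfl⟩
  · rintro ⟨_, v₀, rfl⟩
    obtain ⟨t, ht, -⟩ := hn (Sum.inl v₀)
    have h2 := htwo t
    have i : Bool ≃ {e // (T.toWGraph.loopless.ends e).map φ.onV = t.1} :=
      finTwoEquiv.symm.trans (Finite.equivFinOfCardEq h2).symm
    let r : T.toWGraph.loopless.V → T.V := Sum.elim id fun _ => v₀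
    have hr : ∀ z, φ.onV z = q v₀ → p (r z) = p v₀ := by
      rintro (v | l) h
      · exact Subtype.ext h
      · rfl
    have hmem' : ∀ b, ∃ x ∈ T.toWGraph.loopless.ends (i b).1, φ.onV x = q v₀ := fun b =>
      Sym2.mem_map.1 (by rw [(i b).2]; exact ht)
    choose x hx hxv using hmem'
    have hcov : ∀ v, q v = q v₀ → ∃ b, x b = Sum.inl v := by
      intro v hv
      obtain ⟨e, he, hve⟩ := hex (Sum.inl v) t (by
        have h3 : φ.onV (Sum.inl v) = φ.onV (Sum.inl v₀) := hv
        rw [h3]; exact ht)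
      obtain ⟨b, hb⟩ := i.surjective ⟨e, he⟩
      refine ⟨b, Sym2.eq_of_mem_of_map_eq (p := φ.onV) (z := T.toWGraph.loopless.ends e) ?_ ?_ hve
        ((hxv b).trans hv.symm)⟩
      · rw [he]; exact B.not_isDiag_of_mem_edgeSet t.2
      · have h3 := hx b
        rwa [hb] at h3
    refine ⟨fun b => r (x b), fun b => hr _ (hxv b), fun v hv => ?_⟩
    obtain ⟨b, hb⟩ := hcov v (congrArg Subtype.val hv)
    exact ⟨b, congrArg r hb⟩
  · intro e e'
    rw [hrel]
    refine or_congr_right ⟨?_, ?_⟩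
    · rintro ⟨h, h', t, h1, h2⟩
      have h3 := (hon _ t).1 h1
      have h4 := (hon _ t).1 h2
      have h3' : (T.ends e).map q = t.1 := (Sym2.map_map _).symm.trans h3
      have h4' : (T.ends e').map q = t.1 := (Sym2.map_map _).symm.trans h4
      refine ⟨hinj ?_, ?_⟩
      · rw [hval, hval, h3', h4']
      · rw [hmem, hval, h3']; exact t.2
    · rintro ⟨h1, h2⟩
      have h2' := (hmem _).1 h2
      obtain ⟨h, h3⟩ := hlift _ h2' e rfl
      obtain ⟨h', h4⟩ := hlift _ h2' e' h1.symm
      exact ⟨h, h', ⟨_, h2'⟩, (hon _ ⟨_, h2'⟩).2 h3, (hon _ ⟨_, h2'⟩).2 h4⟩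

theorem CGraph.IsHyp.hypDatum {T : CGraph} (h : T.IsHyp) : Nonempty (HypDatum T) := by
  obtain ⟨hc, W, _, B, hB, φ, hφ, h | ⟨h2, h1⟩, hrel⟩ := h
  · exact HypDatum.of_mor hc.1 hB φ hφ h.1 h.2 hrel
  · refine HypDatum.of_dipole hc.1 h2 fun e e' => (hrel e e').trans (or_iff_left ?_)
    rintro ⟨-, -, t, -⟩
    have := (Nat.card_eq_one_iff_unique.1 h1).1
    obtain ⟨t, ht⟩ := t
    induction t using Sym2.inductionOn with
    | hf a b => exact SimpleGraph.Adj.ne ht (Subsingleton.elim a b)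

namespace HypDatum

variable {T : CGraph} (D : HypDatum T)

/-- The vertices in the fibre over `y` are listed by `x`, possibly twice the same one. -/
def IsFibre (y : D.W) (x : Bool → T.V) : Prop :=
  (∀ b, D.p (x b) = y) ∧ ∀ v, D.p v = y → ∃ b, x b = v

/-- A list of the fibre over `y` and a list of the fibre over an adjacent vertex `y'` match if
corresponding vertices are joined by the two edges over the edge `yy'`. -/
def Match (x x' : Bool → T.V) : Prop :=
  ∃ e : Bool → T.E, Function.Injective e ∧ ∀ b, T.ends (e b) = s(x b, x' b)

/-- A list of a fibre can be carried along an edge of the tree: the two edges over it can be listed such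
that they start at the listed vertices, and their other ends make up the next fibre. -/
theorem exists_match {y y' : D.W} {x : Bool → T.V} (h : D.B.Adj y y') (hx : D.IsFibre y x) :
    ∃ x', D.IsFibre y' x' ∧ Match x x' := by
  have ht : s(y, y') ∈ D.B.edgeSet := h
  have hdiag := D.B.not_isDiag_of_mem_edgeSet ht
  have h2 := D.two _ ht
  let i : Bool ≃ {e // (T.ends e).map D.p = s(y, y')} :=
    finTwoEquiv.symm.trans (Finite.equivFinOfCardEq h2).symm
  obtain ⟨e, hx'⟩ : ∃ e : Bool ≃ {e // (T.ends e).map D.p = s(y, y')},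
      ∀ b, x b ∈ T.ends (e b).1 := by
    by_cases hxx : x false = x true
    · refine ⟨i, fun b => ?_⟩
      have : y ∈ (T.ends (i b).1).map D.p := by rw [(i b).2]; exact Sym2.mem_mk_left _ _
      obtain ⟨v, hv, hvy⟩ := Sym2.mem_map.1 this
      obtain ⟨b', rfl⟩ := hx.2 v hvy
      have : x b = x b' := by cases b <;> cases b' <;> simp [hxx]
      rwa [this]
    · have h3 : ∀ b, ∃ e, (T.ends e).map D.p = s(y, y') ∧ x b ∈ T.ends e := fun b =>
        D.ex _ ht _ (by rw [hx.1]; exact Sym2.mem_mk_left _ _)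
      choose e he hxe using h3
      let j : Bool → {e // (T.ends e).map D.p = s(y, y')} := fun b => ⟨e b, he b⟩
      have hj : Function.Injective j := by
        have hne : e false ≠ e true := fun h3 => hxx <| by
          refine Sym2.eq_of_mem_of_map_eq (p := D.p) (z := T.ends (e false)) ?_ (hxe _) ?_ ?_
          · rw [he]; exact hdiag
          · rw [h3]; exact hxe _
          · rw [hx.1, hx.1]
        intro b b' hbb
        have h4 := congrArg Subtype.val hbb
        cases b <;> cases b'
        · rfl
        · exact absurd h4 hne
        · exact absurd h4.symm hne
        · rfl
      exact ⟨Equiv.ofBijective j ((Nat.bijective_iff_injective_and_card j).2 ⟨hj, by rw [h2]; simp⟩),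
        hxe⟩
  have hother : ∀ b, ∃ v, T.ends (e b).1 = s(x b, v) := fun b => by
    obtain ⟨v, hv⟩ := hx' b
    exact ⟨v, hv⟩
  choose x' hx'' using hother
  have hp : ∀ b, D.p (x' b) = y' := fun b => by
    have h3 := (e b).2
    rw [hx'', Sym2.map_mk, hx.1] at h3
    exact Sym2.congr_right.1 h3
  refine ⟨x', ⟨hp, fun v hv => ?_⟩, fun b => (e b).1, Subtype.val_injective.comp e.injective, hx''⟩
  obtain ⟨k, hk, hvk⟩ := D.ex _ ht v (by rw [hv]; exact Sym2.mem_mk_right _ _)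
  obtain ⟨b, hb⟩ := e.surjective ⟨k, hk⟩
  have hb' : (e b).1 = k := congrArg Subtype.val hb
  refine ⟨b, Sym2.eq_of_mem_of_map_eq (p := D.p) (z := T.ends k) ?_ ?_ hvk ((hp b).trans hv.symm)⟩
  · rw [hk]; exact hdiag
  · rw [← hb', hx'']; exact Sym2.mem_mk_right _ _

/-- The two sheets over the tree can be labelled consistently, because a tree has no cycles. -/
theorem exists_section : ∃ s : D.W → Bool → T.V, (∀ y, D.IsFibre y (s y)) ∧
    ∀ y y', D.B.Adj y y' → Match (s y) (s y') := by
  obtain ⟨r⟩ := D.tree.connected.nonempty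
  obtain ⟨x₀, h0⟩ := D.fib r
  refine IsTree.exists_section D.tree (P := D.IsFibre) (Rel := fun _ _ => Match) ?_ (r := r) h0
    fun y y' x h hx => D.exists_match h hx
  rintro y y' x x' ⟨e, he, hxx⟩
  exact ⟨e, he, fun b => by rw [hxx, Sym2.eq_swap]⟩

variable (s : D.W → Bool → T.V)

/-- The tree with legs of a hyperelliptic type: the tree over which the type lies, with legs for the
edges inside the fibres, for the loops, for the weights and for the fibres with one vertex. -/
noncomputable abbrev legTree : LegTree where
  W := D.W
  E := D.B.edgeSet
  L := {e : T.E // ((T.ends e).map D.p).IsDiag ∧ ¬ (T.ends e).IsDiag} ⊕ T.toWGraph.AllLoops ⊕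
    {y // s y false = s y true}
  finW := inferInstance
  finE := inferInstance
  finL := inferInstance
  root := fun h => bif h.2 then (Quot.out h.1.1).2 else (Quot.out h.1.1).1
  leg := Sum.elim (fun e => D.p (T.tail e.1)) (Sum.elim (fun l => D.p (T.toWGraph.base l)) Subtype.val)
  conn := by
    refine ⟨D.tree.connected.nonempty, fun y y' => ?_⟩
    have hr := D.tree.connected y y'
    rw [SimpleGraph.reachable_iff_reflTransGen] at hr
    induction hr with
    | refl => exact Setoid.refl' _ _
    | tail _ h ih =>
      refine Setoid.trans' _ ih (joined_of_ends (e := (⟨s(_, _), h⟩ : D.B.edgeSet)) (mem_univ _) ?_)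
      exact Quot.out_eq (s(_, _))
  card := (SimpleGraph.isTree_iff_connected_and_card.1 D.tree).2

variable {D s}

theorem root_eq (t : D.B.edgeSet) :
    s((D.legTree s).root (t, false), (D.legTree s).root (t, true)) = t.1 :=
  Quot.out_eq t.1

variable (hs : ∀ y, D.IsFibre y (s y))

include hs in
/-- The base of a loop, or of a weight, is alone in its fibre. -/
theorem section_base (l : T.toWGraph.AllLoops) (b : Bool) :
    s (D.p (T.toWGraph.base l)) b = T.toWGraph.base l :=
  D.loop l _ ((hs _).1 b)

include hs in
/-- An edge inside a fibre joins the two vertices of the fibre. -/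
theorem vertical_ends {e : T.E} (h : ((T.ends e).map D.p).IsDiag) (h' : ¬ (T.ends e).IsDiag) :
    T.ends e = s(s (D.p (T.tail e)) false, s (D.p (T.tail e)) true) := by
  have h1 := T.ends_eq_mk e
  rw [h1] at h h'
  rw [h1]
  have h2 : D.p (T.tail e) = D.p (T.head e) := h
  have h3 : T.tail e ≠ T.head e := h'
  obtain ⟨b, hb⟩ := (hs (D.p (T.tail e))).2 _ rfl
  obtain ⟨b', hb'⟩ := (hs (D.p (T.tail e))).2 _ h2.symm
  rw [Sym2.eq_iff]
  cases b <;> cases b'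
  · exact absurd (hb.symm.trans hb') h3
  · exact Or.inl ⟨hb.symm, hb'.symm⟩
  · exact Or.inr ⟨hb.symm, hb'.symm⟩
  · exact absurd (hb.symm.trans hb') h3

/-- The edges of the type that correspond to the edges of the generalised ladder; there is none for a
leg that stands for a weight or for a fibre with one vertex. -/
def label (copy : D.B.edgeSet × Bool → T.E) : (D.legTree s).dbl.E → Option T.E :=
  Sum.elim (fun x => some (copy x)) (Sum.elim (fun e => some e.1)
    (Sum.elim (Sum.elim (fun q => some q.1.2) fun _ => none) fun _ => none))

include hs in
/-- A vertex that is alone in its fibre of weight `w` arises by contracting `w + 1` legs between two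
vertices, and a vertex that is not alone in its fibre has weight zero. -/
theorem weight_eq (copy : D.B.edgeSet × Bool → T.E) (v : T.V) :
    (T.w v : ℤ) - 1 = push (fun x : D.W × Bool => s x.1 x.2) (fun _ => ((0 : ℕ) : ℤ) - 1) v +
      push (Sum.elim (fun x => s ((D.legTree s).root x) false)
        fun l => s ((D.legTree s).leg l) false)
        (indicator {d : (D.legTree s).dbl.E | label copy d = none} 1) v := by
  have h1 : push (fun x : D.W × Bool => s x.1 x.2) (fun _ => ((0 : ℕ) : ℤ) - 1) v =
      -(Nat.card {b // s (D.p v) b = v} : ℤ) := by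
    have h2 := push_mul_left (fun x : D.W × Bool => s x.1 x.2) (-1) 1 v
    rw [push_one] at h2
    have h3 : Nat.card {x : D.W × Bool // s x.1 x.2 = v} = Nat.card {b // s (D.p v) b = v} := by
      symm
      refine Nat.card_congr (Equiv.ofBijective (fun b => ⟨(D.p v, b.1), b.2⟩) ⟨?_, ?_⟩)
      · intro b b' h
        exact Subtype.ext (Prod.mk.inj (congrArg Subtype.val h)).2
      · rintro ⟨⟨y, b⟩, h⟩
        obtain rfl : D.p v = y := (congrArg D.p h).symm.trans ((hs y).1 b)
        exact ⟨⟨b, h⟩, rfl⟩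
    rw [h3] at h2
    refine Eq.trans ?_ (h2.trans (by ring))
    congr 1
  rw [h1, push_indicator]
  have hweight : ∀ q : (Σ v : T.V, Fin (T.w v)), ∀ b, s (D.p q.1) b = q.1 := fun q b =>
    section_base hs (Sum.inr q) b
  by_cases hv : s (D.p v) false = s (D.p v) true
  · have hb : ∀ b, s (D.p v) b = v := by
      obtain ⟨b', hb'⟩ := (hs (D.p v)).2 v rfl
      intro b
      refine Eq.trans ?_ hb'
      cases b <;> cases b' <;> simp [hv]
    have h2 : Nat.card {b // s (D.p v) b = v} = 2 := by
      rw [Nat.card_congr (Equiv.subtypeUnivEquiv hb)]; simp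
    have h3 : Nat.card (Option (Fin (T.w v))) = Nat.card {d : (D.legTree s).dbl.E //
        d ∈ {d : (D.legTree s).dbl.E | label copy d = none} ∧
        Sum.elim (fun x => s ((D.legTree s).root x) false)
          (fun l => s ((D.legTree s).leg l) false) d = v} := by
      refine Nat.card_congr (Equiv.ofBijective (fun o => o.elim
        ⟨Sum.inr (Sum.inr (Sum.inr ⟨D.p v, hv⟩)), rfl, hb _⟩
        fun k => ⟨Sum.inr (Sum.inr (Sum.inl (Sum.inr ⟨v, k⟩))), rfl, hb _⟩) ⟨?_, ?_⟩)
      · rintro (_ | k) (_ | k') h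
        · rfl
        · cases congrArg Subtype.val h
        · cases congrArg Subtype.val h
        · cases congrArg Subtype.val h
          rfl
      · rintro ⟨x | e | (q | q) | y, hd, hd'⟩
        · cases hd
        · cases hd
        · cases hd
        · have h4 : q.1 = v := (hweight q false).symm.trans hd'
          obtain ⟨v', k⟩ := q
          subst h4
          exact ⟨some k, rfl⟩
        · have h4 : y.1 = D.p v := ((hs y.1).1 false).symm.trans (congrArg D.p hd')
          refine ⟨none, Subtype.ext ?_⟩
          obtain ⟨y, hy⟩ := y
          subst h4
          rfl
    rw [h2, ← h3]
    simp
    ring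
  · have h2 : Nat.card {b // s (D.p v) b = v} = 1 := by
      obtain ⟨b', hb'⟩ := (hs (D.p v)).2 v rfl
      rw [Nat.card_eq_one_iff_exists]
      refine ⟨⟨b', hb'⟩, fun b => Subtype.ext ?_⟩
      have h3 := b.2.trans hb'.symm
      by_contra hne
      refine hv ?_
      rcases b with ⟨b, hb⟩
      cases b <;> cases b'
      · exact absurd rfl hne
      · exact h3
      · exact h3.symm
      · exact absurd rfl hne
    have h3 : T.w v = 0 := by
      by_contra h
      have h4 := hweight ⟨v, ⟨0, Nat.pos_of_ne_zero h⟩⟩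
      exact hv ((h4 false).trans (h4 true).symm)
    have h5 : Nat.card {d : (D.legTree s).dbl.E //
        d ∈ {d : (D.legTree s).dbl.E | label copy d = none} ∧
        Sum.elim (fun x => s ((D.legTree s).root x) false)
          (fun l => s ((D.legTree s).leg l) false) d = v} = 0 := by
      rw [Nat.card_eq_zero]
      left
      refine ⟨?_⟩
      rintro ⟨x | e | (q | q) | y, hd, hd'⟩
      · cases hd
      · cases hd
      · cases hd
      · have h4 : q.1 = v := (hweight q false).symm.trans hd'
        exact hv (by rw [← h4]; exact (hweight q false).trans (hweight q true).symm)
      · have h4 : y.1 = D.p v := ((hs y.1).1 false).symm.trans (congrArg D.p hd')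
        exact hv (h4 ▸ y.2)
    rw [h2, h3, h5]
    simp

set_option maxHeartbeats 1000000 in
/-- A labelling of the two sheets presents the type as a contraction of the generalised ladder: the copy
`(y, b)` of a vertex of the tree goes to the vertex on sheet `b` over `y`, and the legs that stand for
weights and for fibres with one vertex are contracted. -/
theorem spec_dbl (hs : ∀ y, D.IsFibre y (s y)) (hm : ∀ y y', D.B.Adj y y' → Match (s y) (s y')) :
    T.Spec (D.legTree s).dbl ∧ ∃ (S : Set (D.legTree s).dbl.E)
      (k : Contr (D.legTree s).dbl.toWGraph T.toWGraph S), ∀ x, k.onV x = s x.1 x.2 := by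
  classical
  have hcopy : ∀ t : D.B.edgeSet, Match (s ((D.legTree s).root (t, false)))
      (s ((D.legTree s).root (t, true))) := fun t =>
    hm _ _ (by rw [← SimpleGraph.mem_edgeSet, root_eq]; exact t.2)
  choose copy' hinj' hends' using hcopy
  let copy : D.B.edgeSet × Bool → T.E := fun x => copy' x.1 x.2
  have hends : ∀ x, T.ends (copy x) = s(s ((D.legTree s).root (x.1, false)) x.2,
    s ((D.legTree s).root (x.1, true)) x.2) := fun x => hends' x.1 x.2
  have hmap : ∀ x, (T.ends (copy x)).map D.p = x.1.1 := fun x => by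
    rw [hends, Sym2.map_mk, (hs _).1, (hs _).1, root_eq]
  have hinj : Function.Injective copy := by
    rintro ⟨t, b⟩ ⟨t', b'⟩ h
    have h1 := hmap (t, b)
    rw [h, hmap] at h1
    obtain rfl : t' = t := Subtype.ext h1
    exact congrArg (Prod.mk t') (hinj' t' h)
  have hsurj : ∀ e, (T.ends e).map D.p ∈ D.B.edgeSet → ∃ x, copy x = e := by
    intro e he
    let j : Bool → {e' // (T.ends e').map D.p = (T.ends e).map D.p} := fun b =>
      ⟨copy (⟨_, he⟩, b), hmap _⟩
    have hj : Function.Injective j := fun b b' h =>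
      (Prod.mk.inj (hinj (congrArg Subtype.val h))).2
    obtain ⟨b, hb⟩ := ((Nat.bijective_iff_injective_and_card j).2
      ⟨hj, by rw [D.two _ he]; simp⟩).2 ⟨e, rfl⟩
    exact ⟨_, congrArg Subtype.val hb⟩
  let J : (D.legTree s).dbl.E → Option T.E := label copy
  let f : D.W × Bool → T.V := fun x => s x.1 x.2
  have hJ : ∀ d a, J d = some a → T.ends a = ((D.legTree s).dbl.ends d).map f := by
    rintro (x | e | (⟨⟨v, e⟩, he⟩ | q) | y) a h
    · obtain rfl := Option.some.inj h
      exact hends x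
    · obtain rfl := Option.some.inj h
      exact vertical_ends hs e.2.1 e.2.2
    · obtain rfl := Option.some.inj h
      have h1 := section_base hs (Sum.inl ⟨(v, e), he⟩)
      refine he.trans ?_
      exact (congrArg₂ (fun a b => s(a, b)) (h1 false) (h1 true)).symm
    · cases h
    · cases h
  have hnd : ∀ x, ¬ ((T.ends (copy x)).map D.p).IsDiag := fun x => by
    rw [hmap]; exact D.B.not_isDiag_of_mem_edgeSet x.1.2
  have hdd : ∀ e v, T.ends e = s(v, v) → ((T.ends e).map D.p).IsDiag := fun e v h => by
    rw [h]; rfl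
  have hJinj : ∀ d d' a, J d = some a → J d' = some a → d = d' := by
    rintro (x | e | (⟨⟨v, e⟩, he⟩ | q) | y) (x' | e' | (⟨⟨v', e'⟩, he'⟩ | q') | y') a h h' <;>
      first | exact (Option.some_ne_none a h.symm).elim |
        exact (Option.some_ne_none a h'.symm).elim | skip
    · have h1 : copy x = copy x' := Option.some.inj (h.trans h'.symm)
      rw [hinj h1]
    · have h1 : copy x = e'.1 := Option.some.inj (h.trans h'.symm)
      exact absurd (h1 ▸ e'.2.1) (hnd x)
    · have h1 : copy x = e' := Option.some.inj (h.trans h'.symm)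
      exact absurd (h1 ▸ hdd _ _ he') (hnd x)
    · have h1 : e.1 = copy x' := Option.some.inj (h.trans h'.symm)
      exact absurd (h1 ▸ e.2.1) (hnd x')
    · have h1 : e.1 = e'.1 := Option.some.inj (h.trans h'.symm)
      rw [Subtype.ext h1]
    · have h1 : e.1 = e' := Option.some.inj (h.trans h'.symm)
      exact absurd (by rw [h1]; exact he' ▸ rfl) e.2.2
    · have h1 : e = copy x' := Option.some.inj (h.trans h'.symm)
      exact absurd (h1 ▸ hdd _ _ he) (hnd x')
    · have h1 : e = e'.1 := Option.some.inj (h.trans h'.symm)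
      exact absurd (by rw [← h1]; exact he ▸ rfl) e'.2.2
    · have h1 : e = e' := Option.some.inj (h.trans h'.symm)
      subst h1
      have h2 : v = v' := by
        have h3 : s(v, v) = s(v', v') := he.symm.trans he'
        simpa using h3
      subst h2
      rfl
  have hJsurj : ∀ a, ∃ d, J d = some a := by
    intro a
    by_cases h : (T.ends a).IsDiag
    · have h1 := T.ends_eq_mk a
      rw [h1] at h
      have h2 : T.tail a = T.head a := h
      exact ⟨Sum.inr (Sum.inr (Sum.inl (Sum.inl ⟨(T.tail a, a), by rw [h1, ← h2]⟩))), rfl⟩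
    · rcases D.edge a with h1 | h1
      · exact ⟨Sum.inr (Sum.inl ⟨a, h1, h⟩), rfl⟩
      · obtain ⟨x, hx⟩ := hsurj a h1
        exact ⟨Sum.inl x, congrArg some hx⟩
  choose i hi using hJsurj
  let S : Set (D.legTree s).dbl.E := {d | J d = none}
  let t : (D.legTree s).dbl.E → T.V := Sum.elim (fun x => s ((D.legTree s).root x) false)
    fun l => s ((D.legTree s).leg l) false
  have hsat : (D.legTree s).dbl.Saturated S := by
    rintro d d' hr hd
    rcases d with x | l
    · cases hd
    · have hr' : Sum.map Prod.fst id (Sum.inr l) = Sum.map Prod.fst id d' := hr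
      rcases d' with x' | l'
      · cases hr'
      · obtain rfl : l = l' := Sum.inr.inj hr'
        exact hd
  -- the legs of the last kind, and only they, make the two copies of a vertex equal
  have hS : ∀ d ∈ S, ∀ x ∈ (D.legTree s).dbl.ends d, f x = t d := by
    rintro (x | e | (q | q) | y) hd
    · cases hd
    · cases hd
    · cases hd
    · have h1 := section_base hs (Sum.inr q)
      intro x hx
      have hx' : x ∈ s((D.p q.1, false), (D.p q.1, true)) := hx
      rcases Sym2.mem_iff.1 hx' with rfl | rfl
      · rfl
      · exact (h1 true).trans (h1 false).symm
    · intro x hx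
      have hx' : x ∈ s((y.1, false), (y.1, true)) := hx
      rcases Sym2.mem_iff.1 hx' with rfl | rfl
      · rfl
      · exact y.2.symm
  have hsingle : ∀ y, s y false = s y true → ∀ b b', (D.legTree s).dbl.joined S (y, b) (y, b') := by
    intro y hy b b'
    have h1 : (D.legTree s).dbl.joined S (y, false) (y, true) :=
      joined_of_ends (G := (D.legTree s).dbl.toWGraph) (e := Sum.inr (Sum.inr (Sum.inr ⟨y, hy⟩)))
        (show J _ = none from rfl) rfl
    cases b <;> cases b'
    · exact Setoid.refl' _ _
    · exact h1
    · exact Setoid.symm' _ h1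
    · exact Setoid.refl' _ _
  have hw : ∀ v, (T.w v : ℤ) - 1 = push f (fun x => (((D.legTree s).dbl.w x : ℕ) : ℤ) - 1) v +
      push t (S.indicator 1) v := weight_eq hs copy
  have hf : Function.Surjective f := fun v => by
    obtain ⟨b, hb⟩ := (hs (D.p v)).2 v rfl
    exact ⟨(D.p v, b), hb⟩
  have hj : ∀ x y, f x = f y → (D.legTree s).dbl.joined S x y := by
    rintro ⟨y, b⟩ ⟨y', b'⟩ h
    have h1 : y = y' := by
      have := congrArg D.p h
      rwa [(hs y).1, (hs y').1] at this
    subst h1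
    by_cases hb : b = b'
    · subst hb; exact Setoid.refl' _ _
    · refine hsingle y ?_ b b'
      have h2 : s y b = s y b' := h
      cases b <;> cases b'
      · exact absurd rfl hb
      · exact h2
      · exact h2.symm
      · exact absurd rfl hb
  have hinc : Function.Injective i := fun a a' h => by
    have := (hi a).symm.trans ((congrArg J h).trans (hi a'))
    exact Option.some.inj this
  have hr : ∀ d, d ∈ range i ↔ d ∉ S := by
    intro d
    constructor
    · rintro ⟨a, rfl⟩ h
      have := (hi a).symm.trans h
      cases this
    · intro h
      obtain ⟨a, ha⟩ := Option.ne_none_iff_exists'.1 h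
      exact ⟨a, hJinj _ _ a (hi a) ha⟩
  have hrel : ∀ a a', T.rel a a' ↔ (D.legTree s).dbl.rel (i a) (i a') := by
    intro a a'
    rw [D.rel]
    constructor
    · rintro (rfl | ⟨h1, h2⟩)
      · exact Setoid.refl' _ _
      · obtain ⟨x, rfl⟩ := hsurj a h2
        obtain ⟨x', rfl⟩ := hsurj a' (h1 ▸ h2)
        rw [hJinj _ (Sum.inl x) _ (hi _) rfl, hJinj _ (Sum.inl x') _ (hi _) rfl]
        rw [hmap, hmap] at h1
        exact congrArg Sum.inl (Subtype.ext h1)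
    · intro h
      have h' : Sum.map Prod.fst id (i a) = Sum.map Prod.fst id (i a') := h
      rcases hd : i a with x | l <;> rcases hd' : i a' with x' | l' <;> rw [hd, hd'] at h'
      · right
        have h1 : x.1 = x'.1 := Sum.inl.inj h'
        have h2 := hi a
        have h3 := hi a'
        rw [hd] at h2
        rw [hd'] at h3
        obtain rfl : copy x = a := Option.some.inj h2
        obtain rfl : copy x' = a' := Option.some.inj h3
        rw [hmap, hmap, h1]
        exact ⟨rfl, x'.1.2⟩
      · cases h'
      · cases h'
      · left
        obtain rfl : l = l' := Sum.inr.inj h'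
        exact hinc (hd.trans hd'.symm)
  exact ⟨⟨S, hsat, _, Contr.ofIncl_compat (G := (D.legTree s).dbl) (T := T) f hf t hS hj i hinc hr
    (fun a => hJ _ _ (hi a)) hw hrel⟩, S, Contr.ofIncl (G := (D.legTree s).dbl.toWGraph) f hf t hS hj i
      hinc hr (fun a => hJ _ _ (hi a)) hw, fun x => rfl⟩

/-- Stability of the type makes the tree with legs stable: the canonical divisor of the type is the
push-forward of that of the generalised ladder, which has the same sign on the whole fibre over `y`. -/
theorem three_le_val (hs : ∀ y, D.IsFibre y (s y)) (hT : T.IsType) (hg : 2 ≤ T.genus)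
    {S : Set (D.legTree s).dbl.E} (k : Contr (D.legTree s).dbl.toWGraph T.toWGraph S)
    (hk : ∀ x, k.onV x = s x.1 x.2) (y : D.W) : 3 ≤ (D.legTree s).val y := by
  classical
  by_contra hlt
  have h1 := k.canon_eq (s y false)
  have h2 : push k.onV (D.legTree s).dbl.canon (s y false) ≤ 0 := by
    have h3 : push k.onV (D.legTree s).dbl.canon (s y false) =
        push k.onV (fun x => if x.1 = y then (D.legTree s).dbl.canon x else 0) (s y false) := by
      let _ := Fintype.ofFinite (D.legTree s).dbl.V
      rw [push_eq_sum, push_eq_sum]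
      refine Finset.sum_congr rfl fun x _ => ?_
      by_cases h4 : k.onV x = s y false
      · have h5 : x.1 = y := by
          rw [hk] at h4
          exact ((hs _).1 _).symm.trans ((congrArg D.p h4).trans ((hs _).1 _))
        rw [if_pos h5]
      · rw [if_neg h4, if_neg h4]
    rw [h3]
    have h4 : 0 ≤ push k.onV (fun x => -1 * if x.1 = y then (D.legTree s).dbl.canon x else 0)
        (s y false) := by
      refine push_nonneg fun x => ?_
      split_ifs with hx
      · have h5 := (D.legTree s).canon_dbl x
        have h6 : ((D.legTree s).val x.1 : ℤ) < 3 := by rw [hx]; exact_mod_cast not_le.1 hlt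
        linarith
      · simp
    rw [push_mul_left] at h4
    linarith
  have h3 : T.canon (s y false) ≤ 0 := h1.trans_le h2
  have h4 : (T.valence (s y false) : ℤ) + 2 * ((T.w (s y false) : ℤ) - 1) ≤ 0 := h3
  have h5 := hT.2 (s y false)
  have h6 : T.w (s y false) = 1 ∧ T.valence (s y false) = 0 := by
    rcases Nat.lt_or_ge (T.w (s y false)) 1 with h | h
    · have := h5 (by omega)
      omega
    · omega
  -- a vertex of valence zero is the whole graph
  have hval : ∀ e, s y false ∉ T.ends e := by
    intro e he
    have h7 := h6.2
    unfold WGraph.valence at h7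
    have h8 : Nat.card {e // s y false ∈ T.ends e} = 0 := by omega
    rw [Nat.card_eq_zero] at h8
    rcases h8 with h8 | h8
    · exact h8.elim ⟨e, he⟩
    · exact not_finite {e // s y false ∈ T.ends e}
  have hall : ∀ x, x = s y false := by
    intro x
    have := joined_le (G := T.toWGraph) (S := univ)
      (Setoid.ker fun x => x = s y false) (fun e _ u u' he => ?_) (hT.1.2 (s y false) x)
    · have h7 : (s y false = s y false) = (x = s y false) := this
      exact h7.mp rfl
    · have hu : u ≠ s y false := fun h => hval e (by rw [he, ← h]; exact Sym2.mem_mk_left _ _)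
      have hu' : u' ≠ s y false := fun h => hval e (by rw [he, ← h]; exact Sym2.mem_mk_right _ _)
      exact propext ⟨fun h => absurd h hu, fun h => absurd h hu'⟩
  have hE : IsEmpty T.E := ⟨fun e => hval e (hall (T.tail e) ▸ T.tail_mem e)⟩
  have hV : Unique T.V := ⟨⟨s y false⟩, hall⟩
  have hgen : T.genus = 1 := by
    unfold WGraph.genus
    rw [finsum_unique]
    have h7 : T.w default = 1 := (congrArg T.w (hall _)).trans h6.1
    rw [h7]
    simp
  omega

end HypDatum

/-- Every hyperelliptic type is a specialisation of the generalised ladder of a cubic tree with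
legs. -/
theorem CGraph.IsHyp.exists_spec {T : CGraph} (hT : T.IsType) (hh : T.IsHyp) (hg : 2 ≤ T.genus) :
    ∃ R : LegTree, (∀ y, R.val y = 3) ∧ (Nat.card R.L : ℤ) = T.genus + 1 ∧ T.Spec R.dbl := by
  obtain ⟨D⟩ := hh.hypDatum
  obtain ⟨s, hs, hm⟩ := D.exists_section
  obtain ⟨h1, S, k, hk⟩ := HypDatum.spec_dbl hs hm
  obtain ⟨R', h3, hc, h2⟩ := (D.legTree s).exists_resolution
    (HypDatum.three_le_val hs hT hg k hk)
  refine ⟨R', h3, ?_, h1.trans h2⟩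
  rw [hc]
  have h4 := k.genus_eq
  have h5 := (D.legTree s).genus_dbl
  have h6 : T.genus = (D.legTree s).dbl.genus := h4
  omega

/-! ### Specialisations of hyperelliptic types -/

/-- A tree with `g + 1` legs and all valences three, of which the type is a specialisation. -/
theorem HypType.exists_resolution {g : ℕ} (hg : 2 ≤ g) (T : HypType g) :
    ∃ R : LegTree, (∀ y, R.val y = 3) ∧ Nat.card R.L = g + 1 ∧ T.1.Spec R.dbl := by
  obtain ⟨R, h3, hc, hs⟩ := T.2.2.1.exists_spec T.2.1 (by rw [T.2.2.2]; exact_mod_cast hg)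
  rw [T.2.2.2] at hc
  exact ⟨R, h3, by exact_mod_cast hc, hs⟩

/-- Specialisations of generalised ladders are isomorphic to hyperelliptic types. -/
theorem LegTree.exists_hypType {g : ℕ} (hg : 2 ≤ g) {R : LegTree} (h3 : ∀ y, 3 ≤ R.val y)
    (hL : Nat.card R.L = g + 1) {U : CGraph} (h : U.Spec R.dbl) : ∃ V : HypType g, U.Isom V.1 := by
  obtain ⟨S, hS, hU⟩ := h.exists_isom
  obtain ⟨h1, h2, h4⟩ := R.contract_isHyp hS h3 (by omega)
  refine ⟨⟨R.dbl.contract S, h1, h2, h4.trans ?_⟩, hU⟩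
  rw [hL]
  push_cast
  ring

/-- A specialisation of a hyperelliptic type is isomorphic to a hyperelliptic type. -/
theorem HypType.exists_of_spec {g : ℕ} (hg : 2 ≤ g) (T : HypType g) {U : CGraph} (h : U.Spec T.1) :
    ∃ V : HypType g, U.Isom V.1 := by
  obtain ⟨R, h3, hL, hs⟩ := T.exists_resolution hg
  exact R.exists_hypType hg (fun y => (h3 y).ge) hL (h.trans hs)

/-- Distinct edges of a hyperelliptic type are related if and only if their removal disconnects the
graph. Thus the relation is determined by the graph. -/
theorem HypType.rel_iff {g : ℕ} (hg : 2 ≤ g) (T : HypType g) (a a' : T.1.E) :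
    T.1.rel a a' ↔ a = a' ∨ ¬ ∀ x y, T.1.joined {a, a'}ᶜ x y := by
  obtain ⟨R, h3, -, S, -, c, hc⟩ := T.exists_resolution hg
  obtain ⟨e, rfl⟩ := c.onE.surjective a
  obtain ⟨e', rfl⟩ := c.onE.surjective a'
  rw [hc, c.joined_compl_pair_iff, c.onE.injective.eq_iff,
    R.dbl_joined_compl_iff (fun y => (h3 y).ge), Subtype.ext_iff]
  constructor
  · intro h
    by_cases h' : e.1 = e'.1
    · exact Or.inl h'
    · exact Or.inr fun h2 => h2.elim h' fun h4 => h4 h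
  · rintro (h | h)
    · rw [h]
    · push Not at h
      exact h.2

/-- Isomorphisms of the graphs of hyperelliptic types respect the relations. -/
theorem HypType.compat {g : ℕ} (hg : 2 ≤ g) {T U : HypType g}
    (f : WIso T.1.toWGraph U.1.toWGraph) : f.Compat := by
  intro e e'
  rw [T.rel_iff hg, U.rel_iff hg, f.onE.apply_eq_iff_eq]
  refine or_congr_right (not_congr ?_)
  have h := f.joined_iff (S := {e, e'}ᶜ) (S' := {f.onE e, f.onE e'}ᶜ) (by simp)
  refine ⟨fun h1 x y => ?_, fun h1 x y => (h x y).2 (h1 _ _)⟩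
  obtain ⟨x, rfl⟩ := f.onV.surjective x
  obtain ⟨y, rfl⟩ := f.onV.surjective y
  exact (h x y).1 (h1 _ _)

/-! ### Cubic trees with legs and ladders -/

namespace LegTree

variable (R : LegTree)

/-- The underlying tree as a simple graph. -/
abbrev graph : SimpleGraph R.W := SimpleGraph.fromEdgeSet (range R.base.ends)

theorem graph_isTree : R.graph.IsTree := (R.conn.isTree (G := R.base) R.card).1

theorem ends_injective : Function.Injective R.base.ends := (R.conn.isTree (G := R.base) R.card).2.1

theorem ends_not_isDiag (e : R.E) : ¬ (R.base.ends e).IsDiag :=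
  (R.conn.isTree (G := R.base) R.card).2.2 e

/-- The half-edges at a vertex correspond to its neighbours in the tree. -/
theorem val_eq_add (v : R.W) :
    R.val v = (R.graph.neighborSet v).ncard + Nat.card {l // R.leg l = v} := by
  have h1 : R.val v = Nat.card {h // R.root h = v} + Nat.card {l // R.leg l = v} := by
    rw [← Nat.card_sum]
    exact Nat.card_congr (Equiv.subtypeSum (p := fun h => Sum.elim R.root R.leg h = v))
  rw [h1]
  congr 1
  have hends : ∀ h : R.E × Bool, R.base.ends h.1 = s(R.root h, R.root (h.1, !h.2)) := by
    rintro ⟨e, b⟩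
    cases b
    · rfl
    · exact Sym2.eq_swap
  have hadj : ∀ h : R.E × Bool, R.graph.Adj (R.root h) (R.root (h.1, !h.2)) := fun h => by
    rw [SimpleGraph.fromEdgeSet_adj, ← hends]
    refine ⟨mem_range_self _, fun h' => R.ends_not_isDiag h.1 ?_⟩
    rw [hends]
    exact h'
  rw [← Nat.card_coe_set_eq]
  refine Nat.card_congr (Equiv.ofBijective (fun h => ⟨R.root (h.1.1, !h.1.2), ?_⟩) ⟨?_, ?_⟩)
  · have := hadj h.1
    rwa [h.2] at this
  · rintro ⟨⟨e, b⟩, h⟩ ⟨⟨e', b'⟩, h'⟩ hh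
    have h2 : R.root (e, !b) = R.root (e', !b') := congrArg Subtype.val hh
    have h3 : e = e' := R.ends_injective (by
      rw [hends (e, b), hends (e', b'), h, h', h2])
    subst h3
    have h4 := (hadj (e, b)).ne
    refine Subtype.ext (Prod.ext rfl ?_)
    by_contra hne
    have h5 : b' = !b := by
      change ¬ b = b' at hne
      cases b <;> cases b' <;> simp_all
    subst h5
    exact h4 (h.trans h'.symm)
  · rintro ⟨w, hw⟩
    rw [SimpleGraph.mem_neighborSet, SimpleGraph.fromEdgeSet_adj] at hw
    obtain ⟨⟨e, he⟩, -⟩ := hw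
    rcases Sym2.eq_iff.1 he with ⟨h2, h3⟩ | ⟨h2, h3⟩
    · exact ⟨⟨(e, false), h2⟩, Subtype.ext h3⟩
    · exact ⟨⟨(e, true), h3⟩, Subtype.ext h2⟩

end LegTree

theorem one_le_ncard_neighborSet {W : Type} [Finite W] {T : SimpleGraph W} (hT : T.Connected)
    (hW : 2 ≤ Nat.card W) (v : W) : 1 ≤ (T.neighborSet v).ncard := by
  have : Nontrivial W := Finite.one_lt_card_iff_nontrivial.1 hW
  obtain ⟨w, hw⟩ := hT.preconnected.exists_adj_of_nontrivial v
  rw [Nat.one_le_iff_ne_zero, Ne, Set.ncard_eq_zero]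
  exact Set.Nonempty.ne_empty ⟨w, hw⟩

/-- In a tree with valences between one and three, the rungs complete the valences to three. -/
theorem ncard_add_rungs {W : Type} {T : SimpleGraph W} {v : W} (h1 : 1 ≤ (T.neighborSet v).ncard)
    (h3 : (T.neighborSet v).ncard ≤ 3) : (T.neighborSet v).ncard + rungs T v = 3 := by
  unfold rungs
  split_ifs <;> omega

theorem Sym2.map_mk_out {V W : Type*} (f : V → W) (z : Sym2 V) :
    z.map f = s(f (Quot.out z).1, f (Quot.out z).2) := by
  conv_lhs => rw [← Quot.out_eq z]
  rfl

/-- Isomorphic trees have isomorphic ladders. -/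
theorem ladder_isom {W W' : Type} [Finite W] [Finite W'] {S : SimpleGraph W} {T : SimpleGraph W'}
    (f : S ≃g T) : (ladder S).Isom (ladder T) := by
  have hr : ∀ v, rungs S v = rungs T (f v) := by
    intro v
    have h : (T.neighborSet (f v)).ncard = (S.neighborSet v).ncard := by
      rw [← Nat.card_coe_set_eq, ← Nat.card_coe_set_eq]
      exact Nat.card_congr (f.mapNeighborSet v).symm
    unfold rungs
    rw [h]
  let j : (Σ v, Fin (rungs S v)) ≃ Σ v, Fin (rungs T v) :=
    Equiv.sigmaCongr (β₂ := fun v => Fin (rungs T v)) f.toEquiv fun v => finCongr (hr v)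
  refine ⟨{
    onV := f.toEquiv.prodCongr (Equiv.refl Bool)
    onE := Equiv.sumCongr (f.mapEdgeSet.prodCongr (Equiv.refl Bool)) j
    ends_eq := ?_
    w_eq := fun _ => rfl }, ?_⟩
  · rintro (⟨⟨t, ht⟩, b⟩ | p)
    · induction t using Sym2.inductionOn with
      | hf x y => rfl
    · rfl
  · have h : ∀ e, Sum.map Prod.fst id (Equiv.sumCongr (f.mapEdgeSet.prodCongr (Equiv.refl Bool)) j e) =
        Equiv.sumCongr f.mapEdgeSet j (Sum.map Prod.fst id e) := by
      rintro (x | p) <;> rfl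
    intro e e'
    change Sum.map Prod.fst id e = Sum.map Prod.fst id e' ↔ Sum.map Prod.fst id _ = Sum.map Prod.fst id _
    refine Iff.trans ?_ (iff_of_eq (congrArg₂ _ (h e) (h e'))).symm
    rw [EmbeddingLike.apply_eq_iff_eq]

/-- The generalised ladder of a cubic tree with legs is the ladder of the underlying tree. -/
theorem LegTree.dbl_isom_ladder (R : LegTree) (h3 : ∀ y, R.val y = 3) (h2 : 2 ≤ Nat.card R.W) :
    R.dbl.Isom (ladder R.graph) := by
  have hleg : ∀ v, Nat.card {l // R.leg l = v} = rungs R.graph v := by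
    intro v
    have h4 := one_le_ncard_neighborSet R.graph_isTree.connected h2 v
    have h5 := R.val_eq_add v
    have h6 := h3 v
    have := ncard_add_rungs h4 (by omega)
    omega
  let i : R.E ≃ R.graph.edgeSet := Equiv.ofBijective
    (fun e => ⟨R.base.ends e, by
      rw [SimpleGraph.edgeSet_fromEdgeSet]; exact ⟨mem_range_self e, R.ends_not_isDiag e⟩⟩)
    ⟨fun e e' h => R.ends_injective (congrArg Subtype.val h), fun t => by
      obtain ⟨⟨e, he⟩, -⟩ := (SimpleGraph.edgeSet_fromEdgeSet (range R.base.ends)).le t.2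
      exact ⟨e, Subtype.ext he⟩⟩
  let j : R.L ≃ Σ v, Fin (rungs R.graph v) := (Equiv.sigmaFiberEquiv R.leg).symm.trans
    (Equiv.sigmaCongrRight fun v => Finite.equivFinOfCardEq (hleg v))
  refine ⟨{
    onV := Equiv.refl _
    onE := Equiv.sumCongr (i.prodCongr (Equiv.refl Bool)) j
    ends_eq := ?_
    w_eq := fun _ => rfl }, ?_⟩
  · rintro (⟨t, b⟩ | l)
    · rfl
    · rfl
  · have h : ∀ e, Sum.map Prod.fst id (Equiv.sumCongr (i.prodCongr (Equiv.refl Bool)) j e) =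
        Equiv.sumCongr i j (Sum.map Prod.fst id e) := by
      rintro (x | p) <;> rfl
    intro e e'
    change Sum.map Prod.fst id e = Sum.map Prod.fst id e' ↔ Sum.map Prod.fst id _ = Sum.map Prod.fst id _
    refine Iff.trans ?_ (iff_of_eq (congrArg₂ _ (h e) (h e'))).symm
    rw [EmbeddingLike.apply_eq_iff_eq]

/-- A ladder is a generalised ladder. -/
theorem exists_ladder_isom_dbl {W : Type} [Finite W] {T : SimpleGraph W} (hT : T.IsTree)
    (h3 : ∀ v, (T.neighborSet v).ncard ≤ 3) (h2 : 2 ≤ Nat.card W) :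
    ∃ R : LegTree, (∀ y, R.val y = 3) ∧ Nat.card R.W = Nat.card W ∧ (ladder T).Isom R.dbl := by
  have hends : ∀ t : T.edgeSet, s((Quot.out t.1).1, (Quot.out t.1).2) = t.1 := fun t => Quot.out_eq t.1
  let R : LegTree :=
    { W := W
      E := T.edgeSet
      L := Σ v, Fin (rungs T v)
      finW := inferInstance
      finE := inferInstance
      finL := inferInstance
      root := fun h => bif h.2 then (Quot.out h.1.1).2 else (Quot.out h.1.1).1
      leg := fun l => l.1
      conn := by
        refine ⟨hT.connected.nonempty, fun y y' => ?_⟩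
        have hr := hT.connected y y'
        rw [SimpleGraph.reachable_iff_reflTransGen] at hr
        induction hr with
        | refl => exact Setoid.refl' _ _
        | tail _ h ih =>
          refine Setoid.trans' _ ih (joined_of_ends (e := (⟨s(_, _), h⟩ : T.edgeSet)) (mem_univ _) ?_)
          exact hends ⟨s(_, _), h⟩
      card := (SimpleGraph.isTree_iff_connected_and_card.1 hT).2 }
  have hgraph : R.graph = T := by
    rw [← SimpleGraph.fromEdgeSet_edgeSet T]
    refine congrArg SimpleGraph.fromEdgeSet ?_
    ext z
    constructor
    · rintro ⟨t, rfl⟩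
      exact Set.mem_of_eq_of_mem (hends t) t.2
    · exact fun hz => ⟨⟨z, hz⟩, hends ⟨z, hz⟩⟩
  refine ⟨R, fun y => ?_, rfl, ⟨{
    onV := Equiv.refl _
    onE := Equiv.refl _
    ends_eq := ?_
    w_eq := fun _ => rfl }, fun _ _ => Iff.rfl⟩⟩
  · rw [R.val_eq_add, hgraph, ← ncard_add_rungs (one_le_ncard_neighborSet hT.connected h2 y) (h3 y)]
    congr 1
    have h4 : Nat.card {l : Σ v, Fin (rungs T v) // l.1 = y} = rungs T y := by
      rw [Nat.card_congr (Equiv.sigmaSubtype y), Nat.card_eq_fintype_card, Fintype.card_fin]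
    exact h4
  · rintro (⟨t, b⟩ | p)
    · have h4 : t.1.map (fun v => (v, b)) = s(((Quot.out t.1).1, b), ((Quot.out t.1).2, b)) :=
        Sym2.map_mk_out _ _
      refine h4.symm.trans ?_
      exact (Sym2.map_id' ▸ rfl)
    · rfl

/-- Two vertices of a ladder lie over the same vertex of the tree if and only if every edge at one of
them is related to an edge at the other one. -/
theorem ladder_fst_eq_iff {W : Type} [Finite W] {T : SimpleGraph W} (hT : T.Connected)
    (h2 : 2 ≤ Nat.card W) (x y : W × Bool) : x.1 = y.1 ↔
      ∀ a, x ∈ (ladder T).ends a → ∃ a', y ∈ (ladder T).ends a' ∧ (ladder T).rel a a' := by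
  obtain ⟨c, b⟩ := x
  obtain ⟨d, b'⟩ := y
  constructor
  · rintro h a ha
    obtain rfl : c = d := h
    rcases a with ⟨t, b₀⟩ | p
    · obtain ⟨v, hv, hvc⟩ := Sym2.mem_map.1 ha
      obtain ⟨rfl, rfl⟩ := Prod.mk.inj hvc
      exact ⟨Sum.inl (t, b'), Sym2.mem_map.2 ⟨v, hv, rfl⟩, rfl⟩
    · refine ⟨Sum.inr p, ?_, rfl⟩
      have h1 : (c, b) ∈ s((p.1, false), (p.1, true)) := ha
      have h3 : c = p.1 := by
        rcases Sym2.mem_iff.1 h1 with h | h <;> exact (Prod.mk.inj h).1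
      change (c, b') ∈ s((p.1, false), (p.1, true))
      rw [h3]
      cases b' <;> simp
  · intro h
    have hedge : ∀ w, T.Adj c w → d = c ∨ d = w := by
      intro w hw
      obtain ⟨a', ha', hr⟩ := h (Sum.inl (⟨s(c, w), hw⟩, b)) (Sym2.mem_map.2 ⟨c, Sym2.mem_mk_left _ _, rfl⟩)
      have hr' : Sum.map Prod.fst id (Sum.inl (⟨s(c, w), hw⟩, b)) = Sum.map Prod.fst id a' := hr
      rcases a' with ⟨t, b₀⟩ | p
      · have h3 : (⟨s(c, w), hw⟩ : T.edgeSet) = t := Sum.inl.inj hr'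
        subst h3
        have h5 : (d, b') ∈ s(c, w).map fun v => (v, b₀) := ha'
        obtain ⟨v, hv, hvd⟩ := Sym2.mem_map.1 h5
        have h4 : v = d := (Prod.mk.inj hvd).1
        subst h4
        exact Sym2.mem_iff.1 hv
      · cases hr'
    by_cases hr : 0 < rungs T c
    · obtain ⟨a', ha', hr'⟩ := h (Sum.inr ⟨c, ⟨0, hr⟩⟩) (by
        change (c, b) ∈ s((c, false), (c, true))
        cases b <;> simp)
      have hr'' : Sum.map Prod.fst id (Sum.inr ⟨c, ⟨0, hr⟩⟩) = Sum.map Prod.fst id a' := hr'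
      rcases a' with x | p
      · cases hr''
      · have h3 : ⟨c, ⟨0, hr⟩⟩ = p := Sum.inr.inj hr''
        subst h3
        have h1 : (d, b') ∈ s((c, false), (c, true)) := ha'
        rcases Sym2.mem_iff.1 h1 with h | h <;> exact (Prod.mk.inj h).1.symm
    · have h1 := one_le_ncard_neighborSet hT h2 c
      have h4 : 1 < (T.neighborSet c).ncard := by
        unfold rungs at hr
        split_ifs at hr <;> omega
      obtain ⟨w, w', hw, hw', hne⟩ := (Set.one_lt_ncard_iff (Set.toFinite _)).1 h4
      rcases hedge w hw with h | rfl
      · exact h.symm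
      · rcases hedge w' hw' with h | h
        · exact h.symm
        · exact absurd h hne

/-- A tree can be recovered from its ladder. -/
theorem nonempty_iso_of_ladder_isom {W W' : Type} [Finite W] [Finite W'] {T : SimpleGraph W}
    {T' : SimpleGraph W'} (hT : T.Connected) (h2 : 2 ≤ Nat.card W) (hT' : T'.Connected)
    (h2' : 2 ≤ Nat.card W') (h : (ladder T).Isom (ladder T')) : Nonempty (T ≃g T') := by
  obtain ⟨f, hf⟩ := h
  have hmem : ∀ x a, x ∈ (ladder T).ends a ↔ f.onV x ∈ (ladder T').ends (f.onE a) := by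
    intro x a
    rw [f.ends_eq, Sym2.mem_map]
    exact ⟨fun h => ⟨x, h, rfl⟩, fun ⟨y, hy, hxy⟩ => f.onV.injective hxy ▸ hy⟩
  have hfib : ∀ x y : W × Bool, x.1 = y.1 ↔ (f.onV x : W' × Bool).1 = (f.onV y : W' × Bool).1 := by
    intro x y
    refine (ladder_fst_eq_iff hT h2 x y).trans
      (Iff.trans ?_ (ladder_fst_eq_iff hT' h2' (f.onV x) (f.onV y)).symm)
    exact Equiv.forall_congr f.onE fun a => imp_congr (hmem x a)
      (Equiv.exists_congr f.onE fun a' => and_congr (hmem y a') (hf a a'))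
  have hbij : Function.Bijective fun c : W => (f.onV (c, false) : W' × Bool).1 := by
    constructor
    · exact fun c d h => (hfib (c, false) (d, false)).2 h
    · intro c'
      obtain ⟨x, hx⟩ := f.onV.surjective ((c', false) : W' × Bool)
      refine ⟨x.1, ?_⟩
      have := (hfib (x.1, false) x).1 rfl
      exact this.trans (congrArg Prod.fst hx)
  -- adjacency in the tree can be read off from the ladder and its projection
  have hadj : ∀ {W : Type} [Finite W] (T : SimpleGraph W) (c d : W), T.Adj c d ↔
      c ≠ d ∧ ∃ (a : (ladder T).E) (x y : W × Bool), (ladder T).ends a = s(x, y) ∧ x.1 = c ∧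
        y.1 = d := by
    intro W _ T c d
    constructor
    · exact fun h => ⟨h.ne, Sum.inl (⟨s(c, d), h⟩, false), (c, false), (d, false), rfl, rfl, rfl⟩
    · rintro ⟨hne, ⟨t, b⟩ | p, x, y, hxy, rfl, rfl⟩
      · have h1 : t.1.map (fun v => (v, b)) = s(x, y) := hxy
        have h3 := congrArg (Sym2.map Prod.fst) h1
        rw [Sym2.map_map] at h3
        have h4 : t.1 = s(x.1, y.1) := (congrFun Sym2.map_id t.1).symm.trans h3
        rw [← SimpleGraph.mem_edgeSet, ← h4]
        exact t.2
      · have h1 : s((p.1, false), (p.1, true)) = s(x, y) := hxy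
        rcases Sym2.eq_iff.1 h1 with ⟨h3, h4⟩ | ⟨h3, h4⟩
        · rw [← h3, ← h4] at hne; exact absurd rfl hne
        · rw [← h3, ← h4] at hne; exact absurd rfl hne
  refine ⟨⟨Equiv.ofBijective _ hbij, fun {c d} => ?_⟩⟩
  rw [hadj, hadj]
  refine and_congr (not_congr (Equiv.apply_eq_iff_eq _)) ?_
  refine (Equiv.exists_congr f.onE fun a => Equiv.exists_congr f.onV fun x =>
    Equiv.exists_congr f.onV fun y => and_congr ?_ (and_congr ?_ ?_)).symm
  · rw [f.ends_eq]
    exact ((Sym2.map.injective f.onV.injective).eq_iff (b := s(x, y))).symm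
  · exact hfib x (c, false)
  · exact hfib y (d, false)

/-! ### Coordinates and contractions -/

/-- Contracting edges of length zero does not change the reduced graph. -/
theorem LenGraph.reduce_isom_of_contr {A B : LenGraph} {S : Set A.E}
    (c : Contr A.toWGraph B.toWGraph S) (hS : ∀ e ∈ S, A.len e = 0)
    (hlen : ∀ e, B.len (c.onE e) = A.len e.1) : A.reduce.Isom B.reduce := by
  have hpre : {e | A.len e = 0} = c.preE {e | B.len e = 0} := by
    ext e
    by_cases he : e ∈ S
    · exact iff_of_true (hS e he) (c.subset_preE _ he)
    · rw [c.mem_preE_iff he]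
      change _ ↔ B.len _ = 0
      rw [hlen]
      rfl
  refine ⟨(A.toWGraph.toContract {e | A.len e = 0}).uniq
    (c.comp (B.toWGraph.toContract {e | B.len e = 0}) hpre), fun (e : {e // A.len e ≠ 0}) => ?_⟩
  have h := (A.toWGraph.toContract {e | A.len e = 0}).uniq_onE
    (c.comp (B.toWGraph.toContract {e | B.len e = 0}) hpre) e
  exact (congrArg B.reduce.len h).trans (hlen _)

namespace Contr

variable {G T : CGraph} {S : Set G.E} {c : Contr G.toWGraph T.toWGraph S}

/-- The coordinates of a contraction, as coordinates of the contracted graph. -/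
def coordMap (hc : c.Compat) : T.Coord → G.Coord :=
  Quotient.map (fun a => (c.onE.symm a).1) fun a a' h => by
    have := hc (c.onE.symm a) (c.onE.symm a')
    rw [c.onE.apply_symm_apply, c.onE.apply_symm_apply] at this
    exact this.1 h

theorem coordMap_mk (hc : c.Compat) (e : {e // e ∉ S}) :
    coordMap hc (Quotient.mk _ (c.onE e)) = Quotient.mk _ e.1 := by
  change Quotient.mk _ (c.onE.symm (c.onE e)).1 = _
  rw [c.onE.symm_apply_apply]

theorem coordMap_injective (hc : c.Compat) : Function.Injective (coordMap hc) := by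
  intro q q' h
  induction q using Quotient.inductionOn with
  | h a =>
    induction q' using Quotient.inductionOn with
    | h a' =>
      obtain ⟨e, rfl⟩ := c.onE.surjective a
      obtain ⟨e', rfl⟩ := c.onE.surjective a'
      rw [coordMap_mk, coordMap_mk] at h
      exact Quotient.sound ((hc e e').2 (Quotient.exact h))

theorem mem_range_coordMap (hc : c.Compat) (hS : G.Saturated S) (e : G.E) :
    Quotient.mk _ e ∈ range (coordMap hc) ↔ e ∉ S := by
  constructor
  · rintro ⟨q, hq⟩ he
    induction q using Quotient.inductionOn with
    | h a =>
      obtain ⟨e', rfl⟩ := c.onE.surjective a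
      rw [coordMap_mk] at hq
      exact e'.2 (hS _ _ (G.rel.symm' (Quotient.exact hq)) he)
  · exact fun he => ⟨_, coordMap_mk hc ⟨e, he⟩⟩

/-- A point whose contracted edges have length zero is equivalent to a point of the contraction. -/
theorem reduce_isom (hc : c.Compat) {x : G.Coord → ℝ} (hx : ∀ e ∈ S, x (Quotient.mk _ e) = 0) :
    (G.withLen x).reduce.Isom (T.withLen (x ∘ coordMap hc)).reduce :=
  LenGraph.reduce_isom_of_contr (A := G.withLen x) (B := T.withLen (x ∘ coordMap hc)) c hx
    fun e => congrArg x (coordMap_mk hc e)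

end Contr

/-- Contractions of nothing are isomorphisms. -/
theorem exists_iso_of_contract_iso {A B : WGraph} {S : Set A.E} {S' : Set B.E} (hS : S = ∅)
    (hS' : S' = ∅) (θ : WIso (A.contract S) (B.contract S')) :
    ∃ f : WIso A B, ∀ e h, f.onE e = (θ.onE (⟨e, h⟩ : {e // e ∉ S}) : {e // e ∉ S'}).1 := by
  subst hS hS'
  have h1 := (Contr.ofIso (WIso.refl A)).uniq_onE (A.toContract ∅)
  have h2 := (B.toContract ∅).uniq_onE (Contr.ofIso (WIso.refl B))
  refine ⟨(((Contr.ofIso (WIso.refl A)).uniq (A.toContract ∅)).trans θ).trans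
    ((B.toContract ∅).uniq (Contr.ofIso (WIso.refl B))), fun e h => ?_⟩
  have h3 := h1 ⟨e, h⟩
  have h4 := h2 (θ.onE (⟨e, h⟩ : {e // e ∉ (∅ : Set A.E)}))
  exact (congrArg (fun a => ((B.toContract ∅).uniq (Contr.ofIso (WIso.refl B))).onE (θ.onE a)) h3).trans
    h4

/-- The edges of length zero form a union of classes. -/
theorem CGraph.saturated_zero (G : CGraph) (x : G.Coord → ℝ) :
    G.Saturated {e | x (Quotient.mk _ e) = 0} := by
  intro e e' h he
  have : (Quotient.mk G.rel e) = Quotient.mk G.rel e' := Quotient.sound h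
  exact (congrArg x this).symm.trans he

/-- Isomorphisms between specialisations of hyperelliptic types respect the relations. -/
theorem HypType.compat_of_spec {g : ℕ} (hg : 2 ≤ g) {T U : HypType g} {A B : CGraph}
    (hA : A.Spec T.1) (hB : B.Spec U.1) (f : WIso A.toWGraph B.toWGraph) : f.Compat := by
  obtain ⟨V, k, hk⟩ := T.exists_of_spec hg hA
  obtain ⟨V', k', hk'⟩ := U.exists_of_spec hg hB
  have h := HypType.compat hg (T := V) (U := V') ((k.symm.trans f).trans k')
  intro e e'
  rw [hk, hk' (f.onE e), h]
  simp [WIso.trans, WIso.symm]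

/-- If the reduced graphs of two points are isomorphic, then the second type can be contracted to every
graph to which the first type is contracted by the edges of length zero. -/
theorem HypType.exists_contr_of_reduce_isom {g : ℕ} (hg : 2 ≤ g) {T U : HypType g} {A : CGraph}
    {x : T.1.Coord → ℝ} {y : U.1.Coord → ℝ}
    (h : (T.1.withLen x).reduce.Isom (U.1.withLen y).reduce)
    {c : Contr T.1.toWGraph A.toWGraph {e | x (Quotient.mk _ e) = 0}} (hc : c.Compat) :
    ∃ d : Contr U.1.toWGraph A.toWGraph {e | y (Quotient.mk _ e) = 0}, d.Compat := by
  obtain ⟨θ, -⟩ := h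
  have hA : A.Spec T.1 := ⟨_, T.1.saturated_zero x, c, hc⟩
  have hB : (U.1.contract {e | y (Quotient.mk _ e) = 0}).Spec U.1 :=
    U.1.contract_spec (U.1.saturated_zero y)
  let k : WIso (U.1.contract {e | y (Quotient.mk _ e) = 0}).toWGraph A.toWGraph :=
    WIso.trans (B := T.1.toWGraph.contract {e | x (Quotient.mk _ e) = 0})
      (WIso.symm θ) ((T.1.toWGraph.toContract _).uniq c)
  have hk : k.Compat := HypType.compat_of_spec hg hB hA k
  let d₀ : Contr U.1.toWGraph (U.1.contract {e | y (Quotient.mk _ e) = 0}).toWGraph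
    {e | y (Quotient.mk _ e) = 0} := U.1.toWGraph.toContract _
  refine ⟨d₀.comp (Contr.ofIso k) (by ext e; rw [d₀.preE_iff]; simp), fun e e' => ?_⟩
  exact (hk _ _).symm

/-! ### The topology of the space of curves -/

instance (A B : WGraph) : Finite (WIso A B) :=
  Finite.of_injective (fun f : WIso A B => (f.onV, f.onE)) fun f f' h => by
    cases f; cases f'; cases h; rfl

/-- The point of the space of curves with given coordinates. -/
noncomputable def point {g : ℕ} (T : HypType g) (x : T.1.Coord → ℝ) (hx : ∀ q, 0 ≤ x q) : H2tr g :=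
  Quotient.mk (PreSpace.setoid g) ⟨T, x, hx⟩

theorem point_eq_iff {g : ℕ} {T U : HypType g} {x : T.1.Coord → ℝ} {hx : ∀ q, 0 ≤ x q}
    {y : U.1.Coord → ℝ} {hy : ∀ q, 0 ≤ y q} :
    point T x hx = point U y hy ↔ (T.1.withLen x).reduce.Isom (U.1.withLen y).reduce :=
  Quotient.eq

theorem exists_point {g : ℕ} (p : H2tr g) : ∃ T x hx, point T x hx = p := by
  induction p using Quotient.inductionOn with
  | h a => exact ⟨a.1, a.2.1, a.2.2, rfl⟩

/-- The image of a closed subset of a closed orthant is closed. -/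
theorem isClosed_point_image {g : ℕ} (T : HypType g) {K : Set (T.1.Coord → ℝ)} (hK : IsClosed K) :
    IsClosed {p : H2tr g | ∃ x hx, x ∈ K ∧ point T x hx = p} := by
  classical
  refine (isQuotientMap_quotient_mk' (s := PreSpace.setoid g)).isClosed_preimage.1 ?_
  rw [isClosed_sigma_iff]
  intro U
  -- the lengths on `T` that are obtained from lengths on `U` by an isomorphism `θ` of contractions
  let L : ∀ (S : Set T.1.E) (S' : Set U.1.E), WIso (T.1.toWGraph.contract S) (U.1.toWGraph.contract S') →
      (U.1.Coord → ℝ) → T.1.E → ℝ := fun S S' θ y e =>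
    if h : e ∈ S then 0 else
      y (Quotient.mk _ (θ.onE (⟨e, h⟩ : {e // e ∉ S}) : {e // e ∉ S'}).1)
  have hL : ∀ S S' θ e, Continuous fun y => L S S' θ y e := by
    intro S S' θ e
    by_cases h : e ∈ S
    · simp only [L, h, dif_pos]; exact continuous_const
    · simp only [L, h, dif_neg, not_false_eq_true]; exact continuous_apply _
  have hL0 : ∀ S S' θ y e, e ∈ S → L S S' θ y e = 0 := fun _ _ _ _ _ h => dif_pos h
  have hL1 : ∀ S S' θ y e (h : e ∉ S), L S S' θ y e =
      y (Quotient.mk _ (θ.onE (⟨e, h⟩ : {e // e ∉ S}) : {e // e ∉ S'}).1) :=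
    fun _ _ _ _ _ h => dif_neg h
  let Z : ∀ (S : Set T.1.E) (S' : Set U.1.E), WIso (T.1.toWGraph.contract S) (U.1.toWGraph.contract S') →
      Set (U.1.Coord → ℝ) := fun S S' θ =>
    {y | (∀ e ∈ S', y (Quotient.mk _ e) = 0) ∧
      (∀ e, L S S' θ y (Quotient.out (Quotient.mk T.1.rel e)) = L S S' θ y e) ∧
      (fun q => L S S' θ y (Quotient.out q)) ∈ K}
  have hZ : ∀ S S' θ, IsClosed (Z S S' θ) := by
    intro S S' θ
    refine IsClosed.and ?_ (IsClosed.and ?_ ?_)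
    · have : {y : U.1.Coord → ℝ | ∀ e ∈ S', y (Quotient.mk _ e) = 0} =
          ⋂ e ∈ S', {y | y (Quotient.mk _ e) = 0} := by ext; simp
      exact this ▸ isClosed_biInter fun e _ => isClosed_eq
        (continuous_apply (Quotient.mk U.1.rel e)) continuous_const
    · have : {y : U.1.Coord → ℝ | ∀ e, L S S' θ y (Quotient.out (Quotient.mk T.1.rel e)) =
          L S S' θ y e} = ⋂ e, {y | L S S' θ y (Quotient.out (Quotient.mk T.1.rel e)) =
          L S S' θ y e} := by ext; simp
      exact this ▸ isClosed_iInter fun e => isClosed_eq (hL _ _ _ _) (hL _ _ _ _)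
    · exact hK.preimage (continuous_pi fun q => hL _ _ _ _)
  have key : Sigma.mk U ⁻¹' ((Quotient.mk'' : PreSpace g → _) ⁻¹'
      {p : H2tr g | ∃ x hx, x ∈ K ∧ point T x hx = p}) =
      Subtype.val ⁻¹' (⋃ S, ⋃ S', ⋃ θ, Z S S' θ) := by
    ext ⟨y, hy⟩
    simp only [mem_preimage, mem_iUnion]
    constructor
    · rintro ⟨x, hx, hxK, hp⟩
      obtain ⟨θ, hθ⟩ := point_eq_iff.1 (show point T x hx = point U y hy from hp)
      refine ⟨{e | x (Quotient.mk _ e) = 0}, {e | y (Quotient.mk _ e) = 0}, θ, fun e he => he, ?_⟩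
      have h1 : ∀ e, L {e | x (Quotient.mk _ e) = 0} {e | y (Quotient.mk _ e) = 0} θ y e =
          x (Quotient.mk _ e) := by
        intro e
        by_cases h : x (Quotient.mk _ e) = 0
        · exact (hL0 _ _ _ _ _ h).trans h.symm
        · exact (hL1 _ _ _ _ _ h).trans (hθ (⟨e, h⟩ : {e // x (Quotient.mk _ e) ≠ 0}))
      refine ⟨fun e => by rw [h1, h1, Quotient.out_eq], ?_⟩
      have h2 : (fun q => L {e | x (Quotient.mk _ e) = 0} {e | y (Quotient.mk _ e) = 0} θ y
          (Quotient.out q)) = x := by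
        ext q
        rw [h1, Quotient.out_eq]
      exact Set.mem_of_eq_of_mem h2 hxK
    · rintro ⟨S, S', θ, h1, h2, h3⟩
      refine ⟨_, fun q => ?_, h3, ?_⟩
      · by_cases h : Quotient.out q ∈ S
        · exact (hL0 _ _ _ _ _ h).ge
        · exact (hy _).trans (hL1 _ _ _ _ _ h).ge
      · refine point_eq_iff.2 ?_
        let A : LenGraph := T.1.withLen fun q => L S S' θ y (Quotient.out q)
        let B : LenGraph := U.1.withLen y
        let A' : LenGraph := { T.1.toWGraph.contract S with len := fun e => A.len e.1 }
        let B' : LenGraph := { U.1.toWGraph.contract S' with len := fun e => B.len e.1 }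
        have hA : A.reduce.Isom A'.reduce :=
          LenGraph.reduce_isom_of_contr (A := A) (B := A') (T.1.toWGraph.toContract S)
            (fun e he => (h2 e).trans (hL0 _ _ _ _ _ he)) fun e => rfl
        have hB : B.reduce.Isom B'.reduce :=
          LenGraph.reduce_isom_of_contr (A := B) (B := B') (U.1.toWGraph.toContract S') h1 fun e => rfl
        have hAB : A'.Isom B' := ⟨θ, fun (e : {e // e ∉ S}) =>
          ((h2 e.1).trans (hL1 _ _ _ _ _ e.2)).symm⟩
        exact LenGraph.isom_equivalence.trans hA (LenGraph.isom_equivalence.trans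
          (LenGraph.reduce_isom hAB) (LenGraph.isom_equivalence.symm hB))
  have hfin : IsClosed (⋃ S, ⋃ S', ⋃ θ, Z S S' θ) :=
    isClosed_iUnion_of_finite fun S => isClosed_iUnion_of_finite fun S' =>
      isClosed_iUnion_of_finite fun θ => hZ S S' θ
  exact key ▸ hfin.preimage continuous_subtype_val

/-! ### The cells -/

theorem CGraph.closure_orthant (T : CGraph) : closure T.orthant = {x | ∀ q, 0 ≤ x q} := by
  have h : T.orthant = Set.pi univ fun _ => Ioi 0 := by ext; simp [orthant]
  rw [h, closure_pi_set]
  ext x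
  simp [Pi.le_def]

theorem CGraph.mem_closure_orthant {T : CGraph} {x : T.Coord → ℝ} :
    x ∈ closure T.orthant ↔ ∀ q, 0 ≤ x q := by
  rw [T.closure_orthant]; rfl

theorem CGraph.orthant_isRationalOpenCone (T : CGraph) : IsRationalOpenCone T.orthant := by
  constructor
  · let i : Fin (Fintype.card T.Coord) ≃ T.Coord := (Fintype.equivFin _).symm
    refine ⟨_, fun k => Pi.single (i k) 1, ?_⟩
    have hsum : ∀ a : Fin (Fintype.card T.Coord) → ℝ, ∀ k,
        (∑ j, a j • fun q => ((Pi.single (i j) (1 : ℤ) : T.Coord → ℤ) q : ℝ)) (i k) = a k := by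
      intro a k
      rw [Finset.sum_apply, Finset.sum_eq_single k]
      · simp
      · intro j _ hj
        have : i k ≠ i j := fun h => hj (i.injective h).symm
        simp [this]
      · simp
    ext x
    constructor
    · intro hx
      refine ⟨fun k => x (i k), fun k => hx _, funext fun q => ?_⟩
      obtain ⟨k, rfl⟩ := i.surjective q
      rw [hsum]
    · rintro ⟨a, ha, rfl⟩ q
      obtain ⟨k, rfl⟩ := i.surjective q
      rw [hsum]
      exact ha k
  · rw [eq_top_iff]
    intro x _
    have h1 : (fun q => |x q| + 1) ∈ T.orthant := fun q => by positivity
    have h2 : (fun q => x q + (|x q| + 1)) ∈ T.orthant := fun q => by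
      change 0 < x q + (|x q| + 1)
      linarith [neg_abs_le (x q)]
    have h3 : x = (fun q => x q + (|x q| + 1)) - fun q => |x q| + 1 := by ext q; simp
    rw [h3]
    exact Submodule.sub_mem _ (Submodule.subset_span h2) (Submodule.subset_span h1)

theorem CGraph.act_eq {T : CGraph} {A : GL T.Coord ℤ} {σ : Equiv.Perm T.Coord}
    (h : (A : Matrix T.Coord T.Coord ℤ) = σ.permMatrix ℤ) (x : T.Coord → ℝ) : act A x = x ∘ σ := by
  rw [act, h, ← Matrix.permMatrix_mulVec]
  congr 1
  ext i j
  simp [Equiv.Perm.permMatrix, PEquiv.toMatrix_apply]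

/-- An automorphism acts on the coordinates by a matrix of the group `autGL`. -/
theorem CGraph.exists_mem_autGL {T : CGraph} {f : WIso T.toWGraph T.toWGraph}
    (hf : f.Compat (S := T) (T := T)) : ∃ A ∈ T.autGL, ∀ x, act A x = x ∘ T.coordPerm f hf := by
  let σ := T.coordPerm f hf
  refine ⟨⟨σ.permMatrix ℤ, (σ⁻¹).permMatrix ℤ, ?_, ?_⟩, ⟨f, hf, rfl⟩, fun x => T.act_eq rfl x⟩
  · rw [← Matrix.permMatrix_mul]; simp
  · rw [← Matrix.permMatrix_mul]; simp

theorem CGraph.act_image_orthant (T : CGraph) {A : GL T.Coord ℤ} (hA : A ∈ T.autGL) :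
    act A '' T.orthant = T.orthant := by
  have h : ∀ A ∈ T.autGL, ∀ x ∈ T.orthant, act A x ∈ T.orthant := by
    rintro A ⟨f, hf, h⟩ x hx q
    rw [T.act_eq h]
    exact hx _
  refine Subset.antisymm (by rintro _ ⟨x, hx, rfl⟩; exact h A hA x hx) fun x hx => ?_
  refine ⟨act A⁻¹ x, h _ (T.autGL.inv_mem hA) x hx, ?_⟩
  rw [← act_mul, mul_inv_cancel, act_one]

/-- The faces of an orthant are given by the vanishing of some of the coordinates. -/
theorem CGraph.isFace_iff {T : CGraph} {F : Set (T.Coord → ℝ)} :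
    IsFace (closure T.orthant) F ↔
      ∃ Q : Set T.Coord, F = {x | (∀ q, 0 ≤ x q) ∧ ∀ q ∈ Q, x q = 0} := by
  classical
  constructor
  · rintro ⟨u, hu, rfl⟩
    refine ⟨{q | u (Pi.single q 1) ≠ 0}, ?_⟩
    have hpos : ∀ q, 0 ≤ u (Pi.single q 1) := fun q => hu _ <| T.mem_closure_orthant.2 fun q' => by
      by_cases h : q' = q
      · subst h; simp
      · simp [h]
    have hsum : ∀ x, u x = ∑ q, x q * u (Pi.single q 1) := by
      intro x
      conv_lhs => rw [pi_eq_sum_univ' x]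
      rw [map_sum]
      refine Finset.sum_congr rfl fun q _ => ?_
      rw [map_smul, smul_eq_mul]
    ext x
    rw [mem_ofPred_eq, mem_ofPred_eq, T.mem_closure_orthant]
    refine and_congr_right fun hx => ?_
    rw [hsum, Finset.sum_eq_zero_iff_of_nonneg fun q _ => mul_nonneg (hx q) (hpos q)]
    constructor
    · intro h q hq
      exact (mul_eq_zero.1 (h q (Finset.mem_univ q))).resolve_right hq
    · intro h q _
      by_cases hq : u (Pi.single q 1) = 0
      · rw [hq, mul_zero]
      · rw [h q hq, zero_mul]
  · rintro ⟨Q, rfl⟩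
    refine ⟨∑ q, if q ∈ Q then LinearMap.proj q else 0, ?_, ?_⟩
    · intro x hx
      rw [LinearMap.sum_apply]
      refine Finset.sum_nonneg fun q _ => ?_
      split_ifs
      · exact T.mem_closure_orthant.1 hx q
      · exact le_rfl
    · ext x
      rw [mem_ofPred_eq, mem_ofPred_eq, T.mem_closure_orthant]
      refine and_congr_right fun hx => ?_
      rw [LinearMap.sum_apply, Finset.sum_eq_zero_iff_of_nonneg]
      · refine ⟨fun h q _ => ?_, fun h q hq => ?_⟩
        · split_ifs with hq
          · exact h q hq
          · rfl
        · have := h q (Finset.mem_univ q)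
          rwa [if_pos hq] at this
      · intro q _
        split_ifs
        · exact hx q
        · exact le_rfl

section cellMap

variable {g : ℕ}

theorem continuous_point (T : HypType g) :
    Continuous fun x : {x : T.1.Coord → ℝ // ∀ q, 0 ≤ x q} => point T x.1 x.2 :=
  (continuous_quotient_mk' (s := PreSpace.setoid g)).comp
    (continuous_sigmaMk (σ := fun T : HypType g => {x : T.1.Coord → ℝ // ∀ q, 0 ≤ x q}) (i := T))

theorem continuous_cellMap (T : HypType g) : Continuous (cellMap T) :=
  Continuous.quotient_lift ((continuous_point T).comp
    (continuous_subtype_val.subtype_mk fun x => T.1.nonneg_of_mem_closure x.2)) _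

theorem zero_eq_empty {T : CGraph} {x : T.Coord → ℝ} (hx : x ∈ T.orthant) :
    {e | x (Quotient.mk _ e) = 0} = (∅ : Set T.E) :=
  eq_empty_of_forall_notMem fun e he => (hx (Quotient.mk _ e)).ne' he

/-- Points of the same closed orthant that are identified, one of which lies in the open orthant,
both lie in the open orthant and differ by an automorphism. -/
theorem exists_act_of_point_eq (hg : 2 ≤ g) {T : HypType g} {x y : T.1.Coord → ℝ}
    (hx : x ∈ T.1.orthant) {hy : ∀ q, 0 ≤ y q} (h : point T x (fun q => (hx q).le) = point T y hy) :
    ∃ A ∈ T.1.autGL, act A y = x := by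
  obtain ⟨θ, hθ⟩ := point_eq_iff.1 h
  have hxS := zero_eq_empty hx
  have hyS : {e | y (Quotient.mk _ e) = 0} = (∅ : Set T.1.E) := by
    have h1 : Nat.card {e : T.1.E // x (Quotient.mk _ e) ≠ 0} =
      Nat.card {e : T.1.E // y (Quotient.mk _ e) ≠ 0} := Nat.card_congr θ.onE
    have h2 : {e : T.1.E | x (Quotient.mk _ e) ≠ 0} = univ :=
      eq_univ_of_forall fun e => (hx _).ne'
    have h3 : {e : T.1.E | y (Quotient.mk _ e) ≠ 0} = univ := by
      refine Set.eq_of_subset_of_ncard_le (subset_univ _) ?_ (toFinite _)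
      rw [← h2]
      exact h1.le
    refine eq_empty_of_forall_notMem fun e he => ?_
    exact (h3 ▸ mem_univ e : e ∈ {e : T.1.E | y (Quotient.mk _ e) ≠ 0}) he
  obtain ⟨f, hf⟩ := exists_iso_of_contract_iso hxS hyS θ
  have hfc : f.Compat (S := T.1) (T := T.1) := HypType.compat hg f
  obtain ⟨A, hA, hact⟩ := CGraph.exists_mem_autGL hfc
  refine ⟨A, hA, ?_⟩
  rw [hact]
  ext q
  induction q using Quotient.inductionOn with
  | h e =>
    have he : e ∉ {e | x (Quotient.mk _ e) = 0} := fun h => (hx _).ne' h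
    have h1 := hθ (⟨e, he⟩ : {e // x (Quotient.mk _ e) ≠ 0})
    have h2 := hf e he
    have h3 : (y ∘ T.1.coordPerm f hfc) (Quotient.mk _ e) = y (Quotient.mk _ (f.onE e)) := rfl
    rw [h3, h2]
    exact h1

/-- The quotient of the open orthant is embedded: a closed subset is the preimage of the image of a closed
subset of the closed orthant, and such images are closed. -/
theorem isEmbedding_cellMap (hg : 2 ≤ g) (T : HypType g) : Topology.IsEmbedding fun p =>
    cellMap T (OrbitSpace.incl T.1.autGL T.1.orthant p) := by
  have hcont : Continuous fun p => cellMap T (OrbitSpace.incl T.1.autGL T.1.orthant p) := by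
    refine (continuous_cellMap T).comp ?_
    exact Continuous.quotient_map' (continuous_inclusion subset_closure) _
  refine ⟨⟨TopologicalSpace.ext_isClosed fun s => ?_⟩, ?_⟩
  · rw [isClosed_induced_iff]
    refine ⟨fun hs => ?_, fun ⟨Z, hZ, h⟩ => h ▸ hZ.preimage hcont⟩
    have hs' := hs.preimage (continuous_quotient_mk' (s := orbitSetoid T.1.autGL T.1.orthant))
    obtain ⟨K, hK, hKs⟩ := isClosed_induced_iff.1 hs'
    refine ⟨_, isClosed_point_image T hK, ?_⟩
    ext p
    induction p using Quotient.inductionOn with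
    | h x =>
      have hmem : ∀ x : T.1.orthant, x.1 ∈ K ↔ Quotient.mk _ x ∈ s := fun x => iff_of_eq
        (congrFun hKs x)
      constructor
      · rintro ⟨y, hy, hyK, h⟩
        obtain ⟨A, hA, hxy⟩ := exists_act_of_point_eq hg x.2 (hy := hy) h.symm
        have hyo : y ∈ T.1.orthant := by
          have h1 : act A⁻¹ x.1 = y := by rw [← hxy, ← act_mul, inv_mul_cancel, act_one]
          rw [← h1]
          exact (T.1.act_image_orthant (T.1.autGL.inv_mem hA)).subset (mem_image_of_mem _ x.2)
        have h2 : (Quotient.mk (orbitSetoid T.1.autGL T.1.orthant) ⟨y, hyo⟩) = Quotient.mk _ x :=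
          Quotient.sound ⟨A, hA, hxy⟩
        rw [← h2]
        exact (hmem ⟨y, hyo⟩).1 hyK
      · exact fun hx => ⟨x.1, fun q => (x.2 q).le, (hmem x).2 hx, rfl⟩
  · intro p p' h
    induction p using Quotient.inductionOn with
    | h x =>
      induction p' using Quotient.inductionOn with
      | h y =>
        obtain ⟨A, hA, hxy⟩ := exists_act_of_point_eq hg x.2 (y := y.1)
          (hy := fun q => (y.2 q).le) h
        exact (Quotient.sound (show (orbitSetoid T.1.autGL T.1.orthant) y x from ⟨A, hA, hxy⟩)).symm

end cellMap

/-! ### The faces of the cells -/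

section faces

variable {G T : CGraph} {S : Set G.E} {c : Contr G.toWGraph T.toWGraph S}

/-- Extension by zero along the coordinates of a contraction. -/
noncomputable def Contr.extend (hc : c.Compat) (y : T.Coord → ℝ) : G.Coord → ℝ :=
  Function.extend (Contr.coordMap hc) y 0

theorem Contr.extend_comp (hc : c.Compat) (y : T.Coord → ℝ) :
    Contr.extend hc y ∘ Contr.coordMap hc = y :=
  funext fun q => (Contr.coordMap_injective hc).extend_apply _ _ q

theorem Contr.extend_eq_zero (hc : c.Compat) (y : T.Coord → ℝ) {q : G.Coord}
    (hq : q ∉ range (Contr.coordMap hc)) : Contr.extend hc y q = 0 :=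
  Function.extend_apply' _ _ _ fun ⟨a, h⟩ => hq ⟨a, h⟩

/-- The face of the closed orthant on which the contracted edges have length zero. -/
def Contr.face (hc : c.Compat) : Set (G.Coord → ℝ) :=
  {x | (∀ q, 0 ≤ x q) ∧ ∀ q, q ∉ range (Contr.coordMap hc) → x q = 0}

theorem Contr.extend_mem_face (hc : c.Compat) {y : T.Coord → ℝ} (hy : ∀ q, 0 ≤ y q) :
    Contr.extend hc y ∈ Contr.face hc := by
  refine ⟨fun q => ?_, fun q hq => Contr.extend_eq_zero hc y hq⟩
  by_cases h : q ∈ range (Contr.coordMap hc)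
  · obtain ⟨q, rfl⟩ := h
    exact (hy q).trans (congrFun (Contr.extend_comp hc y) q).ge
  · exact (Contr.extend_eq_zero hc y h).ge

theorem Contr.eq_zero_of_mem_span (hc : c.Compat) {x : G.Coord → ℝ}
    (hx : x ∈ Submodule.span ℝ (Contr.face hc)) {q : G.Coord}
    (hq : q ∉ range (Contr.coordMap hc)) : x q = 0 := by
  have h : Submodule.span ℝ (Contr.face hc) ≤ LinearMap.ker (LinearMap.proj q : (G.Coord → ℝ) →ₗ[ℝ] ℝ) :=
    Submodule.span_le.2 fun x hx => hx.2 q hq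
  exact h hx

theorem Contr.extend_mem_span (hc : c.Compat) (y : T.Coord → ℝ) :
    Contr.extend hc y ∈ Submodule.span ℝ (Contr.face hc) := by
  have h : Contr.extend hc y =
      Contr.extend hc (fun q => max (y q) 0) - Contr.extend hc fun q => max (-y q) 0 := by
    ext q
    by_cases h : q ∈ range (Contr.coordMap hc)
    · obtain ⟨q, rfl⟩ := h
      have h1 := fun y => congrFun (Contr.extend_comp hc y) q
      simp only [Function.comp_apply] at h1
      rw [Pi.sub_apply, h1, h1, h1]
      exact (max_zero_sub_max_neg_zero_eq_self (y q)).symm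
    · rw [Pi.sub_apply, Contr.extend_eq_zero hc _ h, Contr.extend_eq_zero hc _ h,
        Contr.extend_eq_zero hc _ h, sub_zero]
  rw [h]
  exact Submodule.sub_mem _
    (Submodule.subset_span (Contr.extend_mem_face hc fun q => le_max_right _ _))
    (Submodule.subset_span (Contr.extend_mem_face hc fun q => le_max_right _ _))

theorem Contr.ext_of_comp (hc : c.Compat) {x x' : G.Coord → ℝ}
    (hx : ∀ q, q ∉ range (Contr.coordMap hc) → x q = 0)
    (hx' : ∀ q, q ∉ range (Contr.coordMap hc) → x' q = 0)
    (h : x ∘ Contr.coordMap hc = x' ∘ Contr.coordMap hc) : x = x' := by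
  ext q
  by_cases hq : q ∈ range (Contr.coordMap hc)
  · obtain ⟨q, rfl⟩ := hq
    exact congrFun h q
  · rw [hx q hq, hx' q hq]

/-- The span of a face is the space of the contracted type. -/
noncomputable def Contr.spanEquiv (hc : c.Compat) :
    Submodule.span ℝ (Contr.face hc) ≃ₗ[ℝ] (T.Coord → ℝ) :=
  LinearEquiv.ofBijective
    ((LinearMap.funLeft ℝ ℝ (Contr.coordMap hc)).comp (Submodule.span ℝ (Contr.face hc)).subtype) <| by
    constructor
    · intro x x' h
      exact Subtype.ext (Contr.ext_of_comp hc (fun _ => Contr.eq_zero_of_mem_span hc x.2)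
        (fun _ => Contr.eq_zero_of_mem_span hc x'.2) h)
    · exact fun y => ⟨⟨_, Contr.extend_mem_span hc y⟩, Contr.extend_comp hc y⟩

end faces

section cells

variable {g : ℕ} {rep : HypClass g → HypType g}

theorem mem_closedCell {c : HypClass g} {p : H2tr g} :
    p ∈ closedCell (fun c => cellMap (rep c)) c ↔ ∃ x hx, point (rep c) x hx = p := by
  constructor
  · rintro ⟨a, rfl⟩
    induction a using Quotient.inductionOn with
    | h x => exact ⟨x.1, (rep c).1.nonneg_of_mem_closure x.2, rfl⟩
  · rintro ⟨x, hx, rfl⟩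
    exact ⟨Quotient.mk _ ⟨x, CGraph.mem_closure_orthant.2 hx⟩, rfl⟩

theorem mem_openCell {c : HypClass g} {p : H2tr g} :
    p ∈ openCell (fun c => cellMap (rep c)) c ↔
      ∃ (x : _) (hx : x ∈ (rep c).1.orthant), point (rep c) x (fun q => (hx q).le) = p := by
  constructor
  · rintro ⟨a, rfl⟩
    induction a using Quotient.inductionOn with
    | h x => exact ⟨x.1, x.2, rfl⟩
  · rintro ⟨x, hx, rfl⟩
    exact ⟨Quotient.mk _ ⟨x, hx⟩, rfl⟩

/-- A point of a face is the point of the contracted type with the remaining coordinates. -/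
theorem point_comp {T U : HypType g} {S : Set T.1.E} {c : Contr T.1.toWGraph U.1.toWGraph S}
    (hc : c.Compat) (hS : T.1.Saturated S) {x : T.1.Coord → ℝ} (hx : x ∈ Contr.face hc) :
    point T x hx.1 = point U (x ∘ Contr.coordMap hc) (fun _ => hx.1 _) :=
  point_eq_iff.2 <| Contr.reduce_isom hc fun e he =>
    hx.2 _ fun h => (Contr.mem_range_coordMap hc hS e).1 h he

/-- The face on which the contracted edges have length zero is glued to the cell of the contraction. -/
theorem faceGluing {i l : HypClass g} {S : Set (rep i).1.E}
    {c : Contr (rep i).1.toWGraph (rep l).1.toWGraph S} (hc : c.Compat)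
    (hS : (rep i).1.Saturated S) :
    FaceGluing (fun c => cellMap (rep c)) i (Contr.face hc) l := by
  refine ⟨?_, Contr.spanEquiv hc, ?_, ?_, ?_⟩
  · ext p
    rw [mem_closedCell]
    constructor
    · rintro ⟨x, hx, hF, rfl⟩
      exact ⟨_, fun q => hF.1 _, (point_comp hc hS hF).symm⟩
    · rintro ⟨y, hy, rfl⟩
      have hF := Contr.extend_mem_face hc hy
      refine ⟨_, CGraph.mem_closure_orthant.2 hF.1, hF, ?_⟩
      have h1 := point_comp hc hS hF
      have h2 : ∀ y' hy', y' = y → point (rep l) y' hy' = point (rep l) y hy := by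
        rintro _ _ rfl; rfl
      exact h1.trans (h2 _ _ (Contr.extend_comp hc y))
  · ext y
    rw [CGraph.mem_closure_orthant]
    constructor
    · rintro ⟨x, hx, rfl⟩
      exact fun q => hx.1 _
    · exact fun hy => ⟨⟨_, Contr.extend_mem_span hc y⟩, Contr.extend_mem_face hc hy,
        Contr.extend_comp hc y⟩
  · ext y
    constructor
    · rintro ⟨x, hx, rfl⟩
      exact fun q => hx _
    · intro hy
      refine ⟨⟨_, Contr.extend_mem_span hc y⟩, fun q => ?_, Contr.extend_comp hc y⟩
      by_cases h : q ∈ range (Contr.coordMap hc)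
      · obtain ⟨q, rfl⟩ := h
        obtain ⟨z, hz⟩ := hy q
        exact ⟨z, (congrFun (Contr.extend_comp hc y) q).trans hz⟩
      · exact ⟨0, (Contr.extend_eq_zero hc y h).trans (by simp)⟩
  · intro x hx hL hF
    exact point_comp hc hS hF

theorem Contr.isFace {T : CGraph} {U : CGraph} {S : Set T.E} {c : Contr T.toWGraph U.toWGraph S}
    (hc : c.Compat) : IsFace (closure T.orthant) (Contr.face hc) :=
  CGraph.isFace_iff.2 ⟨(range (Contr.coordMap hc))ᶜ, rfl⟩

variable (hrep : ∀ c, (Quotient.mk _ (rep c) : HypClass g) = c)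

include hrep in
theorem exists_rep_isom (T : HypType g) : ∃ l, T.1.Isom (rep l).1 :=
  ⟨Quotient.mk _ T, (show (HypType.setoid g) T (rep (Quotient.mk _ T)) from
    Quotient.exact (hrep (Quotient.mk _ T)).symm)⟩

include hrep in
theorem eq_of_rep_isom {c c' : HypClass g} (h : (rep c).1.Isom (rep c').1) : c = c' := by
  rw [← hrep c, ← hrep c']
  exact Quotient.sound h

include hrep in
/-- Every union of classes of edges can be contracted to a representative. -/
theorem exists_rep_contr (hg : 2 ≤ g) (T : HypType g) {S : Set T.1.E} (hS : T.1.Saturated S) :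
    ∃ l, ∃ c : Contr T.1.toWGraph (rep l).1.toWGraph S, c.Compat := by
  obtain ⟨V, hV⟩ := T.exists_of_spec hg (T.1.contract_spec hS)
  obtain ⟨l, hl⟩ := exists_rep_isom hrep V
  obtain ⟨k, hk⟩ := hV.trans hl
  let d : Contr T.1.toWGraph (T.1.contract S).toWGraph S := T.1.toWGraph.toContract S
  refine ⟨l, d.comp (Contr.ofIso k) (by ext e; rw [d.preE_iff]; simp), fun e e' => ?_⟩
  exact (hk _ _).symm

theorem mem_face_of_zero {T U : CGraph} {x : T.Coord → ℝ} (hx : ∀ q, 0 ≤ x q)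
    {c : Contr T.toWGraph U.toWGraph {e | x (Quotient.mk _ e) = 0}} (hc : c.Compat) :
    x ∈ Contr.face hc := by
  refine ⟨hx, fun q hq => ?_⟩
  induction q using Quotient.inductionOn with
  | h e =>
    by_contra he
    exact hq ((Contr.mem_range_coordMap hc (T.saturated_zero x) e).2 he)

include hrep in
/-- The space is a stacky fan. -/
theorem isStackyFan (hg : 2 ≤ g) [Finite (HypClass g)] :
    IsStackyFan (X := H2tr g) (fun c => (rep c).1.orthant) (fun c => (rep c).1.autGL)
      (fun c => cellMap (rep c)) where
  finite := inferInstance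
  rational c := (rep c).1.orthant_isRationalOpenCone
  stable c A hA := (rep c).1.act_image_orthant hA
  cont c := continuous_cellMap (rep c)
  homeo c := isEmbedding_cellMap hg (rep c)
  cover := by
    refine eq_univ_of_forall fun p => ?_
    obtain ⟨T, x, hx, rfl⟩ := exists_point p
    obtain ⟨l, c, hc⟩ := exists_rep_contr hrep hg T (T.1.saturated_zero x)
    have hF := mem_face_of_zero hx hc
    rw [mem_iUnion]
    refine ⟨l, mem_openCell.2 ⟨x ∘ Contr.coordMap hc, fun q => ?_,
      (point_comp hc (T.1.saturated_zero x) hF).symm⟩⟩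
    refine (hx _).lt_of_ne fun h => ?_
    induction q using Quotient.inductionOn with
    | h a =>
      obtain ⟨e, rfl⟩ := c.onE.surjective a
      have h1 : x (Contr.coordMap hc (Quotient.mk _ (c.onE e))) = x (Quotient.mk _ e.1) :=
        congrArg x (Contr.coordMap_mk hc e)
      exact e.2 (h1.symm.trans h.symm)
  disj i j hij := by
    rw [Set.disjoint_left]
    intro p hp hp'
    obtain ⟨x, hx, rfl⟩ := mem_openCell.1 hp
    obtain ⟨y, hy, h⟩ := mem_openCell.1 hp'
    obtain ⟨θ, -⟩ := point_eq_iff.1 h.symm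
    obtain ⟨f, -⟩ := exists_iso_of_contract_iso (zero_eq_empty hx) (zero_eq_empty hy) θ
    exact hij (eq_of_rep_isom hrep ⟨f, HypType.compat hg f⟩)
  faces i F hF := by
    obtain ⟨Q, rfl⟩ := CGraph.isFace_iff.1 hF
    have hS : (rep i).1.Saturated {e | (Quotient.mk _ e : (rep i).1.Coord) ∈ Q} := by
      intro e e' h he
      have h1 : (Quotient.mk (rep i).1.rel e) = Quotient.mk _ e' := Quotient.sound h
      exact (congrArg (· ∈ Q) h1).mp he
    obtain ⟨l, c, hc⟩ := exists_rep_contr hrep hg (rep i) hS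
    have hQ : ∀ q, q ∈ Q ↔ q ∉ range (Contr.coordMap hc) := by
      intro q
      induction q using Quotient.inductionOn with
      | h e => rw [Contr.mem_range_coordMap hc hS, not_not]; rfl
    have hF : {x : (rep i).1.Coord → ℝ | (∀ q, 0 ≤ x q) ∧ ∀ q ∈ Q, x q = 0} = Contr.face hc := by
      ext x
      exact and_congr_right fun _ => forall_congr' fun q => imp_congr (hQ q) Iff.rfl
    exact ⟨l, hF ▸ faceGluing hc hS⟩
  inter i j := by
    ext p
    simp only [mem_iUnion, exists_prop]
    constructor
    · rintro ⟨hi, hj⟩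
      obtain ⟨x, hx, rfl⟩ := mem_closedCell.1 hi
      obtain ⟨y, hy, h⟩ := mem_closedCell.1 hj
      obtain ⟨l, c, hc⟩ := exists_rep_contr hrep hg (rep i) ((rep i).1.saturated_zero x)
      obtain ⟨d, hd⟩ := HypType.exists_contr_of_reduce_isom hg (point_eq_iff.1 h.symm) hc
      refine ⟨l, ⟨⟨_, Contr.isFace hc, faceGluing hc ((rep i).1.saturated_zero x)⟩,
        ⟨_, Contr.isFace hd, faceGluing hd ((rep j).1.saturated_zero y)⟩⟩, ?_⟩
      exact mem_closedCell.2 ⟨_, _, (point_comp hc ((rep i).1.saturated_zero x)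
        (mem_face_of_zero hx hc)).symm⟩
    · have hsub : ∀ l i, IsStackyFace (fun c => cellMap (rep c)) l i →
          closedCell (fun c => cellMap (rep c)) l ⊆ closedCell (fun c => cellMap (rep c)) i := by
        rintro l i ⟨F, -, h, -⟩
        rw [← h]
        rintro _ ⟨x, hx, -, rfl⟩
        exact ⟨_, rfl⟩
      rintro ⟨l, ⟨h, h'⟩, hp⟩
      exact ⟨hsub l i h hp, hsub l j h' hp⟩

/-- A closed cell is contained in another one if and only if its type is a specialisation. -/
theorem closedCell_subset_iff (hg : 2 ≤ g) (i j : HypClass g) :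
    closedCell (fun c => cellMap (rep c)) i ⊆ closedCell (fun c => cellMap (rep c)) j ↔
      (rep i).1.Spec (rep j).1 := by
  constructor
  · intro h
    let x : (rep i).1.Coord → ℝ := fun _ => 1
    have hx : x ∈ (rep i).1.orthant := fun _ => one_pos
    obtain ⟨y, hy, hxy⟩ := mem_closedCell.1 (h (mem_closedCell.2 ⟨x, fun q => (hx q).le, rfl⟩))
    have h0 : {e | x (Quotient.mk _ e) = 0} = (∅ : Set (rep i).1.E) := zero_eq_empty hx
    have hc : ∃ c : Contr (rep i).1.toWGraph (rep i).1.toWGraph {e | x (Quotient.mk _ e) = 0},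
        c.Compat := by
      rw [h0]
      exact ⟨Contr.ofIso (WIso.refl _), fun _ _ => Iff.rfl⟩
    obtain ⟨c, hc⟩ := hc
    obtain ⟨d, hd⟩ := HypType.exists_contr_of_reduce_isom hg (point_eq_iff.1 hxy.symm) hc
    exact ⟨_, (rep j).1.saturated_zero y, d, hd⟩
  · rintro ⟨S, hS, c, hc⟩
    rw [← (faceGluing hc hS).1]
    rintro _ ⟨x, hx, -, rfl⟩
    exact ⟨_, rfl⟩

end cells

/-! ### The maximal cells -/

theorem CGraph.Isom.genus_eq {T U : CGraph} (h : T.Isom U) : T.genus = U.genus := by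
  obtain ⟨f, -⟩ := h
  exact (Contr.ofIso f).genus_eq.symm

theorem CGraph.Spec.card_le {T U : CGraph} (h : T.Spec U) : Nat.card T.E ≤ Nat.card U.E := by
  obtain ⟨S, -, c, -⟩ := h
  have := c.card_edges
  omega

theorem CGraph.Spec.card_coord_le {T U : CGraph} (h : T.Spec U) :
    Nat.card T.Coord ≤ Nat.card U.Coord := by
  obtain ⟨S, -, c, hc⟩ := h
  exact Nat.card_le_card_of_injective _ (Contr.coordMap_injective hc)

/-- A specialisation with the same number of edges is an isomorphism. -/
theorem CGraph.Spec.isom {T U : CGraph} (h : T.Spec U) (hc : Nat.card U.E ≤ Nat.card T.E) :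
    U.Isom T := by
  obtain ⟨S, -, c, hc⟩ := h
  have h1 := c.card_edges
  have h2 : Nat.card S = 0 := by omega
  obtain rfl : S = ∅ := by
    rcases Nat.card_eq_zero.1 h2 with h | h
    · exact Set.isEmpty_coe_sort.1 h
    · exact (not_finite S).elim
  exact Contr.Compat.isom (c := Contr.ofIso (WIso.refl U.toWGraph)) (fun _ _ => Iff.rfl) hc

namespace LegTree

variable {R : LegTree}

theorem card_edges_dbl (R : LegTree) : Nat.card R.dbl.E = 2 * Nat.card R.E + Nat.card R.L := by
  have : Nat.card ((R.E × Bool) ⊕ R.L) = 2 * Nat.card R.E + Nat.card R.L := by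
    rw [Nat.card_sum, Nat.card_prod]
    simp [mul_comm]
  exact this

theorem card_coord_dbl (R : LegTree) : Nat.card R.dbl.Coord = Nat.card R.E + Nat.card R.L := by
  have h : Function.Surjective (Sum.map Prod.fst id : (R.E × Bool) ⊕ R.L → R.E ⊕ R.L) := by
    rintro (t | l)
    · exact ⟨Sum.inl (t, false), rfl⟩
    · exact ⟨Sum.inr l, rfl⟩
  rw [← Nat.card_sum]
  exact Nat.card_congr (Setoid.quotientKerEquivOfSurjective _ h)

end LegTree

section cells

variable {g : ℕ}

/-- Every hyperelliptic type is a specialisation of a ladder of a tree on `g - 1` vertices. -/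
theorem HypType.exists_spec_ladder (hg : 3 ≤ g) (T : HypType g) :
    ∃ C : CubicTree (g - 1), T.1.Spec (ladder C.1) := by
  obtain ⟨R, h3, hL, hs⟩ := T.exists_resolution (by omega)
  have hW : Nat.card R.W = g - 1 := by
    have := R.card_add_two h3
    omega
  let i : R.W ≃ Fin (g - 1) := Finite.equivFinOfCardEq hW
  let φ : R.graph ≃g R.graph.map i.toEmbedding := SimpleGraph.Iso.map i R.graph
  refine ⟨⟨R.graph.map i.toEmbedding, φ.isTree_iff.1 R.graph_isTree, fun v => ?_⟩, ?_⟩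
  · obtain ⟨v, rfl⟩ := φ.surjective v
    have h1 := R.val_eq_add v
    have h2 := h3 v
    have h4 : ((R.graph.map i.toEmbedding).neighborSet (φ v)).ncard = (R.graph.neighborSet v).ncard := by
      rw [← Nat.card_coe_set_eq, ← Nat.card_coe_set_eq]
      exact Nat.card_congr (φ.mapNeighborSet v).symm
    omega
  · exact hs.trans ((R.dbl_isom_ladder h3 (by omega)).trans (ladder_isom φ)).symm.spec

/-- The ladders of trees on `n` vertices, their numbers of edges and of classes of edges, and their
genus. -/
theorem CubicTree.ladder_data {n : ℕ} (hn : 2 ≤ n) (C : CubicTree n) :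
    Nat.card (ladder C.1).E = 3 * n ∧ Nat.card (ladder C.1).Coord = 2 * n + 1 ∧
      (ladder C.1).genus = n + 1 ∧
      ∃ R : LegTree, (∀ y, R.val y = 3) ∧ Nat.card R.L = n + 2 ∧ (ladder C.1).Isom R.dbl := by
  obtain ⟨R, h3, hW, hR⟩ := exists_ladder_isom_dbl C.2.1 C.2.2 (by simpa using hn)
  rw [Nat.card_eq_fintype_card (α := Fin n), Fintype.card_fin] at hW
  have h1 := R.card_add_two h3
  have h2 := R.card
  have h4 := R.genus_dbl
  have h5 := R.card_edges_dbl
  have h6 := R.card_coord_dbl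
  have h7 := hR.genus_eq
  have h8 := le_antisymm hR.symm.spec.card_le hR.spec.card_le
  have h9 := le_antisymm hR.symm.spec.card_coord_le hR.spec.card_coord_le
  refine ⟨by omega, by omega, ?_, R, h3, by omega, hR⟩
  have h10 : (ladder C.1).genus = (Nat.card R.L : ℤ) - 1 := h7.trans h4
  omega

/-- Ladders of trees on `g - 1` vertices are hyperelliptic types of genus `g`. -/
theorem CubicTree.exists_hypType (hg : 3 ≤ g) (C : CubicTree (g - 1)) :
    ∃ V : HypType g, (ladder C.1).Isom V.1 := by
  obtain ⟨-, -, -, R, h3, hL, hR⟩ := C.ladder_data (by omega)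
  exact R.exists_hypType (by omega) (fun y => (h3 y).ge) (by omega) hR.symm.spec

/-- A type is determined by a ladder and a set of edges of it that are contracted. -/
theorem finite_hypClass (hg : 3 ≤ g) : Finite (HypClass g) := by
  have h : ∀ c : HypClass g, ∃ (C : CubicTree (g - 1)) (S : Set (ladder C.1).E),
      (Quotient.out c).1.Isom ((ladder C.1).contract S) := by
    intro c
    obtain ⟨C, hC⟩ := (Quotient.out c).exists_spec_ladder hg
    obtain ⟨S, -, hS⟩ := hC.exists_isom
    exact ⟨C, S, hS⟩
  choose C S hS using h
  have : Finite (CubicTree (g - 1)) := Subtype.finite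
  refine Finite.of_injective (β := Σ C : CubicTree (g - 1), Set (ladder C.1).E)
    (fun c => ⟨C c, S c⟩) fun c c' h => ?_
  have h1 : ∀ p p' : Σ C : CubicTree (g - 1), Set (ladder C.1).E, p = p' →
      ((ladder p.1.1).contract p.2).Isom ((ladder p'.1.1).contract p'.2) := by
    rintro p _ rfl
    exact CGraph.Isom.refl _
  rw [← Quotient.out_eq c, ← Quotient.out_eq c']
  exact Quotient.sound (((hS c).trans (h1 _ _ h)).trans (hS c').symm)

/-- There are trees of valence at most three on `g - 1` vertices: resolve the tree with one vertex and
`g + 1` legs. -/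
theorem exists_cubicTree (hg : 3 ≤ g) : Nonempty (CubicTree (g - 1)) := by
  let R : LegTree :=
    { W := Unit
      E := Empty
      L := Fin (g + 1)
      finW := inferInstance
      finE := inferInstance
      finL := inferInstance
      root := fun _ => ()
      leg := fun _ => ()
      conn := ⟨⟨()⟩, fun _ _ => Setoid.refl' _ _⟩
      card := by simp }
  have h3 : ∀ y, 3 ≤ R.val y := by
    intro y
    have h1 : R.val y = Nat.card ((Empty × Bool) ⊕ Fin (g + 1)) :=
      Nat.card_congr (Equiv.subtypeUnivEquiv fun _ => rfl)
    have h2 : Nat.card ((Empty × Bool) ⊕ Fin (g + 1)) = g + 1 := by simp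
    omega
  obtain ⟨V, -⟩ := R.exists_hypType (g := g) (by omega) h3 (by simp [R])
    (CGraph.Isom.refl R.dbl).spec
  obtain ⟨C, -⟩ := V.exists_spec_ladder hg
  exact ⟨C⟩

variable {rep : HypClass g → HypType g} (hrep : ∀ c, (Quotient.mk _ (rep c) : HypClass g) = c)

theorem isMaxCell_iff_spec (hg : 2 ≤ g) (i : HypClass g) :
    IsMaxCell (fun c => cellMap (rep c)) i ↔
      ∀ j, (rep i).1.Spec (rep j).1 → (rep j).1.Spec (rep i).1 :=
  forall_congr' fun j => imp_congr (closedCell_subset_iff hg i j) (closedCell_subset_iff hg j i)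

include hrep in
/-- The cells of the ladders of trees on `g - 1` vertices are the maximal cells. -/
theorem isMaxCell_iff (hg : 3 ≤ g) (i : HypClass g) :
    IsMaxCell (fun c => cellMap (rep c)) i ↔
      ∃ C : CubicTree (g - 1), (rep i).1.Isom (ladder C.1) := by
  rw [isMaxCell_iff_spec (by omega)]
  constructor
  · intro h
    obtain ⟨C, hC⟩ := (rep i).exists_spec_ladder hg
    obtain ⟨V, hV⟩ := C.exists_hypType hg
    obtain ⟨j, hj⟩ := exists_rep_isom hrep V
    have h1 := h j (hC.trans (hV.trans hj).symm.spec)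
    have h2 : (ladder C.1).Spec (rep i).1 := (hV.trans hj).symm.spec.trans h1
    exact ⟨C, h2.isom hC.card_le⟩
  · rintro ⟨C, hC⟩ j hj
    obtain ⟨C', hC'⟩ := (rep j).exists_spec_ladder hg
    have h1 := (C.ladder_data (by omega)).1
    have h2 := (C'.ladder_data (by omega)).1
    have h3 := hC'.card_le
    have h4 := hC.spec.card_le
    exact (hj.isom (by omega)).symm.spec

include hrep in
theorem isMaxCell_iff_wIso (hg : 3 ≤ g) (c : HypClass g) :
    IsMaxCell (fun c => cellMap (rep c)) c ↔
      ∃ (n : ℕ) (T : CubicTree n), 2 ≤ n ∧ (ladder T.1).toWGraph.genus = g ∧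
        Nonempty (WIso (rep c).1.toWGraph (ladder T.1).toWGraph) := by
  rw [isMaxCell_iff hrep hg]
  constructor
  · rintro ⟨C, f, hf⟩
    refine ⟨g - 1, C, by omega, ?_, ⟨f⟩⟩
    rw [(C.ladder_data (by omega)).2.2.1]
    omega
  · rintro ⟨n, C, hn, hgen, ⟨f⟩⟩
    have h1 := (C.ladder_data hn).2.2.1
    obtain rfl : n = g - 1 := by omega
    obtain ⟨V, k, hk⟩ := C.exists_hypType hg
    refine ⟨C, f, fun e e' => ?_⟩
    have h2 := HypType.compat (by omega) (T := rep c) (U := V) (f.trans k) e e'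
    exact h2.trans (hk _ _).symm

include hrep in
theorem isPureOfDim (hg : 3 ≤ g) : IsPureOfDim (fun c => cellMap (rep c)) (2 * g - 1) := by
  have hcard : ∀ (c : HypClass g) (C : CubicTree (g - 1)), (rep c).1.Isom (ladder C.1) →
      Fintype.card (rep c).1.Coord = 2 * g - 1 := by
    intro c C hC
    have h1 := (C.ladder_data (by omega)).2.1
    have h2 := le_antisymm hC.symm.spec.card_coord_le hC.spec.card_coord_le
    rw [← Nat.card_eq_fintype_card]
    omega
  refine ⟨⟨?_, ?_⟩, fun i hi => ?_⟩
  · obtain ⟨C⟩ := exists_cubicTree hg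
    obtain ⟨V, hV⟩ := C.exists_hypType hg
    obtain ⟨j, hj⟩ := exists_rep_isom hrep V
    exact ⟨j, hcard j C (hV.trans hj).symm⟩
  · rintro _ ⟨i, rfl⟩
    obtain ⟨C, hC⟩ := (rep i).exists_spec_ladder hg
    have h1 := (C.ladder_data (by omega)).2.1
    have h2 := hC.card_coord_le
    change Fintype.card (rep i).1.Coord ≤ _
    rw [← Nat.card_eq_fintype_card]
    omega
  · obtain ⟨C, hC⟩ := (isMaxCell_iff hrep hg i).1 hi
    exact hcard i C hC

include hrep in
theorem exists_equiv_maxCell (hg : 3 ≤ g) : ∃ f : Quotient (CubicTree.setoid (g - 1)) ≃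
    {c : HypClass g // IsMaxCell (fun c => cellMap (rep c)) c},
    ∀ T : CubicTree (g - 1), (rep (f (Quotient.mk _ T)).1).1.Isom (ladder T.1) := by
  have h : ∀ C : CubicTree (g - 1), ∃ c, (rep c).1.Isom (ladder C.1) := fun C => by
    obtain ⟨V, hV⟩ := C.exists_hypType hg
    obtain ⟨j, hj⟩ := exists_rep_isom hrep V
    exact ⟨j, (hV.trans hj).symm⟩
  choose F hF using h
  let f : Quotient (CubicTree.setoid (g - 1)) →
      {c : HypClass g // IsMaxCell (fun c => cellMap (rep c)) c} :=
    Quotient.lift (fun C => ⟨F C, (isMaxCell_iff hrep hg _).2 ⟨C, hF C⟩⟩) fun C C' ⟨k⟩ =>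
      Subtype.ext (eq_of_rep_isom hrep (((hF C).trans (ladder_isom k)).trans (hF C').symm))
  have hf : Function.Bijective f := by
    constructor
    · intro a a' h
      induction a using Quotient.inductionOn with
      | h C =>
        induction a' using Quotient.inductionOn with
        | h C' =>
          have h1 : F C = F C' := congrArg Subtype.val h
          have h2 := hF C
          rw [h1] at h2
          exact Quotient.sound (nonempty_iso_of_ladder_isom C.2.1.connected (by simp; omega)
            C'.2.1.connected (by simp; omega) (h2.symm.trans (hF C')))
    · rintro ⟨c, hc⟩
      obtain ⟨C, hC⟩ := (isMaxCell_iff hrep hg c).1 hc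
      exact ⟨Quotient.mk _ C, Subtype.ext (eq_of_rep_isom hrep ((hF C).trans hC.symm))⟩
  exact ⟨Equiv.ofBijective f hf, hF⟩

end cells

end HypTrop

open HypTrop in
theorem theoremt (g : ℕ) (hg : 3 ≤ g) (rep : HypClass g → HypType g)
    (hrep : ∀ c, (Quotient.mk _ (rep c) : HypClass g) = c) :
    -- the space is a stacky fan, with one cell for every isomorphism class of types
    IsStackyFan (X := H2tr g) (fun c => (rep c).1.orthant) (fun c => (rep c).1.autGL)
      (fun c => cellMap (rep c)) ∧
    -- it is pure of dimension `2g - 1`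
    IsPureOfDim (fun c => cellMap (rep c)) (2 * g - 1) ∧
    -- the maximal cells are exactly those whose graphs are ladders of genus `g`
    (∀ c : HypClass g, IsMaxCell (fun c => cellMap (rep c)) c ↔
      ∃ (n : ℕ) (T : CubicTree n), 2 ≤ n ∧ (ladder T.1).toWGraph.genus = g ∧
        Nonempty (WIso (rep c).1.toWGraph (ladder T.1).toWGraph)) ∧
    -- `T ↦ L(T)` is a bijection from the trees on `g - 1` vertices to the maximal cells
    ∃ f : Quotient (CubicTree.setoid (g - 1)) ≃
        {c : HypClass g // IsMaxCell (fun c => cellMap (rep c)) c},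
      ∀ T : CubicTree (g - 1), (rep (f (Quotient.mk _ T)).1).1.Isom (ladder T.1) := by
  have := finite_hypClass hg
  exact ⟨isStackyFan hrep (by omega), isPureOfDim hrep hg, isMaxCell_iff_wIso hrep hg,
    exists_equiv_maxCell hrep hg⟩
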